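/- Let $d\ge 2$. For $n\ge 1$ let $\mathcal V^{(n)}$ be the group of all unitaries on $(\mathbb C^d)^{\otimes n}$ that commute with $u^{\otimes n}$ for every $u\in\mathrm{SU}(d)$, and let $\mathcal{SV}^{(n)}=[\mathcal V^{(n)},\mathcal V^{(n)}]$ be its commutator subgroup. For $k\le n$ let $\mathcal V^{(n)}_k$ be the subgroup generated by the $k$-qudit gates in $\mathcal V^{(n)}$, i.e. by the elements of $\mathcal V^{(n)}$ of the form $A\otimes\mathbb I^{\otimes (n-k)}$ up to a permutation of the qudits. A set of gates is called semi-universal on $n$ qudits if the group that it generates contains $\mathcal{SV}^{(n)}$. Let $\mathbf P(\sigma)$, $\sigma\in\mathbb S_n$, be the operators permuting the qudits, and $\mathbf P_{ij}$ the swap of qudits $i\ne j$. For $\lambda=(3,1)$ and $\lambda=(2,1,1)$ let $[\mathbf P_\lambda(\sigma)]$, $\sigma\in\mathbb S_4$, be the matrices of the irreducible representation $\lambda$ of $\mathbb S_4$ on $\mathcal M_\lambda=\mathbb C^3$ in Young's orthonormal basis: $$[\mathbf P_{3,1}(12)]=\mathrm{diag}(1,-1,1),\quad [\mathbf P_{3,1}(23)]=\begin{pmatrix}-\frac12&\frac{\sqrt3}2&0\\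 \frac{\sqrt3}2&\frac12&0\\0&0&1\end{pmatrix},\quad [\mathbf P_{3,1}(34)]=\begin{pmatrix}\frac13&0&\frac{2\sqrt2}3\\0&1&0\\ \frac{2\sqrt2}3&0&-\frac13\end{pmatrix},$$ $$[\mathbf P_{2,1,1}(12)]=\mathrm{diag}(1,-1,-1),\quad [\mathbf P_{2,1,1}(23)]=\begin{pmatrix}-\frac12&\frac{\sqrt3}2&0\\ \frac{\sqrt3}2&\frac12&0\\0&0&-1\end{pmatrix},\quad [\mathbf P_{2,1,1}(34)]=\begin{pmatrix}-1&0&0\\0&-\frac13&\frac{2\sqrt2}3\\0&\frac{2\sqrt2}3&\frac13\end{pmatrix},$$ and let $J=\begin{pmatrix}0&1&0\\-1&0&0\\0&0&1\end{pmatrix}$, so that $J[\mathbf P_{3,1}(\sigma)]J^{T}=\mathrm{sgn}(\sigma)[\mathbf P_{2,1,1}(\sigma)]$. For $Y\in\mathcal V^{(4)}$ let $\pi_\lambda(Y)$ be the component of $Y$ in the multiplicity space $\mathcal M_\lambda$, i.e. the $3\times 3$ matrix $v$ such that $Y$ acts as $\mathbb I\otimes v$ on the $\lambda$-sector $\mathcal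 Q_\lambda\otimes\mathcal M_\lambda\subset(\mathbb C^d)^{\otimes 4}$; equivalently, $YT=Tv$ for every linear map $T:\mathbb C^3\to(\mathbb C^d)^{\otimes 4}$ with $\mathbf P(\sigma)T=T[\mathbf P_\lambda(\sigma)]$ for all $\sigma\in\mathbb S_4$. Say that $Y$ breaks the correlation if $$J\,\pi_{3,1}(Y)\,J^{T}\ne e^{i\varphi}\,\pi_{2,1,1}(Y)^{*}\qquad\text{for all }\varphi\in\mathbb R,$$ where $^*$ is the entrywise complex conjugate. 1. Let $d\ge 3$ and $Y\in\mathcal V^{(4)}$. Then $\pi_{3,1}(Y)$ and $\pi_{2,1,1}(Y)$ exist and are unique, and the 2-qudit gates together with $Y$ are semi-universal on $4$ qudits, i.e. $\mathcal{SV}^{(4)}\subset\langle Y,\,V: V\in\mathcal V^{(4)}_2\rangle$, if and only if $Y$ breaks the correlation. 2. Let $S\in\mathcal V^{(3)}\setminus\mathcal V^{(3)}_2$. Then $S\otimes\mathbb I$ breaks the correlation (for $d\ge3$), and $S\otimes\mathbb I$ together with the 2-qudit gates is semi-universal on $4$ qudits: $\mathcal{SV}^{(4)}\subset\langle S\otimes\mathbb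 I,\,V: V\in\mathcal V^{(4)}_2\rangle$, and also $\mathcal{SV}^{(4)}\subset\langle S\otimes\mathbb I,\,\exp(i\theta\mathbf P_{ij}): i\neq j,\ \theta\in\mathbb R\rangle$. (For $d=2$ no such $S$ exists.) -/

import Mathlib

open scoped Matrix Kronecker

noncomputable section

namespace QuditCircuit

/-- Operators on `n` qudits of dimension `d`: matrices in the product basis `|x₁ ⋯ xₙ⟩` of
`(ℂ^d)^{⊗ n}`, which is indexed by the functions `Fin n → Fin d`. -/
abbrev Op (d n : ℕ) : Type := Matrix (Fin n → Fin d) (Fin n → Fin d) ℂ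

/-- The group of unitaries on `(ℂ^d)^{⊗ n}`. -/
abbrev UnitaryGrp (d n : ℕ) : Type := Matrix.unitaryGroup (Fin n → Fin d) ℂ

/-- The tensor power `u^{⊗ n}`. -/
def tensorPow (d n : ℕ) (u : Matrix (Fin d) (Fin d) ℂ) : Op d n :=
  Matrix.of fun x y => ∏ i, u (x i) (y i)

/-- The operator `P(σ)` that permutes the qudits: `P(σ) |y⟩ = |y ∘ σ⁻¹⟩`. -/
def permOp (d n : ℕ) (σ : Equiv.Perm (Fin n)) : Op d n :=
  Matrix.of fun x y => if y = x ∘ σ then 1 else 0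

/-- The group `𝒱⁽ⁿ⁾` of all `SU(d)`-invariant unitaries on `n` qudits, i.e. of the unitaries that
commute with `u^{⊗ n}` for all `u ∈ SU(d)`. -/
def invariantGroup (d n : ℕ) : Subgroup (UnitaryGrp d n) where
  carrier := {V | ∀ u ∈ Matrix.specialUnitaryGroup (Fin d) ℂ,
    Commute (V : Op d n) (tensorPow d n u)}
  one_mem' := fun _ _ => Commute.one_left _
  mul_mem' := fun ha hb u hu => (ha u hu).mul_left (hb u hu)
  inv_mem' := by
    intro V hV u hu
    have h := hV u hu
    have h1 : ((V⁻¹ : UnitaryGrp d n) : Op d n) * (V : Op d n) = 1 := by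
      rw [← Submonoid.coe_mul, inv_mul_cancel]; rfl
    have h2 : (V : Op d n) * ((V⁻¹ : UnitaryGrp d n) : Op d n) = 1 := by
      rw [← Submonoid.coe_mul, mul_inv_cancel]; rfl
    change ((V⁻¹ : UnitaryGrp d n) : Op d n) * _ = _ * ((V⁻¹ : UnitaryGrp d n) : Op d n)
    calc ((V⁻¹ : UnitaryGrp d n) : Op d n) * tensorPow d n u
        = ((V⁻¹ : UnitaryGrp d n) : Op d n) * (tensorPow d n u * (V : Op d n))
            * ((V⁻¹ : UnitaryGrp d n) : Op d n) := by
          rw [mul_assoc, mul_assoc, h2, mul_one]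
      _ = tensorPow d n u * ((V⁻¹ : UnitaryGrp d n) : Op d n) := by
          rw [← h.eq, ← mul_assoc, h1, one_mul]

/-- The operator on `n` qudits that acts as `A` on the `k` distinct qudits `e 0, …, e (k - 1)` and
as the identity on the other ones: `A ⊗ 𝕀^{⊗ (n - k)}` up to a permutation of the qudits. -/
def localOp (d : ℕ) {k n : ℕ} (e : Fin k ↪ Fin n) (A : Op d k) : Op d n :=
  Matrix.of fun x y => if ∀ j, j ∉ Set.range e → x j = y j then A (x ∘ e) (y ∘ e) else 0

open Classical in
/-- Splitting the index set of the product basis into the qudits in the range of `e` and the other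
ones. -/
def splitEquiv (d : ℕ) {k n : ℕ} (e : Fin k ↪ Fin n) :
    (Fin n → Fin d) ≃ (Fin k → Fin d) × ({j // ¬ j ∈ Set.range e} → Fin d) :=
  (Equiv.piEquivPiSubtypeProd (fun j => j ∈ Set.range e) (fun _ => Fin d)).trans
    (Equiv.prodCongr
      (Equiv.arrowCongr (Equiv.ofInjective e e.injective).symm (Equiv.refl (Fin d)))
      (Equiv.refl _))

open Classical in
theorem localOp_eq (d : ℕ) {k n : ℕ} (e : Fin k ↪ Fin n) (A : Op d k) :
    localOp d e A =
      (A ⊗ₖ (1 : Matrix ({j // ¬ j ∈ Set.range e} → Fin d) _ ℂ)).submatrix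
        (splitEquiv d e) (splitEquiv d e) := by
  ext x y
  have h1 : ∀ z, (splitEquiv d e z).1 = z ∘ e := fun z => by
    funext i; simp [splitEquiv, Equiv.piEquivPiSubtypeProd, Equiv.arrowCongr]
  have h2 : ∀ z, (splitEquiv d e z).2 = fun j => z j.1 := fun z => by
    funext i; simp [splitEquiv, Equiv.piEquivPiSubtypeProd]
  simp only [localOp, Matrix.of_apply, Matrix.submatrix_apply, Matrix.kroneckerMap_apply, h1, h2,
    Matrix.one_apply, mul_ite, mul_one, mul_zero]
  refine if_congr ?_ rfl rfl
  rw [funext_iff]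
  exact ⟨fun h j => h j.1 j.2, fun h j hj => h ⟨j, hj⟩⟩

theorem localOp_mem (d : ℕ) {k n : ℕ} (e : Fin k ↪ Fin n) (A : UnitaryGrp d k) :
    localOp d e (A : Op d k) ∈ Matrix.unitaryGroup (Fin n → Fin d) ℂ := by
  classical
  have hA : (A : Op d k) * star (A : Op d k) = 1 := Matrix.mem_unitaryGroup_iff.mp A.2
  rw [Matrix.star_eq_conjTranspose] at hA
  rw [Matrix.mem_unitaryGroup_iff, Matrix.star_eq_conjTranspose, localOp_eq,
    Matrix.conjTranspose_submatrix, Matrix.submatrix_mul_equiv, Matrix.conjTranspose_kronecker,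
    ← Matrix.mul_kronecker_mul, hA, Matrix.conjTranspose_one, mul_one, Matrix.one_kronecker_one,
    Matrix.submatrix_one_equiv]

/-- The gate `A`, applied to the qudits `e 0, …, e (k - 1)`, as a unitary on `n` qudits. -/
def localGate (d : ℕ) {k n : ℕ} (e : Fin k ↪ Fin n) (A : UnitaryGrp d k) : UnitaryGrp d n :=
  ⟨localOp d e (A : Op d k), localOp_mem d e A⟩

/-- The group `𝒱ₖ⁽ⁿ⁾` generated by the `k`-qudit `SU(d)`-invariant unitaries on `n` qudits. -/
def localGroup (d k n : ℕ) : Subgroup (UnitaryGrp d n) :=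
  Subgroup.closure {U | U ∈ invariantGroup d n ∧
    ∃ (e : Fin k ↪ Fin n) (A : UnitaryGrp d k), U = localGate d e A}

/-- The gates `exp(i θ P_{ij})`, with `i ≠ j` and `θ` real. -/
def exchangeGates (d n : ℕ) : Set (UnitaryGrp d n) :=
  {U | ∃ (i j : Fin n) (θ : ℝ), i ≠ j ∧
    (U : Op d n) = NormedSpace.exp ((Complex.I * (θ : ℂ)) • permOp d n (Equiv.swap i j))}

/-- A set of gates is semi-universal on `n` qudits if the group that it generates contains the
commutator subgroup `𝒮𝒱⁽ⁿ⁾ = [𝒱⁽ⁿ⁾, 𝒱⁽ⁿ⁾]`. -/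
def SemiUniversal (d n : ℕ) (gates : Set (UnitaryGrp d n)) : Prop :=
  ⁅invariantGroup d n, invariantGroup d n⁆ ≤ Subgroup.closure gates

/-- Young's orthogonal form of the irrep `(3,1)` of `𝕊₄`: the matrices of `(12)`, `(23)`, `(34)`. -/
def young31 : Fin 3 → Matrix (Fin 3) (Fin 3) ℂ :=
  ![!![1, 0, 0; 0, -1, 0; 0, 0, 1],
    !![-1 / 2, (√3 : ℝ) / 2, 0; (√3 : ℝ) / 2, 1 / 2, 0; 0, 0, 1],
    !![1 / 3, 0, 2 * (√2 : ℝ) / 3; 0, 1, 0; 2 * (√2 : ℝ) / 3, 0, -1 / 3]]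

/-- Young's orthogonal form of the irrep `(2,1,1)` of `𝕊₄`: the matrices of `(12)`, `(23)`,
`(34)`. -/
def young211 : Fin 3 → Matrix (Fin 3) (Fin 3) ℂ :=
  ![!![1, 0, 0; 0, -1, 0; 0, 0, -1],
    !![-1 / 2, (√3 : ℝ) / 2, 0; (√3 : ℝ) / 2, 1 / 2, 0; 0, 0, -1],
    !![-1, 0, 0; 0, -1 / 3, 2 * (√2 : ℝ) / 3; 0, 2 * (√2 : ℝ) / 3, 1 / 3]]

/-- The orthogonal matrix `J`, with `J P_{3,1}(σ) Jᵀ = sgn(σ) P_{2,1,1}(σ)` for all `σ ∈ 𝕊₄`. -/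
def matJ : Matrix (Fin 3) (Fin 3) ℂ := !![0, 1, 0; -1, 0, 0; 0, 0, 1]

/-- `J P_{3,1}(σ) Jᵀ = sgn(σ) P_{2,1,1}(σ)` for the adjacent transpositions, which generate `𝕊₄`. -/
theorem matJ_young31 (k : Fin 3) : matJ * young31 k * matJᵀ = -young211 k := by
  fin_cases k <;> ext a b <;> fin_cases a <;> fin_cases b <;>
    simp [matJ, young31, young211, Matrix.mul_apply, Fin.sum_univ_three, Matrix.vecHead,
      Matrix.vecTail] <;> ring

/-- `T : ℂ³ → (ℂ^d)^{⊗ 4}` intertwines the irrep `ℳ` of `𝕊₄`, in which the adjacent transpositions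
`(k k+1)` act by the matrices `ρ k`, with the permutations of the qudits: `P(σ) T = T ρ(σ)` for the
adjacent transpositions, which generate `𝕊₄`. By Schur-Weyl duality the space `𝒬` of all such `T` is
the irrep of `SU(d)` paired with `ℳ`, and `𝒬 ⊗ ℳ → (ℂ^d)^{⊗ 4}`, `T ⊗ x ↦ T x`, is the inclusion
of the sector. -/
def IsIntertwiner (d : ℕ) (ρ : Fin 3 → Matrix (Fin 3) (Fin 3) ℂ)
    (T : Matrix (Fin 4 → Fin d) (Fin 3) ℂ) : Prop :=
  ∀ k : Fin 3, permOp d 4 (Equiv.swap k.castSucc k.succ) * T = T * ρ k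

/-- `V` acts as `𝕀_𝒬 ⊗ v` on the sector `𝒬 ⊗ ℳ` of `ρ`: `V (T x) = T (v x)` for all `T`, `x`. -/
def IsComponent (d : ℕ) (ρ : Fin 3 → Matrix (Fin 3) (Fin 3) ℂ) (V : Op d 4)
    (v : Matrix (Fin 3) (Fin 3) ℂ) : Prop :=
  ∀ T : Matrix (Fin 4 → Fin d) (Fin 3) ℂ, IsIntertwiner d ρ T → V * T = T * v

/-- The matrix `[π_λ(V)]` of the component of `V` in the multiplicity space of the sector `λ` with
matrices `ρ`: the `v` such that `V` acts as `𝕀_𝒬 ⊗ v` on the sector. -/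
def component (d : ℕ) (ρ : Fin 3 → Matrix (Fin 3) (Fin 3) ℂ) (V : Op d 4) :
    Matrix (Fin 3) (Fin 3) ℂ :=
  Classical.epsilon (IsComponent d ρ V)

/-- `[J] [π_{3,1}(Y)] [J]ᵀ ≠ e^{iφ} [π_{2,1,1}(Y)]^*` for all phases `e^{iφ}`. -/
def BreaksCorrelation (d : ℕ) (Y : Op d 4) : Prop :=
  ∀ φ : ℝ, matJ * component d young31 Y * matJᵀ ≠
    Complex.exp (Complex.I * (φ : ℂ)) • (component d young211 Y).map star

end QuditCircuit

end

/-! By Schur-Weyl duality the invariant unitaries on `n` qudits are the images of the unitaries of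
the group algebra of `𝕊ₙ`. For `n = 4` this algebra is `M₃ × M₃ × M₂ × ℂ × ℂ`, with blocks (3,1),
(2,1,1), (2,2), (4), (1,1,1,1), so the question is one about subgroups of U(3) × U(3) × U(2) × U(1)
× U(1).

In a basis where (3,1) is real, a transposition acts by a real involution `R` in (3,1) and by `-R`
in (2,1,1). Hence `exp(iθP)` has complex conjugate components in these two blocks, and every 2-qudit
gate `a + bP` does up to a phase. This correlation is multiplicative and, for `d ≥ 3`, visible on
the qudits, so it obstructs semi-universality (`localGroup_le`,
`not_semiUniversal_of_phaseCorrelated`).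

It is the only obstruction. Two disjoint transpositions agree in the quotient `𝕊₃`, so products
`exp(iθP) exp(-iθP')` are trivial outside the two three-dimensional blocks; they generate all pairs
`(g, conj g)` with `g` in SU(3) (`HasExchange.diagHom_mem`). Commutators then isolate SU(2) in (2,2)
(`HasExchange.incl22_mem`). An element that breaks the correlation gives a non-scalar `w` such that
all commutators of `w` with SU(3) occur in (2,1,1) alone, and the simplicity of SU(3) modulo its
centre yields a full second copy of SU(3) (`HasExchange.incl211_mem`). Together these contain every
commutator (`HasExchange.commutator_le`).

For a gate `S` on three qudits with components `u`, `α`, `β` in (2,1), (3), (1,1,1), the branching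
rule puts `u ⊕ α` into (3,1) and `u ⊕ β` into (2,1,1). As `J` turns `u` into its cofactor matrix, a
correlated `S ⊗ 𝕀` must satisfy `det u = αβ` (`det_eq_mul_of_phaseCorrelated`). The exchange gates
and the global phases already generate all such `S` (`mem_of_det_eq_mul`), so a gate outside the
2-qudit group breaks the correlation. -/

noncomputable section

namespace QuditCircuit

/-! ### Schur-Weyl duality -/

section

/-- The product operator `A₁ ⊗ ⋯ ⊗ Aₙ`. -/
def prodOp {d n : ℕ} : (Fin n → Matrix (Fin d) (Fin d) ℂ) →* Op d n where
  toFun A := Matrix.of fun x y => ∏ i, A i (x i) (y i)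
  map_one' := by
    ext x y
    simp [Matrix.one_apply, Finset.prod_ite_zero, funext_iff]
  map_mul' A B := by
    ext x y
    simp only [Matrix.of_apply, Pi.mul_apply, Matrix.mul_apply, Finset.prod_univ_sum,
      Fintype.piFinset_univ, Finset.prod_mul_distrib]

theorem prodOp_apply {d n : ℕ} (A : Fin n → Matrix (Fin d) (Fin d) ℂ) (x y : Fin n → Fin d) :
    prodOp A x y = ∏ i, A i (x i) (y i) := rfl

theorem tensorPow_eq_prodOp {d n : ℕ} (A : Matrix (Fin d) (Fin d) ℂ) :
    tensorPow d n A = prodOp fun _ => A := rfl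

theorem tensorPow_smul {d n : ℕ} (c : ℂ) (A : Matrix (Fin d) (Fin d) ℂ) :
    tensorPow d n (c • A) = c ^ n • tensorPow d n A := by
  ext x y
  simp [tensorPow, Finset.prod_mul_distrib]

/-- The operator that acts as `X` on qudit `i`. -/
def siteOp {d n : ℕ} (i : Fin n) (X : Matrix (Fin d) (Fin d) ℂ) : Op d n :=
  prodOp (Pi.mulSingle i X)

theorem siteOp_apply {d n : ℕ} (i : Fin n) (X : Matrix (Fin d) (Fin d) ℂ) (x y : Fin n → Fin d) :
    siteOp i X x y = (∏ j ∈ Finset.univ.erase i, (1 : Matrix (Fin d) (Fin d) ℂ) (x j) (y j)) *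
      X (x i) (y i) := by
  rw [siteOp, prodOp_apply, ← Finset.prod_erase_mul _ _ (Finset.mem_univ i), Pi.mulSingle_eq_same]
  congr 1
  refine Finset.prod_congr rfl fun j hj => ?_
  rw [Pi.mulSingle_eq_of_ne (Finset.ne_of_mem_erase hj)]

theorem siteOp_pow {d n : ℕ} (i : Fin n) (X : Matrix (Fin d) (Fin d) ℂ) (k : ℕ) :
    siteOp i X ^ k = siteOp i (X ^ k) := by
  rw [siteOp, siteOp, ← map_pow, Pi.mulSingle_pow]

theorem siteOp_commute {d n : ℕ} (i j : Fin n) (X : Matrix (Fin d) (Fin d) ℂ) :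
    Commute (siteOp i X : Op d n) (siteOp j X) := by
  by_cases h : i = j
  · rw [h]
  · exact (Pi.mulSingle_commute (f := fun _ : Fin n => Matrix (Fin d) (Fin d) ℂ) h X X).map prodOp

/-- The generator `∑ᵢ Xᵢ` of the tensor power representation. -/
def sumOp (d n : ℕ) : Matrix (Fin d) (Fin d) ℂ →ₗ[ℂ] Op d n where
  toFun X := ∑ i, siteOp i X
  map_add' X Y := by
    rw [← Finset.sum_add_distrib]
    refine Finset.sum_congr rfl fun i _ => ?_
    ext x y
    simp only [siteOp_apply, Matrix.add_apply, mul_add]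
  map_smul' c X := by
    rw [Finset.smul_sum]
    refine Finset.sum_congr rfl fun i _ => ?_
    ext x y
    simp only [siteOp_apply, Matrix.smul_apply, RingHom.id_apply, smul_eq_mul]
    ring

theorem sumOp_apply {d n : ℕ} (X : Matrix (Fin d) (Fin d) ℂ) :
    sumOp d n X = ∑ i, siteOp i X := rfl

theorem map_prod_eq_prodOp {d n : ℕ} (A : Matrix (Fin d) (Fin d) ℂ) {R : Type*} [CommMonoid R]
    (f : R →* Op d n) (a : Fin n → R) (hf : ∀ i, f (a i) = siteOp i A) (s : Finset (Fin n)) :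
    f (∏ i ∈ s, a i) = prodOp (fun i => if i ∈ s then A else 1) := by
  induction s using Finset.cons_induction with
  | empty =>
    rw [Finset.prod_empty, map_one, ← map_one prodOp]
    simp only [Finset.notMem_empty, if_false]
    rfl
  | cons i s hi ih =>
    rw [Finset.prod_cons, map_mul, ih, hf, siteOp, ← map_mul]
    congr 1
    funext j
    by_cases hj : j = i
    · subst hj; simp [hi]
    · simp [hj]

/-- The operators `A` at single sites commute, their `k`-th power sum is `sumOp d n (A ^ k)`, and
their product, the top elementary symmetric polynomial, is the tensor power. Newton's identities
express the latter through power sums, dividing by `k` in characteristic zero. -/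
theorem tensorPow_mem {d n : ℕ} (S : Subalgebra ℂ (Op d n)) (hS : ∀ X, sumOp d n X ∈ S)
    (A : Matrix (Fin d) (Fin d) ℂ) : tensorPow d n A ∈ S := by
  let T := Algebra.adjoin ℂ (Set.range fun i : Fin n => siteOp (d := d) i A)
  have hT : ∀ a ∈ Set.range (fun i : Fin n => siteOp (d := d) i A),
      ∀ b ∈ Set.range (fun i : Fin n => siteOp (d := d) i A), a * b = b * a := by
    rintro _ ⟨i, rfl⟩ _ ⟨j, rfl⟩
    exact siteOp_commute i j A
  have hT' : IsMulCommutative T := Algebra.isMulCommutative_adjoin ℂ hT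
  -- Polynomials can only be evaluated in a commutative ring, so the evaluation takes place in the
  -- subalgebra generated by the site operators.
  let _ : CommRing T := { (inferInstance : Ring T) with mul_comm := hT'.is_comm.comm }
  let s : Fin n → T := fun i => ⟨siteOp i A, Algebra.subset_adjoin ⟨i, rfl⟩⟩
  let f : MvPolynomial (Fin n) ℂ →ₐ[ℂ] Op d n := T.val.comp (MvPolynomial.aeval s)
  have hf : ∀ i, f (MvPolynomial.X i) = siteOp i A := fun i => by
    change ((MvPolynomial.aeval s (MvPolynomial.X i) : T) : Op d n) = _
    rw [MvPolynomial.aeval_X]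
  have hp : ∀ k, f (MvPolynomial.psum (Fin n) ℂ k) ∈ S := fun k => by
    have : f (MvPolynomial.psum (Fin n) ℂ k) = sumOp d n (A ^ k) := by
      simp only [MvPolynomial.psum, map_sum, map_pow, hf, siteOp_pow, sumOp_apply]
    rw [this]; exact hS _
  have he : ∀ k, f (MvPolynomial.esymm (Fin n) ℂ k) ∈ S := fun k => by
    induction k using Nat.strong_induction_on with
    | _ k ih =>
      rcases Nat.eq_zero_or_pos k with rfl | hk
      · rw [MvPolynomial.esymm_zero, map_one]; exact S.one_mem
      have h := congrArg f (MvPolynomial.mul_esymm_eq_sum (Fin n) ℂ k)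
      have h2 : f (MvPolynomial.esymm (Fin n) ℂ k) =
          (k : ℂ)⁻¹ • f ((k : MvPolynomial (Fin n) ℂ) * MvPolynomial.esymm (Fin n) ℂ k) := by
        rw [map_mul, map_natCast, ← nsmul_eq_mul, ← Nat.cast_smul_eq_nsmul ℂ, smul_smul,
          inv_mul_cancel₀ (by exact_mod_cast hk.ne'), one_smul]
      rw [h2, h, map_mul, map_sum]
      refine S.smul_mem (S.mul_mem ?_ (S.sum_mem fun a ha => ?_)) _
      · rw [map_pow, map_neg, map_one]
        exact S.pow_mem (S.neg_mem S.one_mem) _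
      · rw [map_mul, map_mul]
        refine S.mul_mem (S.mul_mem ?_ (ih _ (Finset.mem_filter.mp ha).2)) (hp _)
        rw [map_pow, map_neg, map_one]
        exact S.pow_mem (S.neg_mem S.one_mem) _
  have hn := he n
  have h3 : MvPolynomial.esymm (Fin n) ℂ n = ∏ i, MvPolynomial.X i := by
    have := Finset.powersetCard_self (Finset.univ : Finset (Fin n))
    rw [Finset.card_univ, Fintype.card_fin] at this
    rw [MvPolynomial.esymm, this, Finset.sum_singleton]
  have h4 := map_prod_eq_prodOp A (f : MvPolynomial (Fin n) ℂ →* Op d n) MvPolynomial.X hf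
    Finset.univ
  simp only [Finset.mem_univ, if_true] at h4
  rw [tensorPow_eq_prodOp, ← h4]
  rw [h3] at hn
  exact hn

/-- Commuting with the tensor powers of all `u ∈ SU(d)` implies it for all unitaries. -/
theorem commute_tensorPow_unitary {d n : ℕ} {M : Op d n}
    (hM : ∀ u ∈ Matrix.specialUnitaryGroup (Fin d) ℂ, Commute M (tensorPow d n u))
    (u : Matrix (Fin d) (Fin d) ℂ) (hu : u ∈ Matrix.unitaryGroup (Fin d) ℂ) :
    Commute M (tensorPow d n u) := by
  rcases Nat.eq_zero_or_pos d with rfl | hd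
  · refine hM u (Matrix.mem_specialUnitaryGroup_iff.mpr ⟨hu, ?_⟩)
    simp
  have hdet : u.det ∈ unitary ℂ := Matrix.det_of_mem_unitary hu
  -- Division by a `d`-th root of the determinant moves `u` into SU(d) and only rescales its tensor
  -- power.
  obtain ⟨c, hc⟩ := IsAlgClosed.exists_pow_nat_eq u.det hd
  have hc1 : ‖c‖ = 1 := by
    have h1 : ‖u.det‖ = 1 := CStarRing.norm_of_mem_unitary hdet
    rw [← hc, norm_pow] at h1
    exact (pow_eq_one_iff_of_nonneg (norm_nonneg c) hd.ne').mp h1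
  have hc0 : c ≠ 0 := fun h => by simp [h] at hc1
  have hcc : c⁻¹ * star c⁻¹ = 1 := by
    have := Complex.mul_conj c⁻¹
    rw [Complex.normSq_eq_norm_sq, norm_inv, hc1] at this
    simpa using this
  have hmem : c⁻¹ • u ∈ Matrix.specialUnitaryGroup (Fin d) ℂ := by
    rw [Matrix.mem_specialUnitaryGroup_iff]
    constructor
    · rw [Matrix.mem_unitaryGroup_iff] at hu ⊢
      rw [star_smul, smul_mul_smul_comm, hu, hcc, one_smul]
    · rw [Matrix.det_smul, Fintype.card_fin, ← hc, ← mul_pow, inv_mul_cancel₀ hc0, one_pow]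
  have : u = c • (c⁻¹ • u) := by rw [smul_smul, mul_inv_cancel₀ hc0, one_smul]
  rw [this, tensorPow_smul]
  exact (hM _ hmem).smul_right _

open scoped Matrix.Norms.L2Operator in
theorem hasDerivAt_exp_entry {d : ℕ} (X : Matrix (Fin d) (Fin d) ℂ) (a b : Fin d) :
    HasDerivAt (fun t : ℝ => NormedSpace.exp (t • X) a b) (X a b) 0 := by
  have h := hasDerivAt_exp_smul_const (𝕂 := ℝ) X (0 : ℝ)
  rw [zero_smul, NormedSpace.exp_zero, one_mul] at h
  have h1 := (Matrix.entryLinearMap ℝ ℂ a b).toContinuousLinearMap.hasFDerivAt.comp_hasDerivAt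
    (0 : ℝ) h
  exact h1

-- Differentiate the commutation with the tensor power of `exp(tX)` at `t = 0`; the product rule
-- produces the sum over the sites.
open scoped Matrix.Norms.L2Operator in
theorem commute_sumOp_of_skew {d n : ℕ} {M : Op d n}
    (hM : ∀ u ∈ Matrix.unitaryGroup (Fin d) ℂ, Commute M (tensorPow d n u))
    {X : Matrix (Fin d) (Fin d) ℂ} (hX : X ∈ skewAdjoint (Matrix (Fin d) (Fin d) ℂ)) :
    Commute M (sumOp d n X) := by
  have hent : ∀ x y : Fin n → Fin d, HasDerivAt
      (fun t : ℝ => tensorPow d n (NormedSpace.exp (t • X)) x y) (sumOp d n X x y) 0 := by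
    intro x y
    have := HasDerivAt.fun_finsetProd (u := Finset.univ)
      (f := fun (i : Fin n) (t : ℝ) => NormedSpace.exp (t • X) (x i) (y i))
      (fun i _ => hasDerivAt_exp_entry X (x i) (y i))
    rw [sumOp_apply, Matrix.sum_apply]
    simp only [siteOp_apply]
    simp only [zero_smul, NormedSpace.exp_zero, smul_eq_mul] at this
    exact this
  let _ : NormedAlgebra ℚ (Matrix (Fin d) (Fin d) ℂ) := NormedAlgebra.restrictScalars ℚ ℂ _
  have hu : ∀ t : ℝ, NormedSpace.exp (t • X) ∈ Matrix.unitaryGroup (Fin d) ℂ := fun t =>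
    NormedSpace.exp_mem_unitary_of_mem_skewAdjoint (skewAdjoint.smul_mem t hX)
  ext x y
  have h1 : HasDerivAt (fun t : ℝ => (M * tensorPow d n (NormedSpace.exp (t • X))) x y)
      ((M * sumOp d n X) x y) 0 := by
    simp only [Matrix.mul_apply]
    exact HasDerivAt.fun_sum fun z _ => (hent z y).const_mul (M x z)
  have h2 : HasDerivAt (fun t : ℝ => (tensorPow d n (NormedSpace.exp (t • X)) * M) x y)
      ((sumOp d n X * M) x y) 0 := by
    simp only [Matrix.mul_apply]
    exact HasDerivAt.fun_sum fun z _ => (hent x z).mul_const (M z y)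
  have h3 := fun t => (hM _ (hu t)).eq
  simp only [h3] at h1
  exact h1.unique h2

/-- Every matrix is a complex combination of skew-adjoint ones and `sumOp` is complex linear, so
unitarity of `u` is no longer felt. -/
theorem commute_sumOp {d n : ℕ} {M : Op d n}
    (hM : ∀ u ∈ Matrix.unitaryGroup (Fin d) ℂ, Commute M (tensorPow d n u))
    (X : Matrix (Fin d) (Fin d) ℂ) : Commute M (sumOp d n X) := by
  have key : ∀ Y : Matrix (Fin d) (Fin d) ℂ, IsSelfAdjoint Y → Commute M (sumOp d n Y) := by
    intro Y hY
    have h := commute_sumOp_of_skew hM (X := Complex.I • Y)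
      (hY.smul_mem_skewAdjoint Complex.conj_I)
    have : Y = (-Complex.I) • (Complex.I • Y) := by
      rw [smul_smul]; simp
    rw [this, map_smul]
    exact h.smul_right _
  rw [← realPart_add_I_smul_imaginaryPart X, map_add, map_smul]
  exact (key _ (realPart X).2).add_right ((key _ (imaginaryPart X).2).smul_right _)

theorem commute_tensorPow {d n : ℕ} {M : Op d n}
    (hM : ∀ X, Commute M (sumOp d n X)) (A : Matrix (Fin d) (Fin d) ℂ) :
    Commute M (tensorPow d n A) := by
  have := tensorPow_mem (Subalgebra.centralizer ℂ {M})
    (fun X => Subalgebra.mem_centralizer_iff ℂ |>.mpr fun g hg => by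
      rw [Set.mem_singleton_iff.mp hg]; exact (hM X).eq) A
  exact Subalgebra.mem_centralizer_iff ℂ |>.mp this M rfl

/-- Polarization: the inclusion-exclusion formula for the permanent. -/
theorem sum_neg_one_pow_prod_sum {n : ℕ} {R : Type*} [CommRing R] (a : Fin n → Fin n → R) :
    ∑ s : Finset (Fin n), (-1) ^ (s.card) * ∏ i, ∑ j ∈ s, a i j =
      (-1) ^ n * ∑ σ : Equiv.Perm (Fin n), ∏ i, a i (σ i) := by
  classical
  have h1 : ∀ s : Finset (Fin n), ∏ i, ∑ j ∈ s, a i j =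
      ∑ f : Fin n → Fin n, if Finset.univ.image f ⊆ s then ∏ i, a i (f i) else 0 := by
    intro s
    rw [Finset.prod_univ_sum, ← Finset.sum_filter]
    refine Finset.sum_congr ?_ fun _ _ => rfl
    ext f
    simp [Finset.image_subset_iff]
  -- The sets containing the image of `f` cancel in pairs unless that image is everything, which
  -- leaves exactly the permutations.
  have h2 : ∀ f : Fin n → Fin n, ∑ s : Finset (Fin n),
      (if Finset.univ.image f ⊆ s then (-1 : R) ^ s.card else 0) =
        if Function.Surjective f then (-1) ^ n else 0 := by
    intro f
    rw [← Finset.sum_filter]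
    have : Finset.univ.filter (fun s => Finset.univ.image f ⊆ s) =
        Finset.Icc (Finset.univ.image f) Finset.univ := by
      ext s; simp
    rw [this, Finset.Icc_eq_image_powerset (Finset.subset_univ _), Finset.sum_image]
    · have h3 : ∀ t ∈ (Finset.univ \ Finset.univ.image f).powerset,
          (-1 : R) ^ (Finset.univ.image f ∪ t).card =
            (-1) ^ (Finset.univ.image f).card * (((-1 : ℤ) ^ t.card : ℤ) : R) := by
        intro t ht
        rw [Finset.card_union_of_disjoint, pow_add]
        · push_cast; rfl
        · rw [Finset.mem_powerset] at ht
          exact (Finset.disjoint_sdiff).mono_right ht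
      rw [Finset.sum_congr rfl h3, ← Finset.mul_sum, ← Int.cast_sum,
        Finset.sum_powerset_neg_one_pow_card]
      have h4 : Finset.univ \ Finset.univ.image f = ∅ ↔ Function.Surjective f := by
        rw [Finset.sdiff_eq_empty_iff_subset, Finset.univ_subset_iff]
        simp [Finset.ext_iff, Function.Surjective]
      by_cases hf : Function.Surjective f
      · rw [if_pos (h4.mpr hf), if_pos hf, Finset.image_univ_of_surjective hf, Finset.card_univ,
          Fintype.card_fin]
        simp
      · rw [if_neg (fun h => hf (h4.mp h)), if_neg hf]
        simp
    · intro t ht t' ht' h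
      have ht := Finset.mem_powerset.mp ht
      have ht' := Finset.mem_powerset.mp ht'
      have e : ∀ t ⊆ Finset.univ \ Finset.univ.image f,
          (Finset.univ.image f ∪ t) \ Finset.univ.image f = t := fun t ht => by
        rw [Finset.union_sdiff_left, Finset.sdiff_eq_self_iff_disjoint]
        exact (Finset.disjoint_sdiff.mono_right ht).symm
      have h : Finset.univ.image f ∪ t = Finset.univ.image f ∪ t' := h
      rw [← e t ht, h, e t' ht']
  simp only [h1, Finset.mul_sum]
  rw [Finset.sum_comm]
  have h5 : ∀ f : Fin n → Fin n, ∑ s : Finset (Fin n),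
      (-1) ^ s.card * (if Finset.univ.image f ⊆ s then ∏ i, a i (f i) else 0) =
        if Function.Surjective f then (-1) ^ n * ∏ i, a i (f i) else 0 := by
    intro f
    have := congrArg (· * ∏ i, a i (f i)) (h2 f)
    simp only [Finset.sum_mul, ite_mul, zero_mul] at this
    rw [← this]
    refine Finset.sum_congr rfl fun s _ => ?_
    split_ifs <;> simp
  rw [Finset.sum_congr rfl fun f _ => h5 f, ← Finset.sum_filter]
  refine (Finset.sum_bij (fun (σ : Equiv.Perm (Fin n)) _ => (σ : Fin n → Fin n)) ?_ ?_ ?_ ?_).symm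
  · intro σ _; simpa using σ.surjective
  · intro σ _ τ _ h; exact Equiv.coe_fn_injective h
  · intro f hf
    have hf : Function.Surjective f := by simpa using hf
    exact ⟨Equiv.ofBijective f ⟨Finite.injective_iff_surjective.mpr hf, hf⟩, Finset.mem_univ _, rfl⟩
  · intro σ _; rfl

theorem commute_sum_prodOp {d n : ℕ} {M : Op d n}
    (hM : ∀ A, Commute M (tensorPow d n A)) (A : Fin n → Matrix (Fin d) (Fin d) ℂ) :
    Commute M (∑ σ : Equiv.Perm (Fin n), prodOp fun i => A (σ i)) := by
  have h : ∑ σ : Equiv.Perm (Fin n), prodOp (fun i => A (σ i)) =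
      (-1 : ℂ) ^ n • ∑ s : Finset (Fin n), (-1 : ℂ) ^ s.card • tensorPow d n (∑ j ∈ s, A j) := by
    ext x y
    have := sum_neg_one_pow_prod_sum fun i j => A j (x i) (y i)
    simp only [Matrix.sum_apply, Matrix.smul_apply, prodOp_apply, smul_eq_mul, tensorPow,
      Matrix.of_apply]
    rw [this, ← mul_assoc, ← pow_add, ← two_mul, pow_mul]
    simp
  rw [h]
  exact (Commute.sum_right _ _ _ fun s _ => (hM _).smul_right _).smul_right _

theorem permOp_mul_apply {d n : ℕ} (σ : Equiv.Perm (Fin n)) {m : Type*}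
    (X : Matrix (Fin n → Fin d) m ℂ) (x : Fin n → Fin d) (y : m) :
    (permOp d n σ * X) x y = X (x ∘ σ) y := by
  simp [Matrix.mul_apply, permOp]

theorem mul_permOp_apply {d n : ℕ} (σ : Equiv.Perm (Fin n)) {m : Type*}
    (X : Matrix m (Fin n → Fin d) ℂ) (x : m) (y : Fin n → Fin d) :
    (X * permOp d n σ) x y = X x (y ∘ σ.symm) := by
  have : ∀ z : Fin n → Fin d, y = z ∘ σ ↔ y ∘ σ.symm = z := fun z =>
    (Equiv.comp_symm_eq σ z y).symm
  simp [Matrix.mul_apply, permOp, this]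

/-- The permutation operators as a representation of the symmetric group. -/
def permHom (d n : ℕ) : Equiv.Perm (Fin n) →* Op d n where
  toFun := permOp d n
  map_one' := by
    ext x y
    simp [permOp, Matrix.one_apply, eq_comm]
  map_mul' σ τ := by
    ext x y
    rw [permOp_mul_apply]
    rfl

theorem permHom_apply (d n : ℕ) (σ : Equiv.Perm (Fin n)) : permHom d n σ = permOp d n σ := rfl

theorem permOp_conjTranspose (d n : ℕ) (σ : Equiv.Perm (Fin n)) :
    (permOp d n σ)ᴴ = permOp d n σ⁻¹ := by
  ext x y
  have : x = y ∘ σ ↔ y = x ∘ ⇑σ⁻¹ := by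
    rw [Equiv.Perm.inv_def, eq_comm (a := y), Equiv.comp_symm_eq]
  simp only [permOp, Matrix.conjTranspose_apply, Matrix.of_apply, this]
  split_ifs <;> simp

/-- Expand `B` in matrix units, each a product operator. Since the coefficients are invariant under
`𝕊ₙ`, summing over relabelings writes a multiple of `B` as a combination of symmetrized products, to
which polarization applies. -/
theorem commute_of_commute_permOp {d n : ℕ} {M : Op d n}
    (hM : ∀ A, Commute M (tensorPow d n A)) {B : Op d n}
    (hB : ∀ σ, Commute B (permOp d n σ)) : Commute M B := by
  have hB' : ∀ (σ : Equiv.Perm (Fin n)) x y, B (x ∘ σ) (y ∘ σ) = B x y := fun σ x y => by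
    have := congrFun (congrFun (hB σ).eq x) (y ∘ σ)
    rw [permOp_mul_apply, mul_permOp_apply] at this
    rw [← this, Function.comp_assoc, Equiv.self_comp_symm, Function.comp_id]
  have hsingle : ∀ x y : Fin n → Fin d,
      prodOp (fun i => Matrix.single (x i) (y i) (1 : ℂ)) = Matrix.single x y 1 := by
    intro x y
    ext x' y'
    simp only [prodOp_apply, Matrix.single, Matrix.of_apply, Finset.prod_ite_zero,
      Finset.prod_const_one, funext_iff, Finset.mem_univ, true_imp_iff, forall_and]
  have h : (Fintype.card (Equiv.Perm (Fin n)) : ℂ) • B = ∑ x, ∑ y, B x y •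
      ∑ σ : Equiv.Perm (Fin n), prodOp (fun i => Matrix.single (x (σ i)) (y (σ i)) (1 : ℂ)) := by
    have h1 : ∀ σ : Equiv.Perm (Fin n), B = ∑ x, ∑ y, B x y •
        prodOp (fun i => Matrix.single (x (σ i)) (y (σ i)) (1 : ℂ)) := by
      intro σ
      conv_lhs => rw [Matrix.matrix_eq_sum_single B]
      refine (Fintype.sum_equiv (Equiv.arrowCongr σ.symm (Equiv.refl (Fin d))) _ _ fun x => ?_).symm
      refine Fintype.sum_equiv (Equiv.arrowCongr σ.symm (Equiv.refl (Fin d))) _ _ fun y => ?_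
      have h2 : ∀ z : Fin n → Fin d, Equiv.arrowCongr σ.symm (Equiv.refl (Fin d)) z = z ∘ σ :=
        fun z => rfl
      rw [h2, h2, hB', hsingle (fun i => x (σ i)) (fun i => y (σ i)), Matrix.smul_single,
        smul_eq_mul, mul_one]
      rfl
    calc (Fintype.card (Equiv.Perm (Fin n)) : ℂ) • B = ∑ σ : Equiv.Perm (Fin n), B := by
          rw [Finset.sum_const, Finset.card_univ, Nat.cast_smul_eq_nsmul]
      _ = _ := by
          rw [Finset.sum_congr rfl fun σ _ => h1 σ, Finset.sum_comm]
          refine Finset.sum_congr rfl fun x _ => ?_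
          rw [Finset.sum_comm]
          refine Finset.sum_congr rfl fun y _ => ?_
          rw [Finset.smul_sum]
  have h0 : (Fintype.card (Equiv.Perm (Fin n)) : ℂ) ≠ 0 := by
    exact_mod_cast Fintype.card_ne_zero
  have h3 : Commute M ((Fintype.card (Equiv.Perm (Fin n)) : ℂ) • B) := by
    rw [h]
    exact Commute.sum_right _ _ _ fun x _ => Commute.sum_right _ _ _ fun y _ =>
      (commute_sum_prodOp hM fun i => Matrix.single (x i) (y i) 1).smul_right _
  have := h3.smul_right (Fintype.card (Equiv.Perm (Fin n)) : ℂ)⁻¹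
  rwa [smul_smul, inv_mul_cancel₀ h0, one_smul] at this

/-- The double commutant theorem for the algebra spanned by the permutation operators. -/
theorem mem_span_permOp_of_commute {d n : ℕ} {M : Op d n}
    (hM : ∀ B : Op d n, (∀ σ, Commute B (permOp d n σ)) → Commute M B) :
    M ∈ Submodule.span ℂ (Set.range (permOp d n)) := by
  classical
  set 𝒜 := Submodule.span ℂ (Set.range (permOp d n)) with h𝒜
  obtain ⟨p, hp⟩ := LinearMap.exists_leftInverse_of_injective 𝒜.subtype 𝒜.ker_subtype
  have h𝒜mul : ∀ σ, ∀ X ∈ 𝒜, permOp d n σ * X ∈ 𝒜 := by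
    intro σ X hX
    induction hX using Submodule.span_induction with
    | mem x h =>
      obtain ⟨τ, rfl⟩ := h
      exact Submodule.subset_span ⟨σ * τ, map_mul (permHom d n) σ τ⟩
    | zero => simp
    | add x y _ _ hx hy => rw [mul_add]; exact 𝒜.add_mem hx hy
    | smul c x _ hx => rw [mul_smul_comm]; exact 𝒜.smul_mem c hx
  let c : ℂ := (Fintype.card (Equiv.Perm (Fin n)) : ℂ)⁻¹
  have hc : c * (Fintype.card (Equiv.Perm (Fin n)) : ℂ) = 1 :=
    inv_mul_cancel₀ (by exact_mod_cast Fintype.card_ne_zero)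
  -- Maschke averaging turns an arbitrary linear projection onto `𝒜` into one that commutes with
  -- left multiplication by `𝒜`.
  let Q : Op d n →ₗ[ℂ] Op d n := c • ∑ σ : Equiv.Perm (Fin n),
    (LinearMap.mulLeft ℂ (permOp d n σ)) ∘ₗ 𝒜.subtype ∘ₗ p ∘ₗ
      (LinearMap.mulLeft ℂ (permOp d n σ⁻¹))
  have hQ : ∀ X, Q X = c • ∑ σ : Equiv.Perm (Fin n),
      permOp d n σ * (p (permOp d n σ⁻¹ * X) : Op d n) := fun X => by
    simp [Q, LinearMap.sum_apply]
  have hQmem : ∀ X, Q X ∈ 𝒜 := fun X => by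
    rw [hQ]
    exact 𝒜.smul_mem _ (𝒜.sum_mem fun σ _ => h𝒜mul σ _ (p _).2)
  have hQid : ∀ X ∈ 𝒜, Q X = X := fun X hX => by
    have h1 : ∀ σ : Equiv.Perm (Fin n),
        permOp d n σ * (p (permOp d n σ⁻¹ * X) : Op d n) = X := fun σ => by
      have h2 : (p (permOp d n σ⁻¹ * X) : Op d n) = permOp d n σ⁻¹ * X :=
        congrArg Subtype.val (LinearMap.congr_fun hp ⟨_, h𝒜mul σ⁻¹ X hX⟩)
      rw [h2, ← mul_assoc, ← permHom_apply, ← permHom_apply, ← map_mul, mul_inv_cancel, map_one,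
        one_mul]
    rw [hQ, Finset.sum_congr rfl fun σ _ => h1 σ, Finset.sum_const, Finset.card_univ,
      ← Nat.cast_smul_eq_nsmul ℂ, smul_smul, hc, one_smul]
  have hQeq : ∀ τ X, Q (permOp d n τ * X) = permOp d n τ * Q X := fun τ X => by
    rw [hQ, hQ, mul_smul_comm, Finset.mul_sum]
    congr 1
    refine Fintype.sum_equiv (Equiv.mulLeft τ⁻¹) _ _ fun σ => ?_
    simp only [Equiv.coe_mulLeft, ← permHom_apply, ← mul_assoc, ← map_mul, mul_inv_rev, inv_inv,
      mul_inv_cancel, one_mul]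
  -- Equivariance of `Q` says that these slices of its coefficient tensor commute with all
  -- permutations, hence with `M`. Summed over `l` this becomes `Q M = M * Q 1 = M`, and `Q M` lies
  -- in `𝒜`.
  have hcomm : ∀ j l, Commute M (Matrix.of fun i k => Q (Matrix.single k l 1) i j) := by
    intro j l
    refine hM _ fun σ => ?_
    ext i k
    rw [permOp_mul_apply, mul_permOp_apply, Matrix.of_apply, Matrix.of_apply]
    have h1 : permOp d n σ * Matrix.single k l (1 : ℂ) = Matrix.single (k ∘ σ.symm) l 1 := by
      ext x y
      rw [permOp_mul_apply]
      simp only [Matrix.single, Matrix.of_apply]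
      refine if_congr (and_congr_left fun _ => ?_) rfl rfl
      rw [Equiv.comp_symm_eq]
    rw [← h1, hQeq, permOp_mul_apply]
  have hM1 : Q M = M * Q 1 := by
    have h1 : M = ∑ l, ∑ m, M m l • Matrix.single m l 1 := by
      conv_lhs => rw [Matrix.matrix_eq_sum_single M]
      rw [Finset.sum_comm]
      refine Finset.sum_congr rfl fun l _ => Finset.sum_congr rfl fun m _ => ?_
      rw [Matrix.smul_single, smul_eq_mul, mul_one]
    have h2 : (1 : Op d n) = ∑ l, Matrix.single l l 1 := by
      exact Matrix.sum_single_one.symm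
    have h3 : Q M = ∑ l, ∑ m, M m l • Q (Matrix.single m l 1) := by
      conv_lhs => rw [h1]
      simp only [map_sum, map_smul]
    rw [h3, h2, map_sum, Finset.mul_sum]
    refine Finset.sum_congr rfl fun l _ => ?_
    ext i j
    have h4 := congrFun (congrFun (hcomm j l).eq i) l
    simp only [Matrix.mul_apply, Matrix.of_apply] at h4
    rw [Matrix.mul_apply, h4, Matrix.sum_apply]
    refine Finset.sum_congr rfl fun m _ => ?_
    rw [Matrix.smul_apply, smul_eq_mul, mul_comm]
  have : M = Q M := by
    rw [hM1, hQid 1 (Submodule.subset_span ⟨1, map_one (permHom d n)⟩), mul_one]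
  rw [this]
  exact hQmem M

/-- Schur-Weyl duality, for the generators of the tensor power representation. -/
theorem mem_span_permOp_of_commute_sumOp {d n : ℕ} {M : Op d n}
    (hM : ∀ X, Commute M (sumOp d n X)) : M ∈ Submodule.span ℂ (Set.range (permOp d n)) :=
  mem_span_permOp_of_commute fun _ hB => commute_of_commute_permOp (commute_tensorPow hM) hB

theorem commute_sumOp_of_mem_invariantGroup {d n : ℕ} {V : UnitaryGrp d n}
    (hV : V ∈ invariantGroup d n) (X : Matrix (Fin d) (Fin d) ℂ) :
    Commute (V : Op d n) (sumOp d n X) :=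
  commute_sumOp (commute_tensorPow_unitary hV) X

theorem permOp_commute_tensorPow {d n : ℕ} (σ : Equiv.Perm (Fin n))
    (u : Matrix (Fin d) (Fin d) ℂ) : Commute (permOp d n σ) (tensorPow d n u) := by
  ext x y
  rw [permOp_mul_apply, mul_permOp_apply]
  simp only [tensorPow, Matrix.of_apply, Function.comp_apply]
  exact Fintype.prod_equiv σ _ _ fun i => by simp

theorem mem_invariantGroup_iff {d n : ℕ} (V : UnitaryGrp d n) :
    V ∈ invariantGroup d n ↔ (V : Op d n) ∈ Submodule.span ℂ (Set.range (permOp d n)) := by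
  refine ⟨fun h => mem_span_permOp_of_commute_sumOp (commute_sumOp_of_mem_invariantGroup h),
    fun h u _ => ?_⟩
  generalize (V : Op d n) = W at h
  induction h using Submodule.span_induction with
  | mem x h => obtain ⟨σ, rfl⟩ := h; exact permOp_commute_tensorPow σ u
  | zero => exact Commute.zero_left _
  | add x y _ _ hx hy => exact hx.add_left hy
  | smul c x _ hx => exact hx.smul_left c

end

/-! ### Generation of SU(2) and SU(3) -/

section

/-- The unitary group `U(m)`. -/
abbrev UGrp (m : ℕ) : Type := Matrix.unitaryGroup (Fin m) ℂ

/-- The matrix `A` belongs to the group `N` of unitaries. -/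
def HasMat {m : ℕ} (N : Subgroup (UGrp m)) (A : Matrix (Fin m) (Fin m) ℂ) : Prop :=
  ∃ g ∈ N, (g : Matrix (Fin m) (Fin m) ℂ) = A

theorem HasMat.mul {m : ℕ} {N : Subgroup (UGrp m)} {A B : Matrix (Fin m) (Fin m) ℂ}
    (hA : HasMat N A) (hB : HasMat N B) : HasMat N (A * B) := by
  obtain ⟨g, hg, rfl⟩ := hA
  obtain ⟨h, hh, rfl⟩ := hB
  exact ⟨g * h, N.mul_mem hg hh, rfl⟩

theorem HasMat.conjTranspose {m : ℕ} {N : Subgroup (UGrp m)} {A : Matrix (Fin m) (Fin m) ℂ}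
    (hA : HasMat N A) : HasMat N Aᴴ := by
  obtain ⟨g, hg, rfl⟩ := hA
  exact ⟨g⁻¹, N.inv_mem hg, rfl⟩

theorem hasMat_one {m : ℕ} (N : Subgroup (UGrp m)) : HasMat N 1 := ⟨1, N.one_mem, rfl⟩

theorem hasMat_coe {m : ℕ} {N : Subgroup (UGrp m)} {g : UGrp m} :
    HasMat N (g : Matrix (Fin m) (Fin m) ℂ) ↔ g ∈ N :=
  ⟨fun ⟨_, hg', h⟩ => Subtype.ext h ▸ hg', fun h => ⟨g, h, rfl⟩⟩

theorem HasMat.pow {m : ℕ} {N : Subgroup (UGrp m)} {A : Matrix (Fin m) (Fin m) ℂ}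
    (hA : HasMat N A) (k : ℕ) : HasMat N (A ^ k) := by
  induction k with
  | zero => rw [pow_zero]; exact hasMat_one N
  | succ k ih => rw [pow_succ]; exact ih.mul hA

theorem UGrp.mul_conjTranspose {m : ℕ} (g : UGrp m) :
    (g : Matrix (Fin m) (Fin m) ℂ) * (g : Matrix (Fin m) (Fin m) ℂ)ᴴ = 1 :=
  Matrix.mem_unitaryGroup_iff.mp g.2

theorem UGrp.conjTranspose_mul {m : ℕ} (g : UGrp m) :
    (g : Matrix (Fin m) (Fin m) ℂ)ᴴ * (g : Matrix (Fin m) (Fin m) ℂ) = 1 :=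
  Matrix.mem_unitaryGroup_iff'.mp g.2

theorem UGrp.coe_inv {m : ℕ} (g : UGrp m) :
    ((g⁻¹ : UGrp m) : Matrix (Fin m) (Fin m) ℂ) = (g : Matrix (Fin m) (Fin m) ℂ)ᴴ := rfl

/-- The elements of `SU(2)`. -/
def su2 (p q : ℂ) : Matrix (Fin 2) (Fin 2) ℂ := !![p, -star q; q, star p]

/-- `SU(2)` in the plane of the first two coordinates of `ℂ³`. -/
def su12 (p q : ℂ) : Matrix (Fin 3) (Fin 3) ℂ := !![p, -star q, 0; q, star p, 0; 0, 0, 1]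

/-- `SU(2)` in the plane of the last two coordinates of `ℂ³`. -/
def su23 (p q : ℂ) : Matrix (Fin 3) (Fin 3) ℂ := !![1, 0, 0; 0, p, -star q; 0, q, star p]

theorem su2_mul (p q p' q' : ℂ) :
    su2 p q * su2 p' q' = su2 (p * p' - star q * q') (q * p' + star p * q') := by
  ext i j
  fin_cases i <;> fin_cases j <;> simp [su2, Matrix.mul_apply] <;> ring

theorem su2_conjTranspose (p q : ℂ) : (su2 p q)ᴴ = su2 (star p) (-q) := by
  ext i j
  fin_cases i <;> fin_cases j <;> simp [su2]

theorem su12_mul (p q p' q' : ℂ) :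
    su12 p q * su12 p' q' = su12 (p * p' - star q * q') (q * p' + star p * q') := by
  ext i j
  fin_cases i <;> fin_cases j <;> simp [su12, Matrix.mul_apply, Fin.sum_univ_three] <;> ring

theorem su12_conjTranspose (p q : ℂ) : (su12 p q)ᴴ = su12 (star p) (-q) := by
  ext i j
  fin_cases i <;> fin_cases j <;> simp [su12]

theorem su23_mul (p q p' q' : ℂ) :
    su23 p q * su23 p' q' = su23 (p * p' - star q * q') (q * p' + star p * q') := by
  ext i j
  fin_cases i <;> fin_cases j <;> simp [su23, Matrix.mul_apply, Fin.sum_univ_three] <;> ring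

theorem su23_conjTranspose (p q : ℂ) : (su23 p q)ᴴ = su23 (star p) (-q) := by
  ext i j
  fin_cases i <;> fin_cases j <;> simp [su23]

theorem su2_one : su2 1 0 = 1 := by
  ext i j
  fin_cases i <;> fin_cases j <;> simp [su2]

theorem su12_one : su12 1 0 = 1 := by
  ext i j
  fin_cases i <;> fin_cases j <;> simp [su12]

theorem su23_one : su23 1 0 = 1 := by
  ext i j
  fin_cases i <;> fin_cases j <;> simp [su23]

theorem su2_mem {p q : ℂ} (h : p * star p + q * star q = 1) :
    su2 p q ∈ Matrix.unitaryGroup (Fin 2) ℂ := by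
  rw [Matrix.mem_unitaryGroup_iff', Matrix.star_eq_conjTranspose, su2_conjTranspose, su2_mul,
    ← su2_one]
  congr 1
  · rw [← h, star_neg]; ring
  · rw [star_star]; ring

theorem su12_mem {p q : ℂ} (h : p * star p + q * star q = 1) :
    su12 p q ∈ Matrix.unitaryGroup (Fin 3) ℂ := by
  rw [Matrix.mem_unitaryGroup_iff', Matrix.star_eq_conjTranspose, su12_conjTranspose, su12_mul,
    ← su12_one]
  congr 1
  · rw [← h, star_neg]; ring
  · rw [star_star]; ring

theorem su23_mem {p q : ℂ} (h : p * star p + q * star q = 1) :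
    su23 p q ∈ Matrix.unitaryGroup (Fin 3) ℂ := by
  rw [Matrix.mem_unitaryGroup_iff', Matrix.star_eq_conjTranspose, su23_conjTranspose, su23_mul,
    ← su23_one]
  congr 1
  · rw [← h, star_neg]; ring
  · rw [star_star]; ring

theorem su2_det {p q : ℂ} (h : p * star p + q * star q = 1) : (su2 p q).det = 1 := by
  rw [su2, Matrix.det_fin_two_of, ← h]; ring

theorem su12_det {p q : ℂ} (h : p * star p + q * star q = 1) : (su12 p q).det = 1 := by
  rw [Matrix.det_fin_three, ← h]; simp [su12]; ring

theorem su23_det {p q : ℂ} (h : p * star p + q * star q = 1) : (su23 p q).det = 1 := by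
  rw [Matrix.det_fin_three, ← h]; simp [su23]; ring

theorem conjTranspose_eq_adjugate {m : ℕ} (g : UGrp m)
    (hg : (g : Matrix (Fin m) (Fin m) ℂ).det = 1) :
    (g : Matrix (Fin m) (Fin m) ℂ)ᴴ = (g : Matrix (Fin m) (Fin m) ℂ).adjugate := by
  have h := Matrix.mul_adjugate (g : Matrix (Fin m) (Fin m) ℂ)
  rw [hg, one_smul] at h
  rw [← mul_one ((g : Matrix (Fin m) (Fin m) ℂ)ᴴ), ← h, ← mul_assoc, g.conjTranspose_mul, one_mul]

theorem exists_su2 (g : UGrp 2) (hg : (g : Matrix (Fin 2) (Fin 2) ℂ).det = 1) :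
    ∃ p q : ℂ, p * star p + q * star q = 1 ∧ (g : Matrix (Fin 2) (Fin 2) ℂ) = su2 p q := by
  have h := conjTranspose_eq_adjugate g hg
  have h00 := congrFun (congrFun h 0) 0
  have h10 := congrFun (congrFun h 0) 1
  rw [Matrix.adjugate_fin_two] at h00 h10
  simp only [Matrix.conjTranspose_apply, Matrix.of_apply, Matrix.cons_val_zero,
    Matrix.cons_val_one, Matrix.cons_val', Matrix.cons_val_fin_one] at h00 h10
  refine ⟨(g : Matrix (Fin 2) (Fin 2) ℂ) 0 0, (g : Matrix (Fin 2) (Fin 2) ℂ) 1 0, ?_, ?_⟩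
  · rw [Matrix.det_fin_two] at hg
    rw [h00, h10, ← hg]; ring
  · ext i j
    fin_cases i <;> fin_cases j <;> simp [su2, -RCLike.star_def, -Complex.star_def, h00, h10]

theorem exp_I_star (θ : ℝ) :
    star (Complex.exp (Complex.I * θ)) = Complex.exp (-(Complex.I * θ)) := by
  rw [Complex.star_def, ← Complex.exp_conj]; simp

theorem exp_I_unit (θ : ℝ) :
    Complex.exp (Complex.I * θ) * star (Complex.exp (Complex.I * θ)) = 1 := by
  rw [exp_I_star, ← Complex.exp_add]; simp

theorem exists_phase {p p' : ℂ} (h : ‖p‖ = ‖p'‖) : ∃ μ : ℝ, p' = Complex.exp (Complex.I * μ) * p := by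
  refine ⟨p'.arg - p.arg, ?_⟩
  have h1 := Complex.norm_mul_exp_arg_mul_I p
  have h2 := Complex.norm_mul_exp_arg_mul_I p'
  calc p' = ‖p'‖ * Complex.exp (p'.arg * Complex.I) := h2.symm
    _ = Complex.exp (Complex.I * ((p'.arg - p.arg : ℝ) : ℂ)) *
        (‖p‖ * Complex.exp (p.arg * Complex.I)) := by
      rw [h, mul_left_comm, ← Complex.exp_add]
      congr 2
      push_cast
      ring
    _ = _ := by rw [h1]

theorem exists_unit_exp {z : ℂ} (h : z * star z = 1) : ∃ θ : ℝ, z = Complex.exp (Complex.I * θ) := by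
  have h1 : ‖(1 : ℂ)‖ = ‖z‖ := by
    have := congrArg norm h
    rw [norm_mul, norm_star, norm_one, ← sq] at this
    rw [norm_one]
    exact ((pow_eq_one_iff_of_nonneg (norm_nonneg z) two_ne_zero).mp this).symm
  obtain ⟨μ, hμ⟩ := exists_phase h1
  exact ⟨μ, by rw [hμ, mul_one]⟩

theorem mul_star_eq_norm (p : ℂ) : p * star p = ((‖p‖ ^ 2 : ℝ) : ℂ) := by
  rw [Complex.star_def, Complex.mul_conj, Complex.normSq_eq_norm_sq]

theorem unit_iff_norm {p q : ℂ} : p * star p + q * star q = 1 ↔ ‖p‖ ^ 2 + ‖q‖ ^ 2 = 1 := by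
  rw [mul_star_eq_norm, mul_star_eq_norm]
  exact_mod_cast Iff.rfl

section SU2

variable {N : Subgroup (UGrp 2)}

/-- Torus elements on both sides shift the phases of `p` and `q` independently: the angles `(μ -
ν)/2` on the left and `(μ + ν)/2` on the right add up to `μ` on `p` and differ by `ν` on `q`. -/
theorem hasMat_su2_of_norm_eq (ht : ∀ θ : ℝ, HasMat N (su2 (Complex.exp (Complex.I * θ)) 0))
    {p q p' q' : ℂ} (h : HasMat N (su2 p q)) (hp : ‖p‖ = ‖p'‖) (hq : ‖q‖ = ‖q'‖) :
    HasMat N (su2 p' q') := by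
  obtain ⟨μ, rfl⟩ := exists_phase hp
  obtain ⟨ν, rfl⟩ := exists_phase hq
  have h1 := ((ht ((μ - ν) / 2)).mul h).mul (ht ((μ + ν) / 2))
  rw [su2_mul, su2_mul] at h1
  convert h1 using 2
  · simp only [star_zero, zero_mul, sub_zero, mul_zero]
    rw [mul_right_comm, ← Complex.exp_add]
    congr 2
    push_cast; ring
  · simp only [zero_mul, zero_add, mul_zero, add_zero]
    rw [exp_I_star, mul_right_comm, ← Complex.exp_add]
    congr 2
    push_cast; ring

/-- A torus of `SU(2)` and a rotation that maps its axis to an orthogonal one generate `SU(2)`. -/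
theorem hasMat_su2_of_torus (ht : ∀ θ : ℝ, HasMat N (su2 (Complex.exp (Complex.I * θ)) 0))
    {a b : ℂ} (hab : HasMat N (su2 a b)) (ha : ‖a‖ ^ 2 = 1 / 2) (hb : ‖b‖ ^ 2 = 1 / 2)
    {p q : ℂ} (h : p * star p + q * star q = 1) : HasMat N (su2 p q) := by
  have hr : ‖a‖ = ‖b‖ := by
    rw [← sq_eq_sq₀ (norm_nonneg _) (norm_nonneg _), ha, hb]
  set r : ℝ := ‖a‖ with hr'
  have hr2 : (r : ℂ) * r = 1 / 2 := by
    rw [← sq, ← Complex.ofReal_pow, ha]; norm_num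
  have hR : HasMat N (su2 r r) :=
    hasMat_su2_of_norm_eq ht hab (by rw [Complex.norm_real, hr', norm_norm])
      (by rw [Complex.norm_real, hr, norm_norm])
  rw [unit_iff_norm] at h
  have hp1 : ‖p‖ ≤ 1 := by nlinarith [sq_nonneg ‖q‖, norm_nonneg p]
  -- Euler decomposition: with the balanced real rotation `R` and the torus element `T(φ)`, the
  -- first column of `R T(φ) R` is `(i sin φ, cos φ)`, which has the required norms.
  set φ := Real.arcsin ‖p‖
  have hs : Real.sin φ = ‖p‖ := Real.sin_arcsin (by linarith [norm_nonneg p]) hp1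
  have hc : Real.cos φ = ‖q‖ := by
    rw [Real.cos_arcsin, ← h, add_sub_cancel_left, Real.sqrt_sq (norm_nonneg _)]
  have h1 := (hR.mul (ht φ)).mul hR
  rw [su2_mul, su2_mul] at h1
  have e1 := Complex.exp_mul_I (φ : ℂ)
  have e2 := Complex.exp_mul_I (-φ : ℂ)
  rw [Complex.cos_neg, Complex.sin_neg] at e2
  refine hasMat_su2_of_norm_eq ht h1 ?_ ?_
  · have : ((r : ℂ) * Complex.exp (Complex.I * φ) - star (r : ℂ) * 0) * r -
        star ((r : ℂ) * Complex.exp (Complex.I * φ) + star (r : ℂ) * 0) * r =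
          Complex.I * (Real.sin φ : ℂ) := by
      rw [mul_zero, sub_zero, add_zero, star_mul', exp_I_star, Complex.star_def, Complex.conj_ofReal,
        mul_comm Complex.I, e1, ← neg_mul, e2, Complex.ofReal_sin]
      linear_combination (2 * Complex.sin φ * Complex.I) * hr2
    rw [this, norm_mul, Complex.norm_I, one_mul, Complex.norm_real, hs, norm_norm]
  · have : ((r : ℂ) * Complex.exp (Complex.I * φ) + star (r : ℂ) * 0) * r +
        star ((r : ℂ) * Complex.exp (Complex.I * φ) - star (r : ℂ) * 0) * r =
          (Real.cos φ : ℂ) := by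
      rw [mul_zero, sub_zero, add_zero, star_mul', exp_I_star, Complex.star_def, Complex.conj_ofReal,
        mul_comm Complex.I, e1, ← neg_mul, e2, Complex.ofReal_cos]
      linear_combination (2 * Complex.cos φ) * hr2
    rw [this, Complex.norm_real, hc, norm_norm]

end SU2

/-- Elements of `SU(2)` with equal traces are conjugate. -/
theorem su2_conj {p q : ℂ} (h : p * star p + q * star q = 1) {α : ℝ} (hα : Real.cos α = p.re) :
    (∃ x y : ℂ, x * star x + y * star y = 1 ∧ p * x - star q * y = x * Complex.exp (Complex.I * α) ∧
        q * x + star p * y = y * Complex.exp (Complex.I * α)) ∨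
      (p = Complex.exp (Complex.I * ((-α : ℝ) : ℂ)) ∧ q = 0) := by
  have e1 : Complex.exp (Complex.I * α) = Real.cos α + Real.sin α * Complex.I := by
    rw [mul_comm, Complex.exp_mul_I, Complex.ofReal_cos, Complex.ofReal_sin]
  have e2 : Complex.exp (Complex.I * ((-α : ℝ) : ℂ)) = Real.cos α - Real.sin α * Complex.I := by
    rw [mul_comm, Complex.exp_mul_I, Complex.ofReal_cos, Complex.ofReal_sin]
    push_cast
    rw [Complex.cos_neg, Complex.sin_neg]
    ring
  set c := Real.cos α
  set s := Real.sin α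
  have hcs : c ^ 2 + s ^ 2 = 1 := Real.cos_sq_add_sin_sq α
  have hp : p = c + p.im * Complex.I := by rw [hα]; exact (Complex.re_add_im p).symm
  set y := p.im
  have hp' : star p = c - y * Complex.I := by
    rw [hp]; simp [sub_eq_add_neg]
  have hI := Complex.I_mul_I
  have hcsC : (c : ℂ) ^ 2 + s ^ 2 = 1 := by exact_mod_cast hcs
  have hq : q * star q = s ^ 2 - y ^ 2 := by
    rw [hp', hp] at h
    linear_combination h - hcsC + (y : ℂ) ^ 2 * hI
  -- The vector `(i(y + s), q)` is an eigenvector for `exp(iα)`. It vanishes only if the matrix is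
  -- already diagonal with the two eigenvalues interchanged, the second alternative.
  by_cases h0 : (y + s) ^ 2 + ‖q‖ ^ 2 = 0
  · right
    have hy : y + s = 0 := by
      have := sq_nonneg ‖q‖
      have := sq_nonneg (y + s)
      exact pow_eq_zero_iff two_ne_zero |>.mp (by linarith)
    have hq0 : ‖q‖ = 0 := by
      have := sq_nonneg ‖q‖
      have := sq_nonneg (y + s)
      exact pow_eq_zero_iff two_ne_zero |>.mp (by linarith)
    refine ⟨?_, norm_eq_zero.mp hq0⟩
    rw [e2, hp, show y = -s by linarith]
    push_cast; ring
  · left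
    set n := (y + s) ^ 2 + ‖q‖ ^ 2 with hn
    have hn0 : 0 ≤ n := by positivity
    set k : ℂ := (((Real.sqrt n)⁻¹ : ℝ) : ℂ) with hk
    have hk2 : k * k * n = 1 := by
      rw [hk]
      have : (Real.sqrt n)⁻¹ * (Real.sqrt n)⁻¹ * n = 1 := by
        rw [← mul_inv, Real.mul_self_sqrt hn0, inv_mul_cancel₀ h0]
      exact_mod_cast this
    have hkc : star k = k := by rw [hk, Complex.star_def, Complex.conj_ofReal]
    have hnC : (n : ℂ) = (y + s) ^ 2 + q * star q := by
      rw [mul_star_eq_norm, hn]; push_cast; ring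
    refine ⟨k * (Complex.I * (y + s)), k * q, ?_, ?_, ?_⟩
    · have : star (k * (Complex.I * (y + s))) = k * (-Complex.I * (y + s)) := by
        rw [star_mul', hkc]; simp
      rw [this, star_mul', hkc, ← hk2, hnC]
      linear_combination (- k * k * (y + s) ^ 2) * hI
    · rw [e1, hp]
      linear_combination (-k) * hq + k * ((s : ℂ) ^ 2 - y ^ 2 ) * -hI
    · rw [e1, hp']
      ring

section SU3

variable {N : Subgroup (UGrp 3)}

/-- A Givens rotation: the left side of the second equation is the lower entry of `su2 x y` applied
to `(b, c)`. -/
theorem exists_unit_mul_add_eq_zero (b c : ℂ) :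
    ∃ x y : ℂ, x * star x + y * star y = 1 ∧ y * b + star x * c = 0 := by
  by_cases h0 : ‖b‖ ^ 2 + ‖c‖ ^ 2 = 0
  · refine ⟨1, 0, by simp, ?_⟩
    have : ‖c‖ = 0 := by
      have := sq_nonneg ‖b‖
      have := sq_nonneg ‖c‖
      exact pow_eq_zero_iff two_ne_zero |>.mp (by linarith)
    simp [norm_eq_zero.mp this]
  · set n := ‖b‖ ^ 2 + ‖c‖ ^ 2 with hn
    have hn0 : 0 ≤ n := by positivity
    set k : ℂ := (((Real.sqrt n)⁻¹ : ℝ) : ℂ) with hk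
    have hk2 : k * k * n = 1 := by
      rw [hk]
      have : (Real.sqrt n)⁻¹ * (Real.sqrt n)⁻¹ * n = 1 := by
        rw [← mul_inv, Real.mul_self_sqrt hn0, inv_mul_cancel₀ h0]
      exact_mod_cast this
    have hkc : star k = k := by rw [hk, Complex.star_def, Complex.conj_ofReal]
    have hnC : (n : ℂ) = b * star b + c * star c := by
      rw [mul_star_eq_norm, mul_star_eq_norm, hn]; push_cast; ring
    refine ⟨k * star b, -(k * c), ?_, ?_⟩
    · rw [star_neg, star_mul', star_mul', hkc, star_star, ← hk2, hnC]; ring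
    · rw [star_mul', hkc, star_star]; ring

/-- `SU(3)` is generated by the groups `SU(2)` in two coordinate planes. -/
theorem mem_of_su12_su23
    (h12 : ∀ p q : ℂ, p * star p + q * star q = 1 → HasMat N (su12 p q))
    (h23 : ∀ p q : ℂ, p * star p + q * star q = 1 → HasMat N (su23 p q))
    (g : UGrp 3) (hg : (g : Matrix (Fin 3) (Fin 3) ℂ).det = 1) : g ∈ N := by
  -- Gaussian elimination by left multiplication with known elements: clearing the entries (2,0) and
  -- (1,0) and normalizing (0,0) makes the first column trivial. The equality of adjugate and
  -- conjugate transpose identifies what is left as an element of the second SU(2).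
  have red : ∀ (A : Matrix (Fin 3) (Fin 3) ℂ) (hA : A.det = 1), HasMat N A →
      ∀ g : UGrp 3, (g : Matrix (Fin 3) (Fin 3) ℂ).det = 1 →
      (∀ g' : UGrp 3, (g' : Matrix (Fin 3) (Fin 3) ℂ) = A * g →
        (g' : Matrix (Fin 3) (Fin 3) ℂ).det = 1 → g' ∈ N) → g ∈ N := by
    rintro _ hA ⟨s, hs, rfl⟩ g hg h
    have := h (s * g) rfl (by
      rw [show ((s * g : UGrp 3) : Matrix (Fin 3) (Fin 3) ℂ) = s * g from rfl, Matrix.det_mul, hA,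
        hg, one_mul])
    exact (N.mul_mem_cancel_left hs).mp this
  have s1 : ∀ g : UGrp 3, (g : Matrix (Fin 3) (Fin 3) ℂ).det = 1 →
      (g : Matrix (Fin 3) (Fin 3) ℂ) 0 0 = 1 → (g : Matrix (Fin 3) (Fin 3) ℂ) 1 0 = 0 →
      (g : Matrix (Fin 3) (Fin 3) ℂ) 2 0 = 0 → g ∈ N := by
    intro g hg h00 h10 h20
    have had := conjTranspose_eq_adjugate g hg
    rw [Matrix.adjugate_fin_three] at had
    have a11 := congrFun (congrFun had 1) 1
    have a12 := congrFun (congrFun had 2) 1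
    have a01 := congrFun (congrFun had 1) 0
    have a02 := congrFun (congrFun had 2) 0
    simp [-RCLike.star_def, -Complex.star_def, h00, h10, h20] at a11 a12 a01 a02
    rw [Matrix.det_fin_three] at hg
    simp only [h00, h10, h20] at hg
    have a21 : star ((g : Matrix (Fin 3) (Fin 3) ℂ) 2 1) = -(g : Matrix (Fin 3) (Fin 3) ℂ) 1 2 := by
      rw [← star_star ((g : Matrix (Fin 3) (Fin 3) ℂ) 1 2), a12, star_neg, neg_neg]
    rw [← hasMat_coe]
    have : (g : Matrix (Fin 3) (Fin 3) ℂ) = su23 ((g : Matrix (Fin 3) (Fin 3) ℂ) 1 1)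
        ((g : Matrix (Fin 3) (Fin 3) ℂ) 2 1) := by
      ext i j
      fin_cases i <;> fin_cases j <;>
        simp [su23, -RCLike.star_def, -Complex.star_def, h00, h10, h20, a01, a02, a11, a21]
    rw [this]
    apply h23
    rw [a11, a21]
    linear_combination hg
  have s2 : ∀ g : UGrp 3, (g : Matrix (Fin 3) (Fin 3) ℂ).det = 1 →
      (g : Matrix (Fin 3) (Fin 3) ℂ) 1 0 = 0 →
      (g : Matrix (Fin 3) (Fin 3) ℂ) 2 0 = 0 → g ∈ N := by
    intro g hg h10 h20
    have hc := congrFun (congrFun g.conjTranspose_mul 0) 0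
    simp [Matrix.mul_apply, Fin.sum_univ_three, -RCLike.star_def, -Complex.star_def, h10, h20] at hc
    have hu : star ((g : Matrix (Fin 3) (Fin 3) ℂ) 0 0) *
      star (star ((g : Matrix (Fin 3) (Fin 3) ℂ) 0 0)) + (0 : ℂ) * star 0 = 1 := by
      rw [star_star, hc]; simp
    refine red _ (su12_det hu) (h12 _ _ hu) g hg fun g' hg' hd => s1 g' hd ?_ ?_ ?_
    all_goals
      rw [hg']
      simp [su12, Matrix.mul_apply, Fin.sum_univ_three, -RCLike.star_def, -Complex.star_def, h10, h20, hc]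
  have s3 : ∀ g : UGrp 3, (g : Matrix (Fin 3) (Fin 3) ℂ).det = 1 →
      (g : Matrix (Fin 3) (Fin 3) ℂ) 2 0 = 0 → g ∈ N := by
    intro g hg h20
    obtain ⟨x, y, hxy, h⟩ := exists_unit_mul_add_eq_zero ((g : Matrix (Fin 3) (Fin 3) ℂ) 0 0)
      ((g : Matrix (Fin 3) (Fin 3) ℂ) 1 0)
    refine red _ (su12_det hxy) (h12 _ _ hxy) g hg fun g' hg' hd => s2 g' hd ?_ ?_
    all_goals
      rw [hg']
      simp [su12, Matrix.mul_apply, Fin.sum_univ_three, -RCLike.star_def, -Complex.star_def, h20, h]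
  obtain ⟨x, y, hxy, h⟩ := exists_unit_mul_add_eq_zero ((g : Matrix (Fin 3) (Fin 3) ℂ) 1 0)
    ((g : Matrix (Fin 3) (Fin 3) ℂ) 2 0)
  refine red _ (su23_det hxy) (h23 _ _ hxy) g hg fun g' hg' hd => s3 g' hd ?_
  rw [hg']
  simp [su23, Matrix.mul_apply, Fin.sum_univ_three, -RCLike.star_def, -Complex.star_def, h]

end SU3

end

/-! ### Commutators and normal subgroups in SU(2) and SU(3) -/

section

theorem UGrp.det_mul {m : ℕ} (g h : UGrp m) : ((g * h : UGrp m) : Matrix (Fin m) (Fin m) ℂ).det =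
    (g : Matrix (Fin m) (Fin m) ℂ).det * (h : Matrix (Fin m) (Fin m) ℂ).det := Matrix.det_mul _ _

theorem UGrp.det_inv {m : ℕ} (g : UGrp m) (hg : (g : Matrix (Fin m) (Fin m) ℂ).det = 1) :
    ((g⁻¹ : UGrp m) : Matrix (Fin m) (Fin m) ℂ).det = 1 := by
  rw [UGrp.coe_inv, Matrix.det_conjTranspose, hg, star_one]

theorem abs_re_le_one {p q : ℂ} (h : p * star p + q * star q = 1) : |p.re| ≤ 1 := by
  rw [unit_iff_norm] at h
  refine (Complex.abs_re_le_norm p).trans ?_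
  nlinarith [sq_nonneg ‖q‖, norm_nonneg p]

theorem cos_arccos_re {p q : ℂ} (h : p * star p + q * star q = 1) :
    Real.cos (Real.arccos p.re) = p.re :=
  Real.cos_arccos (abs_le.mp (abs_re_le_one h)).1 (abs_le.mp (abs_re_le_one h)).2

/-- Every element of `SU(2)` is a commutator. -/
theorem mem_of_commutator_mem {K : Subgroup (UGrp 2)}
    (hK : ∀ u v : UGrp 2, (u : Matrix (Fin 2) (Fin 2) ℂ).det = 1 →
      (v : Matrix (Fin 2) (Fin 2) ℂ).det = 1 → u * v * u⁻¹ * v⁻¹ ∈ K)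
    (g : UGrp 2) (hg : (g : Matrix (Fin 2) (Fin 2) ℂ).det = 1) : g ∈ K := by
  have key : ∀ x y : ℂ, x * star x + y * star y = 1 → ∀ α : ℝ,
      HasMat K (su2 x y * su2 (Complex.exp (Complex.I * α)) 0 * (su2 x y)ᴴ) := by
    intro x y hxy α
    have hw : (0 : ℂ) * star 0 + 1 * star 1 = 1 := by simp
    -- The element `W` inverts the torus, so the commutator of `W` and `T` is `T⁻²`. The angle
    -- `-α/2` makes this the torus element of angle `α`, and every conjugacy class meets the torus.
    have ht : Complex.exp (Complex.I * ((-α / 2 : ℝ) : ℂ)) *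
        star (Complex.exp (Complex.I * ((-α / 2 : ℝ) : ℂ))) + 0 * star 0 = 1 := by
      rw [exp_I_unit]; simp
    let X : UGrp 2 := ⟨su2 x y, su2_mem hxy⟩
    let W : UGrp 2 := ⟨su2 0 1, su2_mem hw⟩
    let T : UGrp 2 := ⟨su2 _ 0, su2_mem ht⟩
    have hX : (X : Matrix (Fin 2) (Fin 2) ℂ).det = 1 := su2_det hxy
    have hW : (W : Matrix (Fin 2) (Fin 2) ℂ).det = 1 := su2_det hw
    have hT : (T : Matrix (Fin 2) (Fin 2) ℂ).det = 1 := su2_det ht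
    have h := hK (X * W * X⁻¹) (X * T * X⁻¹) (by
      rw [UGrp.det_mul, UGrp.det_mul, UGrp.det_inv _ hX, hX, hW]; norm_num)
      (by
      rw [UGrp.det_mul, UGrp.det_mul, UGrp.det_inv _ hX, hX, hT]; norm_num)
    have e : X * W * X⁻¹ * (X * T * X⁻¹) * (X * W * X⁻¹)⁻¹ * (X * T * X⁻¹)⁻¹ =
        X * (W * T * W⁻¹ * T⁻¹) * X⁻¹ := by group
    rw [e] at h
    refine ⟨_, h, ?_⟩
    have e2 : ((W * T * W⁻¹ * T⁻¹ : UGrp 2) : Matrix (Fin 2) (Fin 2) ℂ) =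
        su2 (Complex.exp (Complex.I * α)) 0 := by
      change su2 0 1 * su2 _ 0 * (su2 0 1)ᴴ * (su2 _ 0)ᴴ = _
      rw [su2_conjTranspose, su2_conjTranspose, su2_mul, su2_mul, su2_mul, exp_I_star]
      congr 1
      · simp only [star_zero, star_one, zero_mul, mul_zero, zero_sub, one_mul, mul_one, neg_zero,
          add_zero, sub_zero, exp_I_star, mul_neg, neg_neg, ← Complex.exp_add]
        congr 1
        push_cast; ring
      · simp
    change su2 x y * ((W * T * W⁻¹ * T⁻¹ : UGrp 2) : Matrix (Fin 2) (Fin 2) ℂ) * (su2 x y)ᴴ = _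
    rw [e2]
  obtain ⟨p, q, hpq, hg⟩ := exists_su2 g hg
  rw [← hasMat_coe, hg]
  rcases su2_conj hpq (cos_arccos_re hpq) with ⟨x, y, hxy, h1, h2⟩ | ⟨h1, h2⟩
  · have h := key x y hxy (Real.arccos p.re)
    have e : su2 x y * su2 (Complex.exp (Complex.I * (Real.arccos p.re))) 0 =
        su2 p q * su2 x y := by
      rw [su2_mul, su2_mul, h1, h2]; simp
    rw [e, mul_assoc, ← Matrix.star_eq_conjTranspose,
      Matrix.mem_unitaryGroup_iff.mp (su2_mem hxy), mul_one] at h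
    exact h
  · have h := key 1 0 (by simp) (-Real.arccos p.re)
    rw [su2_one, ← h1, ← h2, Matrix.conjTranspose_one, one_mul, mul_one] at h
    exact h

section Simplicity

variable {K : Subgroup (UGrp 3)}

theorem HasMat.conj (hK : ∀ g : UGrp 3, (g : Matrix (Fin 3) (Fin 3) ℂ).det = 1 →
      ∀ k ∈ K, g * k * g⁻¹ ∈ K) {A B : Matrix (Fin 3) (Fin 3) ℂ}
    (hA : A ∈ Matrix.unitaryGroup (Fin 3) ℂ) (hd : A.det = 1) (hB : HasMat K B) :
    HasMat K (A * B * Aᴴ) := by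
  obtain ⟨k, hk, rfl⟩ := hB
  exact ⟨_, hK ⟨A, hA⟩ hd k hk, rfl⟩

/-- The cyclic permutation of the coordinates of `ℂ³`. -/
def cyc3 : Matrix (Fin 3) (Fin 3) ℂ := !![0, 0, 1; 1, 0, 0; 0, 1, 0]

theorem cyc3_mem : cyc3 ∈ Matrix.unitaryGroup (Fin 3) ℂ := by
  rw [Matrix.mem_unitaryGroup_iff, Matrix.star_eq_conjTranspose]
  ext i j
  fin_cases i <;> fin_cases j <;> simp [cyc3, Matrix.mul_apply, Fin.sum_univ_three]

theorem cyc3_det : cyc3.det = 1 := by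
  rw [Matrix.det_fin_three]; simp [cyc3]

theorem cyc3_conj (p q : ℂ) : cyc3 * su12 p q * cyc3ᴴ = su23 p q := by
  ext i j
  fin_cases i <;> fin_cases j <;>
    simp [cyc3, su12, su23, Matrix.mul_apply, Fin.sum_univ_three]

/-- For a normalized subgroup only the trace of a plane rotation matters, because equal traces in
SU(2) mean conjugate elements; in the exceptional case of `su2_conj` the two elements are inverse to
each other. -/
theorem hasMat_su12_iff (hK : ∀ g : UGrp 3, (g : Matrix (Fin 3) (Fin 3) ℂ).det = 1 →
      ∀ k ∈ K, g * k * g⁻¹ ∈ K) {p q : ℂ} (h : p * star p + q * star q = 1) {α : ℝ}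
    (hα : Real.cos α = p.re) :
    HasMat K (su12 p q) ↔ HasMat K (su12 (Complex.exp (Complex.I * α)) 0) := by
  rcases su2_conj h hα with ⟨x, y, hxy, h1, h2⟩ | ⟨h1, h2⟩
  · have e : su12 p q * su12 x y = su12 x y * su12 (Complex.exp (Complex.I * α)) 0 := by
      rw [su12_mul, su12_mul, h1, h2]; simp
    have u1 : su12 x y * (su12 x y)ᴴ = 1 := Matrix.mem_unitaryGroup_iff.mp (su12_mem hxy)
    have u2 : (su12 x y)ᴴ * su12 x y = 1 := Matrix.mem_unitaryGroup_iff'.mp (su12_mem hxy)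
    constructor
    · intro H
      have H' := HasMat.conj hK (A := (su12 x y)ᴴ) (Unitary.star_mem (su12_mem hxy))
        (by rw [Matrix.det_conjTranspose, su12_det hxy, star_one]) H
      rwa [Matrix.conjTranspose_conjTranspose, mul_assoc, e, ← mul_assoc, u2, one_mul] at H'
    · intro H
      have H' := HasMat.conj hK (su12_mem hxy) (su12_det hxy) H
      rwa [← e, mul_assoc, u1, mul_one] at H'
  · have e : su12 p q = (su12 (Complex.exp (Complex.I * α)) 0)ᴴ := by
      rw [su12_conjTranspose, h1, h2, exp_I_star]
      simp
    rw [e]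
    refine ⟨fun H => ?_, fun H => H.conjTranspose⟩
    have := H.conjTranspose
    rwa [Matrix.conjTranspose_conjTranspose] at this

/-- A subgroup of `U(3)` that is normalized by `SU(3)` and contains rotations of a plane by all small
angles contains `SU(3)`. -/
theorem mem_of_small_rotations (hK : ∀ g : UGrp 3, (g : Matrix (Fin 3) (Fin 3) ℂ).det = 1 →
      ∀ k ∈ K, g * k * g⁻¹ ∈ K) {P : ℝ} (hP : P < 1)
    (h : ∀ c : ℝ, c ∈ Set.Icc (-1 : ℝ) 1 → ∃ p q : ℂ, p * star p + q * star q = 1 ∧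
      p.re = P + (1 - P) * c ∧ HasMat K (su12 p q))
    (g : UGrp 3) (hg : (g : Matrix (Fin 3) (Fin 3) ℂ).det = 1) : g ∈ K := by
  -- The bound `cos α ≥ 1 - α²/2` places `cos α` in the interval of available real parts; any larger
  -- angle is a multiple of a small one.
  have hsmall : ∀ α : ℝ, α ^ 2 ≤ 2 * (1 - P) →
      HasMat K (su12 (Complex.exp (Complex.I * α)) 0) := by
    intro α hα
    have h1 := Real.one_sub_sq_div_two_le_cos (x := α)
    have h2 := Real.cos_le_one α
    have h0 : 0 < 1 - P := by linarith
    obtain ⟨p, q, hpq, hre, H⟩ := h ((Real.cos α - P) / (1 - P)) (by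
      rw [Set.mem_Icc, le_div_iff₀ h0, div_le_iff₀ h0]
      constructor <;> linarith)
    refine (hasMat_su12_iff hK hpq ?_).mp H
    rw [hre, mul_div_cancel₀ _ h0.ne']; ring
  have hall : ∀ α : ℝ, HasMat K (su12 (Complex.exp (Complex.I * α)) 0) := by
    intro α
    obtain ⟨n, hn⟩ := exists_nat_gt (α ^ 2 / (2 * (1 - P)))
    have h0 : 0 < 2 * (1 - P) := by linarith
    have hn0 : 0 < (n : ℝ) := lt_of_le_of_lt (by positivity) hn
    have hn1 : (1 : ℝ) ≤ n := by exact_mod_cast (by exact_mod_cast hn0 : 0 < n)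
    have hpow : ∀ k : ℕ, su12 (Complex.exp (Complex.I * ((α / n : ℝ) : ℂ))) 0 ^ k =
        su12 (Complex.exp (Complex.I * ((k * (α / n) : ℝ) : ℂ))) 0 := by
      intro k
      induction k with
      | zero => simp [su12_one]
      | succ k ih =>
        rw [pow_succ, ih, su12_mul]
        congr 1
        · simp only [star_zero, zero_mul, sub_zero, ← Complex.exp_add]
          congr 1
          push_cast; ring
        · simp
    have := (hsmall (α / n) (by
      rw [div_pow, div_le_iff₀ (by positivity)]
      rw [div_lt_iff₀ h0] at hn
      nlinarith)).pow n
    rwa [hpow, mul_div_cancel₀ _ hn0.ne'] at this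
  have h12 : ∀ p q : ℂ, p * star p + q * star q = 1 → HasMat K (su12 p q) := fun p q hpq =>
    (hasMat_su12_iff hK hpq (cos_arccos_re hpq)).mpr (hall _)
  refine mem_of_su12_su23 h12 (fun p q hpq => ?_) g hg
  rw [← cyc3_conj]
  exact HasMat.conj hK cyc3_mem cyc3_det (h12 p q hpq)

/-- A non-scalar unitary on `ℂ³` does not preserve all lines. -/
theorem exists_conj_ne_zero {w : Matrix (Fin 3) (Fin 3) ℂ}
    (hw : ∀ c : ℂ, w ≠ c • 1) : ∃ q ∈ Matrix.unitaryGroup (Fin 3) ℂ, q.det = 1 ∧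
      ((q * w * qᴴ) 1 0 ≠ 0 ∨ (q * w * qᴴ) 2 0 ≠ 0) := by
  by_contra hcon
  push Not at hcon
  have h1 := hcon 1 (one_mem _) Matrix.det_one
  have h2 := hcon cyc3 cyc3_mem cyc3_det
  have h3 := hcon (cyc3 * cyc3) (mul_mem cyc3_mem cyc3_mem) (by rw [Matrix.det_mul, cyc3_det, one_mul])
  -- The identity and the cyclic shifts force `w` to be diagonal. Conjugating by the 3-4-5 rotation
  -- then produces off-diagonal entries equal to 12/25 times differences of diagonal entries, so `w`
  -- is scalar.
  have hr : ((3 / 5 : ℝ) : ℂ) * star ((3 / 5 : ℝ) : ℂ) + ((4 / 5 : ℝ) : ℂ) * star ((4 / 5 : ℝ) : ℂ) = 1 := by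
    simp only [Complex.star_def, Complex.conj_ofReal]
    push_cast; norm_num
  have h4 := (hcon _ (su12_mem hr) (su12_det hr)).1
  have h5 := (hcon (su12 ((3 / 5 : ℝ) : ℂ) ((4 / 5 : ℝ) : ℂ) * cyc3) (mul_mem (su12_mem hr) cyc3_mem)
    (by rw [Matrix.det_mul, cyc3_det, su12_det hr, one_mul])).1
  simp only [Matrix.mul_apply, Fin.sum_univ_three, cyc3, su12] at h1 h2 h3 h4 h5
  simp [-Complex.ofReal_div] at h1 h2 h3 h4 h5
  obtain ⟨h10, h20⟩ := h1
  obtain ⟨h02, h12⟩ := h2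
  obtain ⟨h21, h01⟩ := h3
  simp [h10, h20, h02, h01] at h4 h5
  apply hw (w 0 0)
  have e1 : w 1 1 = w 0 0 := by linear_combination (-25 / 12 : ℂ) * h4
  have e2 : w 0 0 = w 2 2 := by linear_combination (-25 / 12 : ℂ) * h5
  ext i j
  fin_cases i <;> fin_cases j <;> simp [h10, h20, h02, h12, h21, h01, e1, e2]

/-- If a subgroup of `U(3)` is normalized by `SU(3)` and contains the commutators of `SU(3)` with a
non-scalar unitary, then it contains `SU(3)`. -/
theorem mem_of_commutator_nonscalar (hK : ∀ g : UGrp 3, (g : Matrix (Fin 3) (Fin 3) ℂ).det = 1 →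
      ∀ k ∈ K, g * k * g⁻¹ ∈ K) (w : UGrp 3)
    (hw : ∀ c : ℂ, (w : Matrix (Fin 3) (Fin 3) ℂ) ≠ c • 1)
    (hc : ∀ g : UGrp 3, (g : Matrix (Fin 3) (Fin 3) ℂ).det = 1 → w * g * w⁻¹ * g⁻¹ ∈ K)
    (g : UGrp 3) (hg : (g : Matrix (Fin 3) (Fin 3) ℂ).det = 1) : g ∈ K := by
  have hconj : ∀ q w : UGrp 3, (q : Matrix (Fin 3) (Fin 3) ℂ).det = 1 →
      (∀ g : UGrp 3, (g : Matrix (Fin 3) (Fin 3) ℂ).det = 1 → w * g * w⁻¹ * g⁻¹ ∈ K) →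
      ∀ g : UGrp 3, (g : Matrix (Fin 3) (Fin 3) ℂ).det = 1 →
        (q * w * q⁻¹) * g * (q * w * q⁻¹)⁻¹ * g⁻¹ ∈ K := by
    intro q w hq h g hg
    have := hK q hq _ (h (q⁻¹ * g * q) (by
      rw [UGrp.det_mul, UGrp.det_mul, UGrp.det_inv _ hq, hq, hg]; norm_num))
    convert this using 1
    group
  obtain ⟨q, hq, hqd, hne⟩ := exists_conj_ne_zero hw
  have hc1 := hconj ⟨q, hq⟩ w hqd hc
  set w1 : UGrp 3 := ⟨q, hq⟩ * w * ⟨q, hq⟩⁻¹ with hw1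
  have hw1' : (w1 : Matrix (Fin 3) (Fin 3) ℂ) = q * w * qᴴ := rfl
  rw [← hw1'] at hne
  -- A rotation of the last two coordinates brings the first column to the form `(a, b, 0)` with `b
  -- ≠ 0`.
  obtain ⟨x, y, hxy, h20⟩ := exists_unit_mul_add_eq_zero
    ((w1 : Matrix (Fin 3) (Fin 3) ℂ) 1 0) ((w1 : Matrix (Fin 3) (Fin 3) ℂ) 2 0)
  have hc2 := hconj ⟨su23 x y, su23_mem hxy⟩ w1 (su23_det hxy) hc1
  set w2 : UGrp 3 := ⟨su23 x y, su23_mem hxy⟩ * w1 * ⟨su23 x y, su23_mem hxy⟩⁻¹ with hw2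
  have hw2' : (w2 : Matrix (Fin 3) (Fin 3) ℂ) = su23 x y * w1 * (su23 x y)ᴴ := rfl
  have e20 : (w2 : Matrix (Fin 3) (Fin 3) ℂ) 2 0 = 0 := by
    rw [hw2']
    simp only [su23, Matrix.mul_apply, Fin.sum_univ_three]
    simp [-RCLike.star_def, -Complex.star_def, h20]
  have e10 : (w2 : Matrix (Fin 3) (Fin 3) ℂ) 1 0 ≠ 0 := by
    rw [hw2']
    simp only [su23, Matrix.mul_apply, Fin.sum_univ_three]
    simp [-RCLike.star_def, -Complex.star_def]
    intro h
    have h1 : (w1 : Matrix (Fin 3) (Fin 3) ℂ) 1 0 = 0 := by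
      linear_combination (-(w1 : Matrix (Fin 3) (Fin 3) ℂ) 1 0) * hxy + star x * h + star y * h20
    have h2 : (w1 : Matrix (Fin 3) (Fin 3) ℂ) 2 0 = 0 := by
      linear_combination (-(w1 : Matrix (Fin 3) (Fin 3) ℂ) 2 0) * hxy - y * h + x * h20
    exact hne.elim (fun h => h h1) (fun h => h h2)
  set a := (w2 : Matrix (Fin 3) (Fin 3) ℂ) 0 0 with ha
  set b := (w2 : Matrix (Fin 3) (Fin 3) ℂ) 1 0 with hb
  have hab : a * star a + b * star b = 1 := by
    have := congrFun (congrFun w2.conjTranspose_mul 0) 0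
    simp [Matrix.mul_apply, Fin.sum_univ_three, -RCLike.star_def, -Complex.star_def, e20, ← ha,
      ← hb] at this
    linear_combination this
  have habn := unit_iff_norm.mp hab
  have hb0 : 0 < ‖b‖ := norm_pos_iff.mpr e10
  refine mem_of_small_rotations hK (P := ‖a‖ ^ 2) (by nlinarith) (fun c hcc => ?_) g hg
  set θ := Real.arccos c
  have hθ : Real.cos θ = c := Real.cos_arccos hcc.1 hcc.2
  set ν := Complex.exp (Complex.I * ((θ / 3 : ℝ) : ℂ)) with hν
  have hνν : ν * star ν = 1 := exp_I_unit _
  have hζ : star ν ^ 3 = Real.cos θ - Real.sin θ * Complex.I := by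
    rw [hν, exp_I_star, ← Complex.exp_nat_mul]
    have : ((3 : ℕ) : ℂ) * -(Complex.I * ((θ / 3 : ℝ) : ℂ)) = (-θ : ℂ) * Complex.I := by
      push_cast; ring
    rw [this, Complex.exp_mul_I, Complex.cos_neg, Complex.sin_neg, Complex.ofReal_cos,
      Complex.ofReal_sin]
    ring
  -- This matrix is `star ν` times a rank-one perturbation of the identity, so its commutator with
  -- `w2` moves only the span of `e₀` and `w2 e₀`, the plane of the first two coordinates. There it
  -- is a rotation with real part `‖a‖² + (1 - ‖a‖²) cos θ`, which sweeps an interval ending at 1.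
  have hD : Matrix.diagonal ![ν ^ 2, star ν, star ν] ∈ Matrix.unitaryGroup (Fin 3) ℂ := by
    rw [Matrix.mem_unitaryGroup_iff, Matrix.star_eq_conjTranspose, Matrix.diagonal_conjTranspose,
      Matrix.diagonal_mul_diagonal, ← Matrix.diagonal_one]
    congr 1
    funext i
    fin_cases i
    · simp only [Fin.zero_eta, Matrix.cons_val_zero, Pi.star_apply, star_pow]
      linear_combination (ν * star ν + 1) * hνν
    · simp [-RCLike.star_def, -Complex.star_def]; linear_combination hνν
    · simp [-RCLike.star_def, -Complex.star_def]; linear_combination hνν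
  have hDd : (Matrix.diagonal ![ν ^ 2, star ν, star ν]).det = 1 := by
    rw [Matrix.det_diagonal, Fin.prod_univ_three]
    simp [-RCLike.star_def, -Complex.star_def]
    linear_combination (ν * star ν + 1) * hνν
  have H : HasMat K _ := ⟨_, hc2 ⟨_, hD⟩ hDd, rfl⟩
  set p := star ν ^ 3 * (1 + (ν ^ 3 - 1) * (a * star a)) with hp
  set q' := star ν ^ 3 * ((ν ^ 3 - 1) * (b * star a)) with hq'
  have hν3 : ν ^ 3 * star ν ^ 3 = 1 := by rw [← mul_pow, hνν, one_pow]
  have hsp : star p = ν ^ 3 * (1 + (star ν ^ 3 - 1) * (star a * a)) := by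
    rw [hp]
    simp only [star_mul', star_add, star_sub, star_pow, star_one, star_star]
  have hsq : star q' = ν ^ 3 * ((star ν ^ 3 - 1) * (star b * a)) := by
    rw [hq']
    simp only [star_mul', star_sub, star_pow, star_one, star_star]
  refine ⟨p, q', ?_, ?_, ?_⟩
  · rw [hsp, hsq, hp, hq']
    generalize ν ^ 3 = z at *
    generalize star ν ^ 3 = z' at *
    linear_combination ((1 + (z - 1) * (a * star a)) * (1 + (z' - 1) * (a * star a)) +
      (z - 1) * (z' - 1) * (b * star b) * (a * star a) + a * star a) * hν3 +
        ((z - 1) * (z' - 1) * (a * star a)) * hab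
  · have : p = star ν ^ 3 * (1 - ‖a‖ ^ 2) + ‖a‖ ^ 2 := by
      have hn := mul_star_eq_norm a
      push_cast at hn
      rw [hp, hn]
      linear_combination ((‖a‖ : ℂ) ^ 2) * hν3
    rw [this, hζ]
    have : ((Real.cos θ : ℂ) - Real.sin θ * Complex.I) * (1 - (‖a‖ : ℂ) ^ 2) + (‖a‖ : ℂ) ^ 2 =
      ((Real.cos θ * (1 - ‖a‖ ^ 2) + ‖a‖ ^ 2 : ℝ) : ℂ) +
        ((-Real.sin θ * (1 - ‖a‖ ^ 2) : ℝ) : ℂ) * Complex.I := by push_cast; ring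
    rw [this, Complex.add_re, Complex.ofReal_re, Complex.re_ofReal_mul, Complex.I_re, hθ]
    ring
  · convert H using 1
    change _ = (w2 : Matrix (Fin 3) (Fin 3) ℂ) * Matrix.diagonal ![ν ^ 2, star ν, star ν] *
      (w2 : Matrix (Fin 3) (Fin 3) ℂ)ᴴ * (Matrix.diagonal ![ν ^ 2, star ν, star ν])ᴴ
    have hww := w2.mul_conjTranspose
    have hent : ∀ i j, ((w2 : Matrix (Fin 3) (Fin 3) ℂ) *
        Matrix.diagonal ![ν ^ 2, star ν, star ν] * (w2 : Matrix (Fin 3) (Fin 3) ℂ)ᴴ) i j =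
        star ν * ((1 : Matrix (Fin 3) (Fin 3) ℂ) i j + (ν ^ 3 - 1) *
          ((w2 : Matrix (Fin 3) (Fin 3) ℂ) i 0 * star ((w2 : Matrix (Fin 3) (Fin 3) ℂ) j 0))) := by
      intro i j
      rw [← hww]
      simp only [Matrix.mul_apply, Matrix.conjTranspose_apply,
        Fin.sum_univ_three]
      simp [-RCLike.star_def, -Complex.star_def]
      linear_combination (-(w2 : Matrix (Fin 3) (Fin 3) ℂ) i 0 * star ((w2 : Matrix (Fin 3) (Fin 3) ℂ) j 0) * ν ^ 2) * hνν
    ext i j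
    rw [Matrix.diagonal_conjTranspose, Matrix.mul_diagonal, hent]
    fin_cases i <;> fin_cases j <;>
      simp [su12, e20, ← ha, ← hb, -RCLike.star_def, -Complex.star_def]
    · rw [hp]; ring
    · rw [hsq]
      linear_combination (-(star b * a)) * hν3 - (ν ^ 3 - 1) * (a * star b) * hνν
    · rw [hq']; ring
    · rw [hsp]
      linear_combination (a * star a) * hν3 - (1 + (ν ^ 3 - 1) * (b * star b)) * hνν -
        (ν ^ 3 - 1) * hab
    · linear_combination -hνν

end Simplicity

end

/-! ### Representations of the symmetric groups from tight frames -/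

section

section Extension

variable {G A B : Type*} [Group G] [Ring A] [Algebra ℂ A] [Ring B] [Algebra ℂ B]

/-- If a representation `ρ` of a finite group `G` identifies the group algebra with `A`, then all
representations of `G` factor through `A`. -/
theorem exists_algHom_of_adjoin_eq_top [Fintype G] (ρ : G →* A) (hρ : Algebra.adjoin ℂ (Set.range ρ) = ⊤)
    [FiniteDimensional ℂ A] (hdim : Module.finrank ℂ A = Fintype.card G) (P : G →* B) :
    ∃ Θ : A →ₐ[ℂ] B, ∀ g, Θ (ρ g) = P g := by
  let F : MonoidAlgebra ℂ G →ₐ[ℂ] A := MonoidAlgebra.lift ℂ A G ρ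
  have hF : ∀ g, F (MonoidAlgebra.of ℂ G g) = ρ g := fun g => by simp [F]
  have hsurj : Function.Surjective F := by
    rw [← AlgHom.range_eq_top, eq_top_iff, ← hρ]
    refine Algebra.adjoin_le ?_
    rintro _ ⟨g, rfl⟩
    exact ⟨_, hF g⟩
  have hfin : Module.finrank ℂ (MonoidAlgebra ℂ G) = Fintype.card G := by
    rw [(MonoidAlgebra.coeffLinearEquiv (R := ℂ) (S := ℂ) (M := G)).finrank_eq, Module.finrank_finsupp_self]
  have : FiniteDimensional ℂ (MonoidAlgebra ℂ G) :=
    Module.Finite.equiv (MonoidAlgebra.coeffLinearEquiv (R := ℂ) (S := ℂ) (M := G)).symm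
  -- The surjection from the group algebra is an isomorphism since the dimensions agree.
  have hinj : Function.Injective F :=
    (LinearMap.injective_iff_surjective_of_finrank_eq_finrank (f := F.toLinearMap)
      (hfin.trans hdim.symm)).mpr hsurj
  let e := AlgEquiv.ofBijective F ⟨hinj, hsurj⟩
  refine ⟨(MonoidAlgebra.lift ℂ B G P).comp e.symm.toAlgHom, fun g => ?_⟩
  have : e.symm (ρ g) = MonoidAlgebra.of ℂ G g := by
    rw [AlgEquiv.symm_apply_eq]; exact (hF g).symm
  change MonoidAlgebra.lift ℂ B G P (e.symm (ρ g)) = _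
  rw [this]
  simp

/-- On group elements the star is the inverse in both algebras, and these elements generate `A`.
This is what makes the homomorphisms to the qudit operators preserve unitaries. -/
theorem map_star_of_adjoin_eq_top [StarRing A] [StarModule ℂ A] [StarRing B] [StarModule ℂ B]
    (ρ : G →* A) (hρ : Algebra.adjoin ℂ (Set.range ρ) = ⊤) (P : G →* B)
    (hρs : ∀ g, star (ρ g) = ρ g⁻¹) (hPs : ∀ g, star (P g) = P g⁻¹) (Θ : A →ₐ[ℂ] B)
    (hΘ : ∀ g, Θ (ρ g) = P g) (a : A) : Θ (star a) = star (Θ a) := by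
  have ha : a ∈ Algebra.adjoin ℂ (Set.range ρ) := hρ ▸ Algebra.mem_top
  induction ha using Algebra.adjoin_induction with
  | mem x hx => obtain ⟨g, rfl⟩ := hx; rw [hρs, hΘ, hΘ, hPs]
  | algebraMap r => rw [← algebraMap_star_comm, AlgHom.commutes, AlgHom.commutes, algebraMap_star_comm]
  | add x y _ _ hx hy => rw [star_add, map_add, hx, hy, map_add, star_add]
  | mul x y _ _ hx hy => rw [star_mul, map_mul, hx, hy, map_mul, star_mul]

end Extension

/-- The permutation matrices. -/
def permMat (m : ℕ) : Equiv.Perm (Fin m) →* Matrix (Fin m) (Fin m) ℂ where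
  toFun σ := Matrix.of fun x y => if x = σ y then 1 else 0
  map_one' := by ext x y; simp only [Matrix.of_apply, Matrix.one_apply]; congr
  map_mul' σ τ := by
    ext x y
    simp only [Matrix.mul_apply, Matrix.of_apply, mul_ite, mul_one, mul_zero, Finset.sum_ite_eq',
      Finset.mem_univ, if_true]
    rfl

theorem permMat_apply (m : ℕ) (σ : Equiv.Perm (Fin m)) (x y : Fin m) :
    permMat m σ x y = if x = σ y then 1 else 0 := rfl

/-- The representation of the symmetric group on the column space of `W`, a tight frame in the
complement of the trivial representation. -/
def permRep {m k : ℕ} (W : Matrix (Fin m) (Fin k) ℂ) (c e : ℂ) (h1 : c • (Wᵀ * W) = 1)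
    (h2 : ∀ x y, c * (W * Wᵀ) x y = (if x = y then 1 else 0) - e) (h3 : ∀ j, ∑ x, W x j = 0) :
    Equiv.Perm (Fin m) →* Matrix (Fin k) (Fin k) ℂ where
  toFun σ := c • (Wᵀ * permMat m σ * W)
  map_one' := by rw [map_one, Matrix.mul_one, h1]
  map_mul' σ τ := by
    -- Up to the multiple `e` of the all-ones matrix the frame operator is the identity; that
    -- multiple disappears because it absorbs permutations and kills `W`.
    have hP : c • (W * Wᵀ) = 1 - e • Matrix.of fun _ _ => 1 := by
      ext x y
      rw [Matrix.smul_apply, smul_eq_mul, h2]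
      simp [Matrix.one_apply]
    have hJ : (Matrix.of fun _ _ => 1 : Matrix (Fin m) (Fin m) ℂ) * permMat m τ =
        Matrix.of fun _ _ => 1 := by
      ext x y
      simp [Matrix.mul_apply, permMat_apply]
    have hJW : (Matrix.of fun _ _ => 1 : Matrix (Fin m) (Fin m) ℂ) * W = 0 := by
      ext x y
      simp [Matrix.mul_apply, h3]
    have : c • (Wᵀ * permMat m σ * W) * c • (Wᵀ * permMat m τ * W) =
        c • (Wᵀ * permMat m σ * (c • (W * Wᵀ)) * (permMat m τ * W)) := by
      simp only [Matrix.smul_mul, Matrix.mul_smul, Matrix.mul_assoc]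
    rw [this, hP, Matrix.mul_sub, Matrix.sub_mul, Matrix.mul_one, Matrix.mul_smul, Matrix.smul_mul,
      Matrix.mul_assoc _ (Matrix.of _), ← Matrix.mul_assoc (Matrix.of _) _ W, hJ, hJW,
      Matrix.mul_zero, smul_zero, sub_zero, map_mul]
    simp only [Matrix.mul_assoc]

theorem permRep_apply {m k : ℕ} (W : Matrix (Fin m) (Fin k) ℂ) (c e : ℂ) (h1 h2 h3)
    (σ : Equiv.Perm (Fin m)) (i j : Fin k) :
    permRep W c e h1 h2 h3 σ i j = c * ∑ x, W (σ x) i * W x j := by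
  change (c • (Wᵀ * permMat m σ * W)) i j = _
  rw [Matrix.smul_apply, Matrix.mul_apply, smul_eq_mul]
  congr 1
  refine Finset.sum_congr rfl fun x _ => ?_
  simp [Matrix.mul_apply, permMat_apply]

theorem permRep_conjTranspose {m k : ℕ} (W : Matrix (Fin m) (Fin k) ℂ) (c e : ℂ) (h1 h2 h3)
    (hW : ∀ x j, star (W x j) = W x j) (hc : star c = c) (σ : Equiv.Perm (Fin m)) :
    (permRep W c e h1 h2 h3 σ)ᴴ = permRep W c e h1 h2 h3 σ⁻¹ := by
  ext i j
  rw [Matrix.conjTranspose_apply, permRep_apply, permRep_apply, star_mul', hc, star_sum]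
  congr 1
  refine Fintype.sum_equiv σ _ _ fun x => ?_
  rw [star_mul', hW, hW, mul_comm]
  simp

/-- The vertices of a regular tetrahedron. -/
def frame31 : Matrix (Fin 4) (Fin 3) ℂ := !![1, 1, 1; 1, -1, -1; -1, 1, -1; -1, -1, 1]

/-- The vertices of a regular triangle. -/
def frame21 : Matrix (Fin 3) (Fin 2) ℂ :=
  !![1 / 2, (√3 : ℝ) / 2; 1 / 2, -((√3 : ℝ) / 2); -1, 0]

theorem sqrt3_mul : ((√3 : ℝ) : ℂ) * ((√3 : ℝ) : ℂ) = 3 := by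
  rw [← Complex.ofReal_mul, Real.mul_self_sqrt (by norm_num)]; norm_num

theorem sqrt3_sq : ((√3 : ℝ) : ℂ) ^ 2 = 3 := by rw [sq, sqrt3_mul]

/-- The irrep `(3,1)` of `𝕊₄`, by signed permutation matrices. -/
def rep31 : Equiv.Perm (Fin 4) →* Matrix (Fin 3) (Fin 3) ℂ :=
  permRep frame31 (1 / 4) (1 / 4)
    (by
      ext i j
      simp only [Matrix.smul_apply, Matrix.mul_apply, Matrix.transpose_apply, Fin.sum_univ_four]
      fin_cases i <;> fin_cases j <;> simp [frame31] <;> norm_num)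
    (by
      intro i j
      simp only [Matrix.mul_apply, Matrix.transpose_apply, Fin.sum_univ_three]
      fin_cases i <;> fin_cases j <;> simp [frame31] <;> norm_num)
    (by
      intro j
      simp only [Fin.sum_univ_four]
      fin_cases j <;> simp [frame31])

/-- The irrep `(2,1)` of `𝕊₃`, in Young's orthogonal form. -/
def rep21 : Equiv.Perm (Fin 3) →* Matrix (Fin 2) (Fin 2) ℂ :=
  permRep frame21 (2 / 3) (1 / 3)
    (by
      ext i j
      simp only [Matrix.smul_apply, Matrix.mul_apply, Matrix.transpose_apply, Fin.sum_univ_three]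
      fin_cases i <;> fin_cases j <;> simp [frame21] <;> ring_nf <;> norm_num [sqrt3_sq])
    (by
      intro i j
      simp only [Matrix.mul_apply, Matrix.transpose_apply, Fin.sum_univ_two]
      fin_cases i <;> fin_cases j <;> simp [frame21] <;> ring_nf <;> norm_num [sqrt3_sq])
    (by
      intro j
      simp only [Fin.sum_univ_three]
      fin_cases j <;> simp [frame21] <;> norm_num)

/-- The pairing of `{0, 1, 2, 3}` that contains the pair `{a, b}`. -/
def pairing : Fin 4 → Fin 4 → Fin 3 := ![![0, 0, 1, 2], ![0, 0, 2, 1], ![1, 2, 0, 0], ![2, 1, 0, 0]]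

theorem pairing_symm : ∀ p q : Fin 4, pairing p q = pairing q p := by decide

theorem pairing_compl : ∀ p q r s : Fin 4, [p, q, r, s].Nodup →
    pairing q r = pairing p s := by
  decide

/-- Every pair contains 0 or is the complement of a pair that does, and permutations respect
complements. The diagonal values of `pairing` are placeholders, whence `a ≠ b`. This gives the
quotient map from `𝕊₄` to `𝕊₃`. -/
theorem pairing_perm (σ : Equiv.Perm (Fin 4)) (a b : Fin 4) (h : a ≠ b) :
    pairing (σ a) (σ b) = pairing (σ 0) (σ (pairing a b).succ) := by
  have hσ : ∀ l : List (Fin 4), l.Nodup → (l.map σ).Nodup := fun l h => h.map σ.injective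
  fin_cases a <;> fin_cases b <;>
  first
  | exact absurd rfl h
  | rfl
  | exact pairing_symm _ _
  | exact pairing_compl _ _ _ _ (hσ [0, 1, 2, 3] (by decide))
  | exact pairing_compl _ _ _ _ (hσ [0, 1, 3, 2] (by decide))
  | exact pairing_compl _ _ _ _ (hσ [0, 2, 1, 3] (by decide))
  | exact pairing_compl _ _ _ _ (hσ [0, 2, 3, 1] (by decide))
  | exact pairing_compl _ _ _ _ (hσ [0, 3, 1, 2] (by decide))
  | exact pairing_compl _ _ _ _ (hσ [0, 3, 2, 1] (by decide))

/-- The action of `𝕊₄` on the three pairings of `{0, 1, 2, 3}`. -/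
def pairingHom : Equiv.Perm (Fin 4) →* Equiv.Perm (Fin 3) :=
  MonoidHom.toHomPerm
    { toFun := fun σ k => pairing (σ 0) (σ k.succ)
      map_one' := by funext k; fin_cases k <;> rfl
      map_mul' := fun σ τ => funext fun k => pairing_perm σ _ _
        (τ.injective.ne (Fin.succ_ne_zero k).symm) }

end

/-! ### The group algebras of `𝕊₃` and `𝕊₄` as sums of matrix algebras -/

section

/-- The sign character. -/
def sgnHom (m : ℕ) : Equiv.Perm (Fin m) →* ℂ :=
  ((Int.castRingHom ℂ : ℤ →* ℂ).comp (Units.coeHom ℤ)).comp Equiv.Perm.sign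

theorem sgnHom_swap {m : ℕ} {i j : Fin m} (h : i ≠ j) : sgnHom m (Equiv.swap i j) = -1 := by
  simp [sgnHom, Equiv.Perm.sign_swap h]

theorem sgnHom_inv {m : ℕ} (σ : Equiv.Perm (Fin m)) : sgnHom m σ⁻¹ = sgnHom m σ := by
  simp [sgnHom]

theorem star_sgnHom {m : ℕ} (σ : Equiv.Perm (Fin m)) : star (sgnHom m σ) = sgnHom m σ := by
  simp [sgnHom]

/-- The group algebra of `𝕊₃`, as the sum of the matrix algebras of the irreps
`(2,1)`, `(3)`, `(1,1,1)`. -/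
abbrev Alg3 : Type := Matrix (Fin 2) (Fin 2) ℂ × ℂ × ℂ

/-- The group algebra of `𝕊₄`, as the sum of the matrix algebras of the irreps
`(3,1)`, `(2,1,1)`, `(2,2)`, `(4)`, `(1,1,1,1)`. -/
abbrev Alg4 : Type := Matrix (Fin 3) (Fin 3) ℂ × Matrix (Fin 3) (Fin 3) ℂ × Alg3

/-- The sum of the irreps of `𝕊₃`. -/
def rep3 : Equiv.Perm (Fin 3) →* Alg3 := rep21.prod (MonoidHom.prod 1 (sgnHom 3))

/-- The irrep `(2,1,1)` of `𝕊₄`. -/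
def rep211 : Equiv.Perm (Fin 4) →* Matrix (Fin 3) (Fin 3) ℂ where
  toFun σ := sgnHom 3 (pairingHom σ) • rep31 σ
  map_one' := by simp
  map_mul' σ τ := by simp [smul_smul, mul_comm]

theorem rep211_apply (σ : Equiv.Perm (Fin 4)) :
    rep211 σ = sgnHom 3 (pairingHom σ) • rep31 σ := rfl

/-- The sum of the irreps of `𝕊₄`. -/
def rep4 : Equiv.Perm (Fin 4) →* Alg4 := rep31.prod (rep211.prod (rep3.comp pairingHom))

theorem rep4_apply (σ : Equiv.Perm (Fin 4)) :
    rep4 σ = (rep31 σ, rep211 σ, rep3 (pairingHom σ)) := rfl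

theorem rep3_apply (σ : Equiv.Perm (Fin 3)) : rep3 σ = (rep21 σ, 1, sgnHom 3 σ) := rfl

theorem pairingHom_swap01 : pairingHom (Equiv.swap 0 1) = Equiv.swap 1 2 := by decide
theorem pairingHom_swap23 : pairingHom (Equiv.swap 2 3) = Equiv.swap 1 2 := by decide
theorem pairingHom_swap12 : pairingHom (Equiv.swap 1 2) = Equiv.swap 0 1 := by decide
theorem pairingHom_swap03 : pairingHom (Equiv.swap 0 3) = Equiv.swap 0 1 := by decide
theorem pairingHom_swap02 : pairingHom (Equiv.swap 0 2) = Equiv.swap 0 2 := by decide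
theorem pairingHom_swap13 : pairingHom (Equiv.swap 1 3) = Equiv.swap 0 2 := by decide

theorem rep21_swap01 : rep21 (Equiv.swap 0 1) = !![1, 0; 0, -1] := by
  ext i j
  simp only [rep21, permRep_apply, Fin.sum_univ_three]
  fin_cases i <;> fin_cases j <;> simp [frame21, Equiv.swap_apply_def] <;> ring_nf <;>
    norm_num [sqrt3_sq]

theorem rep21_swap12 : rep21 (Equiv.swap 1 2) =
    !![-1 / 2, ((√3 : ℝ) : ℂ) / 2; ((√3 : ℝ) : ℂ) / 2, 1 / 2] := by
  ext i j
  simp only [rep21, permRep_apply, Fin.sum_univ_three]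
  fin_cases i <;> fin_cases j <;> simp [frame21, Equiv.swap_apply_def] <;> ring_nf <;>
    norm_num [sqrt3_sq]

theorem rep21_swap02 : rep21 (Equiv.swap 0 2) =
    !![-1 / 2, -(((√3 : ℝ) : ℂ) / 2); -(((√3 : ℝ) : ℂ) / 2), 1 / 2] := by
  ext i j
  simp only [rep21, permRep_apply, Fin.sum_univ_three]
  fin_cases i <;> fin_cases j <;> simp [frame21, Equiv.swap_apply_def] <;> ring_nf <;>
    norm_num [sqrt3_sq]

theorem rep31_swap01 : rep31 (Equiv.swap 0 1) = !![1, 0, 0; 0, 0, -1; 0, -1, 0] := by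
  ext i j
  simp only [rep31, permRep_apply, Fin.sum_univ_four]
  fin_cases i <;> fin_cases j <;> simp [frame31, Equiv.swap_apply_def] <;> norm_num

theorem rep31_swap23 : rep31 (Equiv.swap 2 3) = !![1, 0, 0; 0, 0, 1; 0, 1, 0] := by
  ext i j
  simp only [rep31, permRep_apply, Fin.sum_univ_four]
  fin_cases i <;> fin_cases j <;> simp [frame31, Equiv.swap_apply_def] <;> norm_num

theorem rep31_swap12 : rep31 (Equiv.swap 1 2) = !![0, 1, 0; 1, 0, 0; 0, 0, 1] := by
  ext i j
  simp only [rep31, permRep_apply, Fin.sum_univ_four]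
  fin_cases i <;> fin_cases j <;> simp [frame31, Equiv.swap_apply_def] <;> norm_num

theorem rep31_swap03 : rep31 (Equiv.swap 0 3) = !![0, -1, 0; -1, 0, 0; 0, 0, 1] := by
  ext i j
  simp only [rep31, permRep_apply, Fin.sum_univ_four]
  fin_cases i <;> fin_cases j <;> simp [frame31, Equiv.swap_apply_def] <;> norm_num

theorem rep31_swap02 : rep31 (Equiv.swap 0 2) = !![0, 0, -1; 0, 1, 0; -1, 0, 0] := by
  ext i j
  simp only [rep31, permRep_apply, Fin.sum_univ_four]
  fin_cases i <;> fin_cases j <;> simp [frame31, Equiv.swap_apply_def] <;> norm_num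

theorem rep31_swap13 : rep31 (Equiv.swap 1 3) = !![0, 0, 1; 0, 1, 0; 1, 0, 0] := by
  ext i j
  simp only [rep31, permRep_apply, Fin.sum_univ_four]
  fin_cases i <;> fin_cases j <;> simp [frame31, Equiv.swap_apply_def] <;> norm_num

/-- The sign between the two three-dimensional irreps on a transposition is the source of the
correlation. -/
theorem rep211_swap {i j : Fin 4} {k l : Fin 3} (h : pairingHom (Equiv.swap i j) = Equiv.swap k l)
    (hkl : k ≠ l) : rep211 (Equiv.swap i j) = -rep31 (Equiv.swap i j) := by
  rw [rep211_apply, h, sgnHom_swap hkl, neg_one_smul]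

theorem star_rep31 (σ : Equiv.Perm (Fin 4)) : star (rep31 σ) = rep31 σ⁻¹ :=
  permRep_conjTranspose _ _ _ _ _ _
    (by
      intro x j
      fin_cases x <;> fin_cases j <;> simp [frame31])
    (by simp) σ

theorem star_rep21 (σ : Equiv.Perm (Fin 3)) : star (rep21 σ) = rep21 σ⁻¹ :=
  permRep_conjTranspose _ _ _ _ _ _
    (by
      intro x j
      fin_cases x <;> fin_cases j <;> simp [frame21])
    (by simp) σ

theorem star_rep3 (σ : Equiv.Perm (Fin 3)) : star (rep3 σ) = rep3 σ⁻¹ := by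
  rw [rep3_apply, rep3_apply, sgnHom_inv]
  refine Prod.ext (star_rep21 σ) (Prod.ext (star_one ℂ) (star_sgnHom σ))

theorem star_rep4 (σ : Equiv.Perm (Fin 4)) : star (rep4 σ) = rep4 σ⁻¹ := by
  rw [rep4_apply, rep4_apply, map_inv pairingHom]
  refine Prod.ext (star_rep31 σ) (Prod.ext ?_ (star_rep3 _))
  change star (rep211 σ) = _
  rw [rep211_apply, rep211_apply, map_inv pairingHom, sgnHom_inv, star_smul, star_sgnHom, star_rep31]

theorem Subalgebra.block_mem {A : Type*} {m : ℕ} [Ring A] [Algebra ℂ A]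
    (f : Matrix (Fin m) (Fin m) ℂ →ₗ[ℂ] A) (S : Subalgebra ℂ A)
    (h : ∀ i j, f (Matrix.single i j 1) ∈ S) (X : Matrix (Fin m) (Fin m) ℂ) : f X ∈ S := by
  rw [Matrix.matrix_eq_sum_single X, map_sum]
  refine S.sum_mem fun i _ => ?_
  rw [map_sum]
  refine S.sum_mem fun j _ => ?_
  rw [← mul_one (X i j), ← smul_eq_mul, ← Matrix.smul_single, map_smul]
  exact S.smul_mem (h i j) _

/-- The sum of the transpositions vanishes in (2,1) and takes the values `±3` on the two characters,
so it splits off the one-dimensional blocks. In the remaining block, the eigenprojections of one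
transposition cut matrix units out of another. -/
theorem adjoin_rep3 : Algebra.adjoin ℂ (Set.range rep3) = ⊤ := by
  set S := Algebra.adjoin ℂ (Set.range rep3)
  have hr : ∀ σ, rep3 σ ∈ S := fun σ => Algebra.subset_adjoin ⟨σ, rfl⟩
  have m1 := hr (Equiv.swap 0 1)
  have m2 := hr (Equiv.swap 1 2)
  have m3 := hr (Equiv.swap 0 2)
  rw [rep3_apply, sgnHom_swap (by decide)] at m1 m2 m3
  rw [rep21_swap01] at m1
  rw [rep21_swap12] at m2
  rw [rep21_swap02] at m3
  have h0 : ((0, 1, -1) : Alg3) ∈ S := by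
    have := S.smul_mem (S.add_mem (S.add_mem m1 m2) m3) (1 / 3 : ℂ)
    convert this using 1
    refine Prod.ext ?_ (Prod.ext ?_ ?_)
    · ext i j
      fin_cases i <;> fin_cases j <;> simp <;> norm_num
    · simp; norm_num
    · simp; norm_num
  have h1 : ((0, 1, 1) : Alg3) ∈ S := by
    have := S.mul_mem h0 h0
    simpa using this
  have h2 : ((0, 1, 0) : Alg3) ∈ S := by
    have := S.smul_mem (S.add_mem h0 h1) (1 / 2 : ℂ)
    simpa [one_add_one_eq_two] using this
  have h3 : ((0, 0, 1) : Alg3) ∈ S := by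
    have := S.sub_mem h1 h2
    simpa using this
  have t1 : ((!![1, 0; 0, -1], 0, 0) : Alg3) ∈ S := by
    have := S.sub_mem m1 h0
    convert this using 1
    refine Prod.ext ?_ (Prod.ext ?_ ?_) <;> simp
  have t2 : ((!![-1 / 2, ((√3 : ℝ) : ℂ) / 2; ((√3 : ℝ) : ℂ) / 2, 1 / 2], 0, 0) : Alg3) ∈ S := by
    have := S.sub_mem m2 h0
    convert this using 1
    refine Prod.ext ?_ (Prod.ext ?_ ?_) <;> simp
  have t0 : ((1, 0, 0) : Alg3) ∈ S := by
    have := S.sub_mem S.one_mem h1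
    convert this using 1
    refine Prod.ext ?_ (Prod.ext ?_ ?_) <;> simp
  have d0 : ((Matrix.single 0 0 1, 0, 0) : Alg3) ∈ S := by
    have := S.smul_mem (S.add_mem t0 t1) (1 / 2 : ℂ)
    convert this using 1
    refine Prod.ext ?_ (Prod.ext ?_ ?_)
    · ext i j
      fin_cases i <;> fin_cases j <;> simp [Matrix.single] <;> norm_num
    · simp
    · simp
  have d1 : ((Matrix.single 1 1 1, 0, 0) : Alg3) ∈ S := by
    have := S.sub_mem t0 d0
    convert this using 1
    refine Prod.ext ?_ (Prod.ext ?_ ?_)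
    · ext i j
      fin_cases i <;> fin_cases j <;> simp [Matrix.single]
    · simp
    · simp
  have hs : (((√3 : ℝ) : ℂ) : ℂ) ≠ 0 := fun h => by simpa [h] using sqrt3_mul
  have e01 : ((Matrix.single 0 1 1, 0, 0) : Alg3) ∈ S := by
    have := S.smul_mem (S.mul_mem (S.mul_mem d0 t2) d1) (2 / ((√3 : ℝ) : ℂ) : ℂ)
    convert this using 1
    refine Prod.ext ?_ (Prod.ext ?_ ?_)
    · ext i j
      fin_cases i <;> fin_cases j <;>
        simp [Matrix.single, Matrix.mul_apply, hs]
    · simp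
    · simp
  have e10 : ((Matrix.single 1 0 1, 0, 0) : Alg3) ∈ S := by
    have := S.smul_mem (S.mul_mem (S.mul_mem d1 t2) d0) (2 / ((√3 : ℝ) : ℂ) : ℂ)
    convert this using 1
    refine Prod.ext ?_ (Prod.ext ?_ ?_)
    · ext i j
      fin_cases i <;> fin_cases j <;>
        simp [Matrix.single, Matrix.mul_apply, hs]
    · simp
    · simp
  rw [eq_top_iff]
  rintro ⟨X, a, b⟩ -
  have hX : ((X, 0, 0) : Alg3) ∈ S :=
    Subalgebra.block_mem (LinearMap.inl ℂ (Matrix (Fin 2) (Fin 2) ℂ) (ℂ × ℂ)) S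
      (by
        intro i j
        fin_cases i <;> fin_cases j
        exacts [d0, e01, e10, d1]) X
  have := S.add_mem hX (S.add_mem (S.smul_mem h2 a) (S.smul_mem h3 b))
  simpa using this

/-- The symmetric matrix unit `E_{jk} + E_{kj}`. -/
def symUnit (j k : Fin 3) : Matrix (Fin 3) (Fin 3) ℂ := Matrix.single j k 1 + Matrix.single k j 1

theorem symUnit_comm (j k : Fin 3) : symUnit j k = symUnit k j := add_comm _ _

theorem symUnit_mul {j k l : Fin 3} (hjk : j ≠ k) (hjl : j ≠ l) (hlk : l ≠ k) :
    symUnit j l * symUnit l k = Matrix.single j k 1 := by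
  simp [symUnit, mul_add, add_mul, hjk, hjl, hlk]

/-- Disjoint transpositions agree in `𝕊₃`, so half their difference is `(E, -E, 0)` with `E` a
symmetric matrix unit. Products of two such elements have equal signs in the two blocks; having both
sign patterns separates the blocks. The rest is the image of the group algebra of `𝕊₃`. -/
theorem adjoin_rep4 : Algebra.adjoin ℂ (Set.range rep4) = ⊤ := by
  set S := Algebra.adjoin ℂ (Set.range rep4)
  have hr : ∀ σ, rep4 σ ∈ S := fun σ => Algebra.subset_adjoin ⟨σ, rfl⟩
  have hsym : ∀ j k : Fin 3, j ≠ k → ((symUnit j k, -symUnit j k, 0) : Alg4) ∈ S := by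
    have a : ((symUnit 1 2, -symUnit 1 2, 0) : Alg4) ∈ S := by
      have := S.smul_mem (S.sub_mem (hr (Equiv.swap 2 3)) (hr (Equiv.swap 0 1))) (1 / 2 : ℂ)
      rw [rep4_apply, rep4_apply, rep211_swap pairingHom_swap23 (by decide),
        rep211_swap pairingHom_swap01 (by decide), pairingHom_swap23, pairingHom_swap01,
        rep31_swap01, rep31_swap23] at this
      convert this using 1
      refine Prod.ext ?_ (Prod.ext ?_ (by simp)) <;> ext i j <;>
        fin_cases i <;> fin_cases j <;> simp [symUnit, Matrix.single] <;> norm_num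
    have b : ((symUnit 0 2, -symUnit 0 2, 0) : Alg4) ∈ S := by
      have := S.smul_mem (S.sub_mem (hr (Equiv.swap 1 3)) (hr (Equiv.swap 0 2))) (1 / 2 : ℂ)
      rw [rep4_apply, rep4_apply, rep211_swap pairingHom_swap13 (by decide),
        rep211_swap pairingHom_swap02 (by decide), pairingHom_swap13, pairingHom_swap02,
        rep31_swap02, rep31_swap13] at this
      convert this using 1
      refine Prod.ext ?_ (Prod.ext ?_ (by simp)) <;> ext i j <;>
        fin_cases i <;> fin_cases j <;> simp [symUnit, Matrix.single] <;> norm_num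
    have c : ((symUnit 0 1, -symUnit 0 1, 0) : Alg4) ∈ S := by
      have := S.smul_mem (S.sub_mem (hr (Equiv.swap 1 2)) (hr (Equiv.swap 0 3))) (1 / 2 : ℂ)
      rw [rep4_apply, rep4_apply, rep211_swap pairingHom_swap12 (by decide),
        rep211_swap pairingHom_swap03 (by decide), pairingHom_swap12, pairingHom_swap03,
        rep31_swap12, rep31_swap03] at this
      convert this using 1
      refine Prod.ext ?_ (Prod.ext ?_ (by simp)) <;> ext i j <;>
        fin_cases i <;> fin_cases j <;> simp [symUnit, Matrix.single] <;> norm_num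
    intro j k hjk
    fin_cases j <;> fin_cases k <;>
      first | exact absurd rfl hjk | assumption | (rw [symUnit_comm]; assumption)
  have third : ∀ j k : Fin 3, j ≠ k → ∃ l, j ≠ l ∧ l ≠ k := by decide
  have hplus : ∀ j k : Fin 3, j ≠ k →
      ((Matrix.single j k 1, Matrix.single j k 1, 0) : Alg4) ∈ S := by
    intro j k hjk
    obtain ⟨l, h1, h2⟩ := third j k hjk
    have := S.mul_mem (hsym j l h1) (hsym l k h2)
    simpa [symUnit_mul hjk h1 h2] using this
  have other : ∀ j : Fin 3, ∃ k, j ≠ k := by decide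
  have hdiag : ∀ j : Fin 3, ((Matrix.single j j 1, 0, 0) : Alg4) ∈ S ∧
      ((0, Matrix.single j j 1, 0) : Alg4) ∈ S := by
    intro j
    obtain ⟨k, hjk⟩ := other j
    have h1 := S.mul_mem (hplus j k hjk) (hplus k j hjk.symm)
    have h2 := S.mul_mem (hplus j k hjk) (hsym k j hjk.symm)
    have e : Matrix.single j k (1 : ℂ) * symUnit k j = Matrix.single j j 1 := by
      simp [symUnit, mul_add, hjk.symm]
    simp [e] at h1 h2
    have h3 := S.smul_mem (S.add_mem h1 h2) (1 / 2 : ℂ)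
    have h4 := S.smul_mem (S.sub_mem h1 h2) (1 / 2 : ℂ)
    simp [← two_smul ℂ] at h3 h4
    exact ⟨h3, h4⟩
  have hblock : ∀ j k : Fin 3, ((Matrix.single j k 1, 0, 0) : Alg4) ∈ S ∧
      ((0, Matrix.single j k 1, 0) : Alg4) ∈ S := by
    intro j k
    by_cases hjk : j = k
    · subst hjk; exact hdiag j
    · have h1 := S.mul_mem (hdiag j).1 (hplus j k hjk)
      have h2 := S.mul_mem (hdiag j).2 (hplus j k hjk)
      simp at h1 h2
      exact ⟨h1, h2⟩
  have hX : ∀ X, ((X, 0, 0) : Alg4) ∈ S :=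
    Subalgebra.block_mem (LinearMap.inl ℂ (Matrix (Fin 3) (Fin 3) ℂ)
      (Matrix (Fin 3) (Fin 3) ℂ × Alg3)) S fun i j => (hblock i j).1
  have hY : ∀ Y, ((0, Y, 0) : Alg4) ∈ S :=
    Subalgebra.block_mem ((LinearMap.inr ℂ (Matrix (Fin 3) (Fin 3) ℂ)
      (Matrix (Fin 3) (Fin 3) ℂ × Alg3)).comp
        (LinearMap.inl ℂ (Matrix (Fin 3) (Fin 3) ℂ) Alg3)) S fun i j => (hblock i j).2
  have hrep : ∀ σ, ((0, 0, rep3 (pairingHom σ)) : Alg4) ∈ S := by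
    intro σ
    have := S.sub_mem (S.sub_mem (hr σ) (hX (rep31 σ))) (hY (rep211 σ))
    simpa [rep4_apply] using this
  have hsurj : ∀ τ, ∃ σ, pairingHom σ = τ := by decide
  have hZ : ∀ z, ((0, 0, z) : Alg4) ∈ S := by
    intro z
    have hz : z ∈ Algebra.adjoin ℂ (Set.range rep3) := adjoin_rep3 ▸ Algebra.mem_top
    have h1 : ((0, 0, 1) : Alg4) ∈ S := by simpa using hrep 1
    induction hz using Algebra.adjoin_induction with
    | mem x hx =>
      obtain ⟨τ, rfl⟩ := hx
      obtain ⟨σ, rfl⟩ := hsurj τ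
      exact hrep σ
    | algebraMap r =>
      have := S.smul_mem h1 r
      simpa [Algebra.algebraMap_eq_smul_one] using this
    | add x y _ _ hx hy =>
      have := S.add_mem hx hy
      simpa using this
    | mul x y _ _ hx hy =>
      have := S.mul_mem hx hy
      simpa using this
  rw [eq_top_iff]
  rintro ⟨X, Y, z⟩ -
  have := S.add_mem (hX X) (S.add_mem (hY Y) (hZ z))
  simpa using this

theorem finrank_alg3 : Module.finrank ℂ Alg3 = Fintype.card (Equiv.Perm (Fin 3)) := by
  simp [Alg3, Module.finrank_prod, Module.finrank_matrix, Fintype.card_perm, Nat.factorial]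

theorem finrank_alg4 : Module.finrank ℂ Alg4 = Fintype.card (Equiv.Perm (Fin 4)) := by
  simp [Alg4, Module.finrank_prod, Module.finrank_matrix, Fintype.card_perm, Nat.factorial]

theorem exists_theta3 (d : ℕ) :
    ∃ Θ : Alg3 →⋆ₐ[ℂ] Op d 3, ∀ σ, Θ (rep3 σ) = permOp d 3 σ := by
  obtain ⟨Θ, hΘ⟩ := exists_algHom_of_adjoin_eq_top rep3 adjoin_rep3 finrank_alg3 (permHom d 3)
  have h := map_star_of_adjoin_eq_top rep3 adjoin_rep3 (permHom d 3) star_rep3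
    (permOp_conjTranspose d 3) Θ hΘ
  exact ⟨{ Θ with map_star' := h }, hΘ⟩

theorem exists_theta4 (d : ℕ) :
    ∃ Θ : Alg4 →⋆ₐ[ℂ] Op d 4, ∀ σ, Θ (rep4 σ) = permOp d 4 σ := by
  obtain ⟨Θ, hΘ⟩ := exists_algHom_of_adjoin_eq_top rep4 adjoin_rep4 finrank_alg4 (permHom d 4)
  have h := map_star_of_adjoin_eq_top rep4 adjoin_rep4 (permHom d 4) star_rep4
    (permOp_conjTranspose d 4) Θ hΘ
  exact ⟨{ Θ with map_star' := h }, hΘ⟩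

/-- The representation of the group algebra of `𝕊₃` on three qudits. -/
def theta3 (d : ℕ) : Alg3 →⋆ₐ[ℂ] Op d 3 := (exists_theta3 d).choose

/-- The representation of the group algebra of `𝕊₄` on four qudits. -/
def theta4 (d : ℕ) : Alg4 →⋆ₐ[ℂ] Op d 4 := (exists_theta4 d).choose

theorem theta3_rep3 (d : ℕ) (σ : Equiv.Perm (Fin 3)) : theta3 d (rep3 σ) = permOp d 3 σ :=
  (exists_theta3 d).choose_spec σ

theorem theta4_rep4 (d : ℕ) (σ : Equiv.Perm (Fin 4)) : theta4 d (rep4 σ) = permOp d 4 σ :=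
  (exists_theta4 d).choose_spec σ

end

/-! ### Invariant unitaries as images of unitaries of the group algebra -/

section

section UnitaryLifting

/-- Elements of `A` that become unitary in a quotient of `A` can be replaced by unitaries. -/
def UnitaryLifting (A : Type) [Ring A] [StarRing A] : Prop :=
  ∀ (B : Type) [Ring B] (f : A →ₙ+* B) (a : A), f (star a * a) = f 1 → f (a * star a) = f 1 →
    ∃ a' ∈ unitary A, f a' = f a

/-- On a simple ring `f` is injective, and then `a` itself is unitary, or zero, and then 1 serves.
The point is that sectors may be absent for small `d`, where a preimage of a unitary is
unconstrained. -/
theorem unitaryLifting_of_isSimpleRing (A : Type) [Ring A] [StarRing A] [IsSimpleRing A] :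
    UnitaryLifting A := by
  intro B _ f a h1 h2
  rcases eq_bot_or_eq_top (TwoSidedIdeal.ker f) with h | h
  · have hinj : Function.Injective f := (TwoSidedIdeal.ker_eq_bot f).mp h
    exact ⟨a, Unitary.mem_iff.mpr ⟨hinj h1, hinj h2⟩, rfl⟩
  · have h0 : ∀ x, f x = 0 := fun x => by
      have : x ∈ TwoSidedIdeal.ker f := by rw [h]; trivial
      exact (TwoSidedIdeal.mem_ker f).mp this
    exact ⟨1, one_mem _, by rw [h0, h0]⟩

/-- Multiplying the hypotheses by the images of the two central idempotents separates them into
conditions on the factors. -/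
theorem UnitaryLifting.prod {A₁ A₂ : Type} [Ring A₁] [StarRing A₁] [Ring A₂] [StarRing A₂]
    (h₁ : UnitaryLifting A₁) (h₂ : UnitaryLifting A₂) : UnitaryLifting (A₁ × A₂) := by
  rintro B _ f ⟨a₁, a₂⟩ hl hr
  let i₁ : A₁ →ₙ+* A₁ × A₂ :=
    { toFun := fun a => (a, 0), map_zero' := rfl, map_mul' := by simp, map_add' := by simp }
  let i₂ : A₂ →ₙ+* A₁ × A₂ :=
    { toFun := fun a => (0, a), map_zero' := rfl, map_mul' := by simp, map_add' := by simp }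
  have e : ∀ x y, f (x, y) = f.comp i₁ x + f.comp i₂ y := fun x y => by
    change _ = f (x, 0) + f (0, y)
    rw [← map_add]; simp
  have k₁ : ∀ x : A₁ × A₂, f x = f 1 → f.comp i₁ x.1 = f.comp i₁ 1 := fun x hx => by
    have := congrArg (f (i₁ 1) * ·) hx
    simp only [← map_mul] at this
    rwa [show i₁ 1 * x = i₁ x.1 from Prod.ext (one_mul _) (zero_mul _),
      show i₁ 1 * 1 = i₁ 1 from Prod.ext (one_mul _) (zero_mul _)] at this
  have k₂ : ∀ x : A₁ × A₂, f x = f 1 → f.comp i₂ x.2 = f.comp i₂ 1 := fun x hx => by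
    have := congrArg (f (i₂ 1) * ·) hx
    simp only [← map_mul] at this
    rwa [show i₂ 1 * x = i₂ x.2 from Prod.ext (zero_mul _) (one_mul _),
      show i₂ 1 * 1 = i₂ 1 from Prod.ext (zero_mul _) (one_mul _)] at this
  obtain ⟨b₁, hb₁, e₁⟩ := h₁ B (f.comp i₁) a₁ (k₁ _ hl) (k₁ _ hr)
  obtain ⟨b₂, hb₂, e₂⟩ := h₂ B (f.comp i₂) a₂ (k₂ _ hl) (k₂ _ hr)
  rw [Unitary.mem_iff] at hb₁ hb₂
  refine ⟨(b₁, b₂), Unitary.mem_iff.mpr ⟨Prod.ext hb₁.1 hb₂.1, Prod.ext hb₁.2 hb₂.2⟩, ?_⟩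
  rw [e, e, e₁, e₂]

theorem unitaryLifting_alg3 : UnitaryLifting Alg3 :=
  (unitaryLifting_of_isSimpleRing _).prod
    ((unitaryLifting_of_isSimpleRing _).prod (unitaryLifting_of_isSimpleRing _))

theorem unitaryLifting_alg4 : UnitaryLifting Alg4 :=
  (unitaryLifting_of_isSimpleRing _).prod
    ((unitaryLifting_of_isSimpleRing _).prod unitaryLifting_alg3)

end UnitaryLifting

/-- The unitary group of `Alg3`. -/
abbrev Grp3 : Type := UGrp 2 × unitary ℂ × unitary ℂ

/-- The unitary group of `Alg4`. -/
abbrev Grp4 : Type := UGrp 3 × UGrp 3 × Grp3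

/-- The inclusion of the unitary group of `Alg3`. -/
def toAlg3 : Grp3 →* Alg3 where
  toFun g := (g.1, g.2.1, g.2.2)
  map_one' := rfl
  map_mul' _ _ := rfl

/-- The inclusion of the unitary group of `Alg4`. -/
def toAlg4 : Grp4 →* Alg4 where
  toFun g := (g.1, g.2.1, toAlg3 g.2.2)
  map_one' := rfl
  map_mul' _ _ := rfl

theorem toAlg3_injective : Function.Injective toAlg3 := fun _ _ h =>
  Prod.ext (Subtype.ext (congrArg (fun a => a.1) h))
    (Prod.ext (Subtype.ext (congrArg (fun a => a.2.1) h))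
      (Subtype.ext (congrArg (fun a => a.2.2) h)))

theorem toAlg4_injective : Function.Injective toAlg4 := fun _ _ h =>
  Prod.ext (Subtype.ext (congrArg (fun a => a.1) h))
    (Prod.ext (Subtype.ext (congrArg (fun a => a.2.1) h))
      (toAlg3_injective (congrArg (fun a => a.2.2) h)))

theorem toAlg3_mem (g : Grp3) : toAlg3 g ∈ unitary Alg3 :=
  Unitary.mem_iff.mpr
    ⟨Prod.ext (Unitary.mem_iff.mp g.1.2).1
      (Prod.ext (Unitary.mem_iff.mp g.2.1.2).1 (Unitary.mem_iff.mp g.2.2.2).1),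
    Prod.ext (Unitary.mem_iff.mp g.1.2).2
      (Prod.ext (Unitary.mem_iff.mp g.2.1.2).2 (Unitary.mem_iff.mp g.2.2.2).2)⟩

theorem toAlg4_mem (g : Grp4) : toAlg4 g ∈ unitary Alg4 :=
  Unitary.mem_iff.mpr
    ⟨Prod.ext (Unitary.mem_iff.mp g.1.2).1
      (Prod.ext (Unitary.mem_iff.mp g.2.1.2).1 (Unitary.mem_iff.mp (toAlg3_mem g.2.2)).1),
    Prod.ext (Unitary.mem_iff.mp g.1.2).2
      (Prod.ext (Unitary.mem_iff.mp g.2.1.2).2 (Unitary.mem_iff.mp (toAlg3_mem g.2.2)).2)⟩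

theorem exists_toAlg3 {a : Alg3} (ha : a ∈ unitary Alg3) : ∃ g, toAlg3 g = a := by
  obtain ⟨h1, h2⟩ := Unitary.mem_iff.mp ha
  exact ⟨(⟨a.1, Unitary.mem_iff.mpr ⟨congrArg (fun a => a.1) h1, congrArg (fun a => a.1) h2⟩⟩,
    ⟨a.2.1, Unitary.mem_iff.mpr ⟨congrArg (fun a => a.2.1) h1, congrArg (fun a => a.2.1) h2⟩⟩,
    ⟨a.2.2, Unitary.mem_iff.mpr ⟨congrArg (fun a => a.2.2) h1, congrArg (fun a => a.2.2) h2⟩⟩),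
    rfl⟩

theorem exists_toAlg4 {a : Alg4} (ha : a ∈ unitary Alg4) : ∃ g, toAlg4 g = a := by
  obtain ⟨h1, h2⟩ := Unitary.mem_iff.mp ha
  obtain ⟨g, hg⟩ := exists_toAlg3 (a := a.2.2)
    (Unitary.mem_iff.mpr ⟨congrArg (fun a => a.2.2) h1, congrArg (fun a => a.2.2) h2⟩)
  exact ⟨(⟨a.1, Unitary.mem_iff.mpr ⟨congrArg (fun a => a.1) h1, congrArg (fun a => a.1) h2⟩⟩,
    ⟨a.2.1, Unitary.mem_iff.mpr ⟨congrArg (fun a => a.2.1) h1, congrArg (fun a => a.2.1) h2⟩⟩,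
    g), Prod.ext rfl (Prod.ext rfl hg)⟩

/-- The action of the unitaries of the group algebra of `𝕊₃` on three qudits. -/
def psi3 (d : ℕ) : Grp3 →* UnitaryGrp d 3 where
  toFun g := ⟨theta3 d (toAlg3 g), Unitary.map_mem (theta3 d) (toAlg3_mem g)⟩
  map_one' := Subtype.ext
    ((congrArg (theta3 d) (map_one toAlg3)).trans (map_one (theta3 d)))
  map_mul' g h := Subtype.ext
    ((congrArg (theta3 d) (map_mul toAlg3 g h)).trans (map_mul (theta3 d) _ _))

/-- The action of the unitaries of the group algebra of `𝕊₄` on four qudits. -/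
def psi4 (d : ℕ) : Grp4 →* UnitaryGrp d 4 where
  toFun g := ⟨theta4 d (toAlg4 g), Unitary.map_mem (theta4 d) (toAlg4_mem g)⟩
  map_one' := Subtype.ext
    ((congrArg (theta4 d) (map_one toAlg4)).trans (map_one (theta4 d)))
  map_mul' g h := Subtype.ext
    ((congrArg (theta4 d) (map_mul toAlg4 g h)).trans (map_mul (theta4 d) _ _))

theorem coe_psi3 (d : ℕ) (g : Grp3) : (psi3 d g : Op d 3) = theta3 d (toAlg3 g) := rfl

theorem coe_psi4 (d : ℕ) (g : Grp4) : (psi4 d g : Op d 4) = theta4 d (toAlg4 g) := rfl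

theorem exists_unitary_preimage {A B : Type} [Ring A] [StarRing A] [Algebra ℂ A] [Ring B]
    [StarRing B] [Algebra ℂ B] (hA : UnitaryLifting A) (Θ : A →⋆ₐ[ℂ] B) {V : B}
    (hV : V ∈ unitary B) {s : Set B} (hs : ∀ x ∈ s, ∃ a, Θ a = x)
    (h : V ∈ Submodule.span ℂ s) : ∃ a ∈ unitary A, Θ a = V := by
  have hr : V ∈ LinearMap.range (Θ : A →ₐ[ℂ] B).toLinearMap :=
    (Submodule.span_le.mpr fun x hx => hs x hx) h
  obtain ⟨a, rfl⟩ := hr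
  obtain ⟨h1, h2⟩ := Unitary.mem_iff.mp hV
  change star (Θ a) * Θ a = 1 at h1
  change Θ a * star (Θ a) = 1 at h2
  refine hA B (Θ : A →ₙ+* B) a ?_ ?_
  · change Θ (star a * a) = Θ 1
    rw [map_mul, map_star, map_one, h1]
  · change Θ (a * star a) = Θ 1
    rw [map_mul, map_star, map_one, h2]

theorem range_psi3 (d : ℕ) : (psi3 d).range = invariantGroup d 3 := by
  ext V
  rw [mem_invariantGroup_iff]
  constructor
  · rintro ⟨g, rfl⟩
    rw [coe_psi3]
    generalize toAlg3 g = a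
    have ha : a ∈ Submodule.span ℂ (Set.range rep3) := by
      have : Submonoid.closure (Set.range rep3) = MonoidHom.mrange rep3 := by
        rw [← MonoidHom.coe_mrange, Submonoid.closure_eq]
      rw [← MonoidHom.coe_mrange, ← this, ← Algebra.adjoin_eq_span, adjoin_rep3]
      trivial
    induction ha using Submodule.span_induction with
    | mem x hx => obtain ⟨σ, rfl⟩ := hx; exact Submodule.subset_span ⟨σ, (theta3_rep3 d σ).symm⟩
    | zero => rw [map_zero]; exact Submodule.zero_mem _
    | add x y _ _ hx hy => rw [map_add]; exact Submodule.add_mem _ hx hy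
    | smul c x _ hx => rw [map_smul]; exact Submodule.smul_mem _ c hx
  · intro h
    obtain ⟨a, ha, hV⟩ := exists_unitary_preimage unitaryLifting_alg3 (theta3 d) V.2
      (by rintro _ ⟨σ, rfl⟩; exact ⟨_, theta3_rep3 d σ⟩) h
    obtain ⟨g, rfl⟩ := exists_toAlg3 ha
    exact ⟨g, Subtype.ext hV⟩

/-- This holds for every `d`, whether or not `psi4 d` is injective, so generation can be studied in
`Grp4` and pushed forward. -/
theorem range_psi4 (d : ℕ) : (psi4 d).range = invariantGroup d 4 := by
  ext V
  rw [mem_invariantGroup_iff]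
  constructor
  · rintro ⟨g, rfl⟩
    rw [coe_psi4]
    generalize toAlg4 g = a
    have ha : a ∈ Submodule.span ℂ (Set.range rep4) := by
      have : Submonoid.closure (Set.range rep4) = MonoidHom.mrange rep4 := by
        rw [← MonoidHom.coe_mrange, Submonoid.closure_eq]
      rw [← MonoidHom.coe_mrange, ← this, ← Algebra.adjoin_eq_span, adjoin_rep4]
      trivial
    induction ha using Submodule.span_induction with
    | mem x hx => obtain ⟨σ, rfl⟩ := hx; exact Submodule.subset_span ⟨σ, (theta4_rep4 d σ).symm⟩
    | zero => rw [map_zero]; exact Submodule.zero_mem _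
    | add x y _ _ hx hy => rw [map_add]; exact Submodule.add_mem _ hx hy
    | smul c x _ hx => rw [map_smul]; exact Submodule.smul_mem _ c hx
  · intro h
    obtain ⟨a, ha, hV⟩ := exists_unitary_preimage unitaryLifting_alg4 (theta4 d) V.2
      (by rintro _ ⟨σ, rfl⟩; exact ⟨_, theta4_rep4 d σ⟩) h
    obtain ⟨g, rfl⟩ := exists_toAlg4 ha
    exact ⟨g, Subtype.ext hV⟩

/-- The one-parameter group `exp(i θ s)` of an involution `s`. -/
def rot {A : Type*} [Ring A] [Algebra ℂ A] (θ : ℝ) (s : A) : A :=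
  (Real.cos θ : ℂ) • (1 : A) + (Complex.I * (Real.sin θ : ℂ)) • s

theorem rot_mul {A : Type*} [Ring A] [Algebra ℂ A] (θ φ : ℝ) {s : A} (hs : s * s = 1) :
    rot θ s * rot φ s = rot (θ + φ) s := by
  simp only [rot, mul_add, add_mul, smul_mul_smul_comm, one_mul, mul_one, hs, Real.cos_add,
    Real.sin_add]
  push_cast
  have := Complex.I_mul_I
  match_scalars
  · linear_combination (Complex.sin θ * Complex.sin φ) * this
  · ring

theorem rot_zero {A : Type*} [Ring A] [Algebra ℂ A] (s : A) : rot 0 s = 1 := by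
  simp [rot]

theorem star_rot {A : Type*} [Ring A] [Algebra ℂ A] [StarRing A] [StarModule ℂ A] (θ : ℝ) {s : A}
    (hs : star s = s) : star (rot θ s) = rot (-θ) s := by
  rw [rot, star_add, star_smul, star_smul, hs, star_one, rot, Real.cos_neg, Real.sin_neg]
  simp only [star_mul', Complex.star_def, Complex.conj_ofReal, Complex.conj_I]
  push_cast
  congr 2
  ring

theorem rot_mem_unitary {A : Type*} [Ring A] [Algebra ℂ A] [StarRing A] [StarModule ℂ A] (θ : ℝ)
    {s : A} (hs : s * s = 1) (hs' : star s = s) : rot θ s ∈ unitary A := by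
  rw [Unitary.mem_iff, star_rot θ hs', rot_mul _ _ hs, rot_mul _ _ hs]
  simp [rot_zero]

theorem map_rot {A B : Type*} [Ring A] [Algebra ℂ A] [Ring B] [Algebra ℂ B] (f : A →ₐ[ℂ] B) (θ : ℝ)
    (s : A) : f (rot θ s) = rot θ (f s) := by
  simp [rot]

theorem rot_prod {A B : Type*} [Ring A] [Algebra ℂ A] [Ring B] [Algebra ℂ B] (θ : ℝ) (s : A)
    (t : B) : rot θ (s, t) = (rot θ s, rot θ t) :=
  Prod.ext (by simp [rot]) (by simp [rot])

end

/-! ### Complex conjugate components of the exchange gates -/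

section

/-- Entrywise complex conjugation of unitary matrices. -/
def conjU : UGrp 3 →* UGrp 3 where
  toFun g := ⟨(g : Matrix (Fin 3) (Fin 3) ℂ).map star, by
    rw [Matrix.mem_unitaryGroup_iff, Matrix.star_eq_conjTranspose]
    have h := congrArg (fun A : Matrix (Fin 3) (Fin 3) ℂ => A.map (starRingEnd ℂ)) g.mul_conjTranspose
    simp only [Matrix.map_mul] at h
    simpa [Matrix.map_one, Matrix.conjTranspose, Matrix.transpose_map] using h⟩
  map_one' := Subtype.ext (Matrix.map_one star (star_zero ℂ) (star_one ℂ))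
  map_mul' g h := Subtype.ext (Matrix.map_mul (f := starRingEnd ℂ))

theorem coe_conjU (g : UGrp 3) :
    (conjU g : Matrix (Fin 3) (Fin 3) ℂ) = (g : Matrix (Fin 3) (Fin 3) ℂ).map star := rfl

theorem conjU_conjU (g : UGrp 3) : conjU (conjU g) = g :=
  Subtype.ext (by ext i j; simp [coe_conjU])

theorem conjU_det (g : UGrp 3) : (conjU g : Matrix (Fin 3) (Fin 3) ℂ).det =
    star (g : Matrix (Fin 3) (Fin 3) ℂ).det :=
  (RingHom.map_det (starRingEnd ℂ) _).symm

/-- The embedding of `U(3)` in the unitaries of the group algebra whose components in `(3,1)` and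
`(2,1,1)` are complex conjugates, the other ones being trivial. -/
def diagHom : UGrp 3 →* Grp4 where
  toFun g := (g, conjU g, 1)
  map_one' := by rw [map_one]; rfl
  map_mul' g h := by rw [map_mul]; exact Prod.ext rfl (Prod.ext rfl (one_mul 1).symm)

/-- `a` is an element of `H`, seen in the group algebra. -/
def HasAlg (H : Subgroup Grp4) (a : Alg4) : Prop := ∃ g ∈ H, toAlg4 g = a

theorem HasAlg.mul {H : Subgroup Grp4} {a b : Alg4} (ha : HasAlg H a) (hb : HasAlg H b) :
    HasAlg H (a * b) := by
  obtain ⟨g, hg, rfl⟩ := ha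
  obtain ⟨h, hh, rfl⟩ := hb
  exact ⟨g * h, H.mul_mem hg hh, map_mul _ _ _⟩

theorem HasAlg.hasMat {H : Subgroup Grp4} {A B : Matrix (Fin 3) (Fin 3) ℂ}
    (h : HasAlg H (A, B, 1)) (hB : B = A.map star) : HasMat (H.comap diagHom) A := by
  obtain ⟨g, hg, e⟩ := h
  have hA : (g.1 : Matrix (Fin 3) (Fin 3) ℂ) = A := congrArg (fun a => a.1) e
  refine ⟨g.1, ?_, hA⟩
  have : diagHom g.1 = g := toAlg4_injective (by
    rw [e]
    refine Prod.ext hA (Prod.ext ?_ (map_one toAlg3))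
    rw [hB, ← hA]; rfl)
  rwa [Subgroup.mem_comap, this]

/-- `H` contains all `exp(i θ P_{ij})`. -/
def HasExchange (H : Subgroup Grp4) : Prop :=
  ∀ i j : Fin 4, i ≠ j → ∀ θ : ℝ, HasAlg H (rot θ (rep4 (Equiv.swap i j)))

theorem rep31_map_star (σ : Equiv.Perm (Fin 4)) : (rep31 σ).map star = rep31 σ := by
  ext i j
  rw [Matrix.map_apply]
  simp only [rep31, permRep_apply, Fin.sum_univ_four]
  have h : ∀ x k, star (frame31 x k) = frame31 x k := by
    intro x k
    fin_cases x <;> fin_cases k <;> simp [frame31]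
  simp [h, -RCLike.star_def, -Complex.star_def]

theorem map_star_mul (A B : Matrix (Fin 3) (Fin 3) ℂ) :
    (A * B).map star = A.map star * B.map star := Matrix.map_mul (f := starRingEnd ℂ)

/-- Conjugation flips the sign of `i` only, as `R` is real; for an involution this reads `conj
exp(iθR) = exp(iθ(-R))`. -/
theorem rot_map_star (θ : ℝ) {R : Matrix (Fin 3) (Fin 3) ℂ} (hR : R.map star = R) :
    (rot θ R).map star = rot θ (-R) := by
  have h : ∀ i j, star (R i j) = R i j := fun i j => congrFun (congrFun hR i) j
  ext i j
  rcases eq_or_ne i j with rfl | hij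
  · simp [rot, -RCLike.star_def, -Complex.star_def, h, -Complex.ofReal_cos, -Complex.ofReal_sin]
    simp [-Complex.ofReal_cos, -Complex.ofReal_sin]
  · simp [rot, -RCLike.star_def, -Complex.star_def, h, hij, -Complex.ofReal_cos,
      -Complex.ofReal_sin]
    simp [-Complex.ofReal_cos, -Complex.ofReal_sin]

theorem rot_rep4_swap {i j : Fin 4} {k l : Fin 3}
    (h : pairingHom (Equiv.swap i j) = Equiv.swap k l) (hkl : k ≠ l) (θ : ℝ) :
    rot θ (rep4 (Equiv.swap i j)) = (rot θ (rep31 (Equiv.swap i j)),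
      (rot θ (rep31 (Equiv.swap i j))).map star, rot θ (rep3 (Equiv.swap k l))) := by
  rw [rep4_apply, rot_prod, rot_prod, rep211_swap h hkl, rot_map_star θ (rep31_map_star _), h]

theorem rep3_swap_mul_self (k l : Fin 3) :
    rep3 (Equiv.swap k l) * rep3 (Equiv.swap k l) = 1 := by
  rw [← map_mul, Equiv.swap_mul_self, map_one]

/-- Two transpositions with the same image in `𝕊₃` and opposite angles cancel in (2,2), (4) and
(1,1,1,1), leaving an element of the image of `diagHom`. -/
theorem HasExchange.hasMat {H : Subgroup Grp4} (hH : HasExchange H)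
    {i j i' j' : Fin 4} {k l : Fin 3} (hij : i ≠ j) (hij' : i' ≠ j')
    (h : pairingHom (Equiv.swap i j) = Equiv.swap k l)
    (h' : pairingHom (Equiv.swap i' j') = Equiv.swap k l) (hkl : k ≠ l) (θ : ℝ) :
    HasMat (H.comap diagHom)
      (rot θ (rep31 (Equiv.swap i j)) * rot (-θ) (rep31 (Equiv.swap i' j'))) := by
  have key := (hH i j hij θ).mul (hH i' j' hij' (-θ))
  rw [rot_rep4_swap h hkl, rot_rep4_swap h' hkl, Prod.mk_mul_mk, Prod.mk_mul_mk,
    rot_mul _ _ (rep3_swap_mul_self k l), add_neg_cancel, rot_zero, ← map_star_mul] at key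
  exact key.hasMat rfl

end

/-! ### The conjugate pairs of SU(3) from exchange gates -/

section

section Plane

variable {N : Subgroup (UGrp 3)} {F : ℂ → ℂ → Matrix (Fin 3) (Fin 3) ℂ}

/-- The subgroup of the `g` in `SU(2)` whose image under `F` lies in `N`. -/
def planeSubgroup (N : Subgroup (UGrp 3)) (F : ℂ → ℂ → Matrix (Fin 3) (Fin 3) ℂ)
    (F_mul : ∀ p q p' q', F p q * F p' q' = F (p * p' - star q * q') (q * p' + star p * q'))
    (F_conj : ∀ p q, (F p q)ᴴ = F (star p) (-q)) (F_one : F 1 0 = 1) : Subgroup (UGrp 2) where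
  carrier := {g | ∃ p q, (g : Matrix (Fin 2) (Fin 2) ℂ) = su2 p q ∧ HasMat N (F p q)}
  one_mem' := ⟨1, 0, by rw [su2_one]; rfl, by rw [F_one]; exact hasMat_one N⟩
  mul_mem' := by
    rintro g h ⟨p, q, hg, hF⟩ ⟨p', q', hh, hF'⟩
    refine ⟨_, _, ?_, F_mul p q p' q' ▸ hF.mul hF'⟩
    rw [← su2_mul, ← hg, ← hh]; rfl
  inv_mem' := by
    rintro g ⟨p, q, hg, hF⟩
    refine ⟨_, _, ?_, F_conj p q ▸ hF.conjTranspose⟩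
    rw [UGrp.coe_inv, hg, su2_conjTranspose]

/-- Rotations about the x and y axes suffice: conjugating the x rotations by the y rotation of
parameter `π/4` gives the diagonal torus, and `hasMat_su2_of_torus` applies. -/
theorem hasMat_plane
    (F_mul : ∀ p q p' q', F p q * F p' q' = F (p * p' - star q * q') (q * p' + star p * q'))
    (F_conj : ∀ p q, (F p q)ᴴ = F (star p) (-q)) (F_one : F 1 0 = 1)
    (hx : ∀ θ : ℝ, HasMat N (F (Real.cos θ) (Complex.I * Real.sin θ)))
    (hy : ∀ θ : ℝ, HasMat N (F (Real.cos θ) (Real.sin θ)))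
    {p q : ℂ} (h : p * star p + q * star q = 1) : HasMat N (F p q) := by
  have lift : ∀ {p q : ℂ}, p * star p + q * star q = 1 → HasMat N (F p q) →
      HasMat (planeSubgroup N F F_mul F_conj F_one) (su2 p q) := fun {p q} hpq hF =>
    ⟨⟨su2 p q, su2_mem hpq⟩, ⟨p, q, rfl, hF⟩, rfl⟩
  obtain ⟨g, ⟨p', q', hg, hF⟩, hg'⟩ : HasMat (planeSubgroup N F F_mul F_conj F_one) (su2 p q) := by
    have hr : Real.cos (Real.pi / 4) ^ 2 = 1 / 2 := by
      rw [Real.cos_pi_div_four]; rw [div_pow, Real.sq_sqrt (by norm_num)]; norm_num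
    have hr' : Real.sin (Real.pi / 4) = Real.cos (Real.pi / 4) := by
      rw [Real.cos_pi_div_four, Real.sin_pi_div_four]
    have h1 := hy (Real.pi / 4)
    have h2 := hy (-(Real.pi / 4))
    rw [Real.cos_neg, Real.sin_neg] at h2
    rw [hr'] at h1 h2
    clear hr'
    generalize Real.cos (Real.pi / 4) = r at *
    have hrC : (r : ℂ) * r = 1 / 2 := by
      rw [← Complex.ofReal_mul, ← pow_two, hr]; norm_num
    refine hasMat_su2_of_torus (a := r) (b := r) (fun θ => ?_) (lift ?_ h1) ?_ ?_ h
    · have h3 := (h2.mul (hx θ)).mul h1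
      rw [F_mul, F_mul] at h3
      have e := Complex.exp_mul_I (θ : ℂ)
      rw [mul_comm] at e
      refine lift (by simpa using exp_I_unit θ) ?_
      convert h3 using 2
      · rw [e]
        simp [-Complex.ofReal_cos, -Complex.ofReal_sin]
        push_cast
        linear_combination (-2 * (Complex.cos θ + Complex.sin θ * Complex.I)) * hrC
      · simp [-Complex.ofReal_cos, -Complex.ofReal_sin]
        ring
    · simp only [Complex.star_def, Complex.conj_ofReal]
      rw [hrC]; norm_num
    · rw [Complex.norm_real, Real.norm_eq_abs, sq_abs, hr]
    · rw [Complex.norm_real, Real.norm_eq_abs, sq_abs, hr]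
  have e := hg.symm.trans hg'
  have e1 : p' = p := by simpa [su2] using congrFun (congrFun e 0) 0
  have e2 : q' = q := by simpa [su2] using congrFun (congrFun e 1) 0
  rwa [e1, e2] at hF

end Plane

theorem cos_eq_half (θ : ℝ) : Real.cos θ =
    Real.cos (θ / 2) * Real.cos (θ / 2) - Real.sin (θ / 2) * Real.sin (θ / 2) := by
  rw [← Real.cos_add, add_halves]

theorem sin_eq_half (θ : ℝ) : Real.sin θ = 2 * Real.sin (θ / 2) * Real.cos (θ / 2) := by
  rw [← Real.sin_two_mul, mul_div_cancel₀ _ two_ne_zero]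

/-- The rotations in the plane of the first and the third coordinate. -/
def x13 (θ : ℝ) : Matrix (Fin 3) (Fin 3) ℂ :=
  !![(Real.cos θ : ℂ), 0, Complex.I * (Real.sin θ : ℂ); 0, 1, 0;
    Complex.I * (Real.sin θ : ℂ), 0, (Real.cos θ : ℂ)]

/-- The two involutions commute and differ by `2 (E₁₂ + E₂₁)`, so half angles give an x rotation of
angle `θ` in the plane of the coordinates 1 and 2. -/
theorem rot_swap23_mul (θ : ℝ) : rot (θ / 2) (rep31 (Equiv.swap 2 3)) *
    rot (-(θ / 2)) (rep31 (Equiv.swap 0 1)) =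
      su23 (Real.cos θ) (Complex.I * (Real.sin θ : ℂ)) := by
  have h3 : (Real.cos (θ / 2) : ℂ) ^ 2 + (Real.sin (θ / 2) : ℂ) ^ 2 = 1 := by
    exact_mod_cast Real.cos_sq_add_sin_sq (θ / 2)
  have hI := Complex.I_sq
  rw [rep31_swap23, rep31_swap01, cos_eq_half θ, sin_eq_half θ, rot, rot, Real.cos_neg,
    Real.sin_neg]
  generalize Real.cos (θ / 2) = c at *
  generalize Real.sin (θ / 2) = s at *
  ext i j
  fin_cases i <;> fin_cases j <;>
    simp [su23, Matrix.mul_apply, Fin.sum_univ_three, Matrix.one_apply] <;> grind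

theorem rot_swap12_mul (θ : ℝ) : rot (θ / 2) (rep31 (Equiv.swap 1 2)) *
    rot (-(θ / 2)) (rep31 (Equiv.swap 0 3)) =
      su12 (Real.cos θ) (Complex.I * (Real.sin θ : ℂ)) := by
  have h3 : (Real.cos (θ / 2) : ℂ) ^ 2 + (Real.sin (θ / 2) : ℂ) ^ 2 = 1 := by
    exact_mod_cast Real.cos_sq_add_sin_sq (θ / 2)
  have hI := Complex.I_sq
  rw [rep31_swap12, rep31_swap03, cos_eq_half θ, sin_eq_half θ, rot, rot, Real.cos_neg,
    Real.sin_neg]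
  generalize Real.cos (θ / 2) = c at *
  generalize Real.sin (θ / 2) = s at *
  ext i j
  fin_cases i <;> fin_cases j <;>
    simp [su12, Matrix.mul_apply, Fin.sum_univ_three, Matrix.one_apply] <;> grind

theorem rot_swap13_mul (θ : ℝ) : rot (θ / 2) (rep31 (Equiv.swap 1 3)) *
    rot (-(θ / 2)) (rep31 (Equiv.swap 0 2)) = x13 θ := by
  have h3 : (Real.cos (θ / 2) : ℂ) ^ 2 + (Real.sin (θ / 2) : ℂ) ^ 2 = 1 := by
    exact_mod_cast Real.cos_sq_add_sin_sq (θ / 2)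
  have hI := Complex.I_sq
  rw [x13, rep31_swap13, rep31_swap02, cos_eq_half θ, sin_eq_half θ, rot, rot, Real.cos_neg,
    Real.sin_neg]
  generalize Real.cos (θ / 2) = c at *
  generalize Real.sin (θ / 2) = s at *
  ext i j
  fin_cases i <;> fin_cases j <;>
    simp [Matrix.mul_apply, Fin.sum_univ_three, Matrix.one_apply] <;> grind

/-- The entries `i` of the conjugating matrix move the plane and also turn an x rotation into a y
rotation, which supplies the missing axis. -/
theorem su23_mul_x13 (θ : ℝ) : su23 0 Complex.I * x13 θ * (su23 0 Complex.I)ᴴ =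
    su12 (Real.cos θ) (-Real.sin θ : ℝ) := by
  have hI := Complex.I_sq
  rw [x13, su23_conjTranspose]
  generalize Real.cos θ = c
  generalize Real.sin θ = s
  ext i j
  fin_cases i <;> fin_cases j <;>
    simp [su12, su23, Matrix.mul_apply, Fin.sum_univ_three] <;> grind

theorem su12_mul_x13 (θ : ℝ) : su12 0 Complex.I * x13 θ * (su12 0 Complex.I)ᴴ =
    su23 (Real.cos θ) (Real.sin θ : ℝ) := by
  have hI := Complex.I_sq
  rw [x13, su12_conjTranspose]
  generalize Real.cos θ = c
  generalize Real.sin θ = s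
  ext i j
  fin_cases i <;> fin_cases j <;>
    simp [su12, su23, Matrix.mul_apply, Fin.sum_univ_three] <;> grind

/-- The exchange gates generate the pairs of complex conjugate elements of `SU(3)` in the irreps
`(3,1)` and `(2,1,1)`. -/
theorem HasExchange.diagHom_mem {H : Subgroup Grp4} (hH : HasExchange H) {g : UGrp 3}
    (hg : (g : Matrix (Fin 3) (Fin 3) ℂ).det = 1) : diagHom g ∈ H := by
  have h12 (θ : ℝ) : HasMat (H.comap diagHom) (su12 (Real.cos θ) (Complex.I * Real.sin θ)) := by
    rw [← rot_swap12_mul]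
    exact hH.hasMat (by decide) (by decide) pairingHom_swap12 pairingHom_swap03 (by decide) _
  have h23 (θ : ℝ) : HasMat (H.comap diagHom) (su23 (Real.cos θ) (Complex.I * Real.sin θ)) := by
    rw [← rot_swap23_mul]
    exact hH.hasMat (by decide) (by decide) pairingHom_swap23 pairingHom_swap01 (by decide) _
  have h13 (θ : ℝ) : HasMat (H.comap diagHom) (x13 θ) := by
    rw [← rot_swap13_mul]
    exact hH.hasMat (by decide) (by decide) pairingHom_swap13 pairingHom_swap02 (by decide) _
  have k12 : HasMat (H.comap diagHom) (su12 0 Complex.I) := by simpa using h12 (Real.pi / 2)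
  have k23 : HasMat (H.comap diagHom) (su23 0 Complex.I) := by simpa using h23 (Real.pi / 2)
  have l12 (θ : ℝ) : HasMat (H.comap diagHom) (su12 (Real.cos θ) (Real.sin θ)) := by
    have := (k23.mul (h13 (-θ))).mul k23.conjTranspose
    rwa [su23_mul_x13, Real.cos_neg, Real.sin_neg, neg_neg] at this
  have l23 (θ : ℝ) : HasMat (H.comap diagHom) (su23 (Real.cos θ) (Real.sin θ)) := by
    have := (k12.mul (h13 θ)).mul k12.conjTranspose
    rwa [su12_mul_x13] at this
  exact mem_of_su12_su23
    (fun p q h => hasMat_plane su12_mul su12_conjTranspose su12_one h12 l12 h)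
    (fun p q h => hasMat_plane su23_mul su23_conjTranspose su23_one h23 l23 h) g hg

end

/-! ### Separating the blocks of four qudits -/

section

theorem rot_rep21_swap01 (θ : ℝ) :
    rot θ (rep21 (Equiv.swap 0 1)) = su2 (Complex.exp (Complex.I * θ)) 0 := by
  have e := Complex.exp_mul_I (θ : ℂ)
  rw [mul_comm] at e
  rw [rep21_swap01, rot, su2, ← Complex.ofReal_cos, ← Complex.ofReal_sin] at *
  rw [e]
  ext i j
  fin_cases i <;> fin_cases j <;>
    simp [-Complex.ofReal_cos, -Complex.ofReal_sin] <;> ring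

theorem rot_rep21_swap12 (θ : ℝ) : rot θ (rep21 (Equiv.swap 1 2)) =
    su2 (Real.cos θ - Complex.I * Real.sin θ / 2) (Complex.I * Real.sin θ * (√3 : ℝ) / 2) := by
  rw [rep21_swap12, rot, su2]
  generalize Real.cos θ = c
  generalize Real.sin θ = s
  ext i j
  fin_cases i <;> fin_cases j <;>
    simp <;> ring

/-- With `sin² θ = 2/3` one has `cos² θ + sin² θ / 4 = 1/2` and `3 sin² θ / 4 = 1/2`. -/
theorem exists_balanced_rotation : ∃ (θ : ℝ) (a b : ℂ), ‖a‖ ^ 2 = 1 / 2 ∧ ‖b‖ ^ 2 = 1 / 2 ∧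
    rot θ (rep21 (Equiv.swap 1 2)) = su2 a b := by
  have h1 : √(2 / 3 : ℝ) ≤ 1 := Real.sqrt_le_one.mpr (by norm_num)
  have h0 : 0 ≤ √(2 / 3 : ℝ) := Real.sqrt_nonneg _
  have hs : Real.sin (Real.arcsin √(2 / 3)) ^ 2 = 2 / 3 := by
    rw [Real.sin_arcsin (by linarith) h1, Real.sq_sqrt (by norm_num)]
  have hc := Real.cos_sq_add_sin_sq (Real.arcsin √(2 / 3))
  refine ⟨_, _, _, ?_, ?_, rot_rep21_swap12 (Real.arcsin √(2 / 3))⟩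
  · rw [Complex.sq_norm, Complex.normSq_apply]
    generalize Real.cos (Real.arcsin √(2 / 3)) = c at *
    generalize Real.sin (Real.arcsin √(2 / 3)) = s at *
    simp
    linarith
  · rw [norm_div, norm_mul, norm_mul, Complex.norm_I, Complex.norm_real, Complex.norm_real]
    simp only [Real.norm_eq_abs, one_mul, div_pow, mul_pow, sq_abs, hs]
    norm_num

/-- The exchange gates on three qudits contain all of `SU(2)` in the irrep `(2,1)`. -/
theorem hasMat_rep21 {L : Subgroup (UGrp 2)}
    (h01 : ∀ θ, HasMat L (rot θ (rep21 (Equiv.swap 0 1))))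
    (h12 : ∀ θ, HasMat L (rot θ (rep21 (Equiv.swap 1 2)))) {g : UGrp 2}
    (hg : (g : Matrix (Fin 2) (Fin 2) ℂ).det = 1) : g ∈ L := by
  obtain ⟨p, q, hpq, e⟩ := exists_su2 g hg
  obtain ⟨θ, a, b, ha, hb, hab⟩ := exists_balanced_rotation
  rw [← hasMat_coe, e]
  exact hasMat_su2_of_torus (fun θ => rot_rep21_swap01 θ ▸ h01 θ) (hab ▸ h12 θ) ha hb hpq

/-- The elements of the form `(g, conj g, (h, x, y))`. -/
def correlated : Subgroup Grp4 where
  carrier := {g | g.2.1 = conjU g.1}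
  one_mem' := (map_one conjU).symm
  mul_mem' := fun {a b} ha hb => by
    change a.2.1 * b.2.1 = conjU (a.1 * b.1)
    rw [map_mul, ha.symm, hb.symm]
  inv_mem' := fun {a} ha => by
    change a.2.1⁻¹ = conjU (a.1⁻¹)
    rw [map_inv, ha.symm]

/-- The projection to the irrep `(2,2)`. -/
def proj22 : Grp4 →* UGrp 2 :=
  (MonoidHom.fst _ _).comp ((MonoidHom.snd _ _).comp (MonoidHom.snd _ _))

/-- The embedding of the unitary group of the irrep `(2,2)`. -/
def incl22 : UGrp 2 →* Grp4 :=
  (MonoidHom.inr _ _).comp ((MonoidHom.inr _ _).comp (MonoidHom.inl _ _))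

/-- The embedding of the unitary group of the irrep `(2,1,1)`. -/
def incl211 : UGrp 3 →* Grp4 := (MonoidHom.inr _ _).comp (MonoidHom.inl _ _)

/-- Intersecting with `correlated` keeps track of the fact that the lifts to `H` have exactly
conjugate components, which is needed to remove them afterwards. -/
theorem HasExchange.hasMat22 {H : Subgroup Grp4} (hH : HasExchange H) {i j : Fin 4} {k l : Fin 3}
    (hij : i ≠ j) (h : pairingHom (Equiv.swap i j) = Equiv.swap k l) (hkl : k ≠ l) (θ : ℝ) :
    HasMat ((H ⊓ correlated).map proj22) (rot θ (rep21 (Equiv.swap k l))) := by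
  obtain ⟨g, hg, e⟩ := hH i j hij θ
  rw [rot_rep4_swap h hkl, rep3_apply, rot_prod] at e
  have e1 : (g.1 : Matrix (Fin 3) (Fin 3) ℂ) = _ := congrArg (fun a => a.1) e
  have e2 : (g.2.1 : Matrix (Fin 3) (Fin 3) ℂ) = _ := congrArg (fun a => a.2.1) e
  have e3 : (g.2.2.1 : Matrix (Fin 2) (Fin 2) ℂ) = _ := congrArg (fun a => a.2.2.1) e
  refine ⟨proj22 g, ⟨g, ⟨hg, Subtype.ext ?_⟩, rfl⟩, e3⟩
  rw [coe_conjU, e1, e2]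

open scoped commutatorElement

theorem UGrp.det_commutator {m : ℕ} (g h : UGrp m) :
    ((⁅g, h⁆ : UGrp m) : Matrix (Fin m) (Fin m) ℂ).det = 1 := by
  have key : ∀ g : UGrp m, (g : Matrix (Fin m) (Fin m) ℂ).det *
      ((g⁻¹ : UGrp m) : Matrix (Fin m) (Fin m) ℂ).det = 1 := fun g => by
    rw [← UGrp.det_mul, mul_inv_cancel]; simp
  rw [commutatorElement_def, UGrp.det_mul, UGrp.det_mul, UGrp.det_mul]
  linear_combination ((h : Matrix (Fin m) (Fin m) ℂ).det *
      ((h⁻¹ : UGrp m) : Matrix (Fin m) (Fin m) ℂ).det) * key g + key h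

/-- Lift two elements of SU(2) to correlated elements of `H`. Their commutator is trivial in the
one-dimensional blocks and a conjugate pair of determinant 1 in the three-dimensional ones;
`diagHom` removes that pair. Commutators exhaust SU(2). -/
theorem HasExchange.incl22_mem {H : Subgroup Grp4} (hH : HasExchange H) {g : UGrp 2}
    (hg : (g : Matrix (Fin 2) (Fin 2) ℂ).det = 1) : incl22 g ∈ H := by
  have hL : ∀ u : UGrp 2, (u : Matrix (Fin 2) (Fin 2) ℂ).det = 1 →
      ∃ a ∈ H, a.2.1 = conjU a.1 ∧ a.2.2.1 = u := fun u hu => by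
    obtain ⟨a, ⟨ha, ha'⟩, rfl⟩ := hasMat_rep21 (L := (H ⊓ correlated).map proj22)
      (hH.hasMat22 (by decide) pairingHom_swap12 (by decide))
      (hH.hasMat22 (by decide) pairingHom_swap01 (by decide)) hu
    exact ⟨a, ha, ha', rfl⟩
  refine mem_of_commutator_mem (K := H.comap incl22) (fun u v hu hv => ?_) g hg
  obtain ⟨a, ha, ha', rfl⟩ := hL u hu
  obtain ⟨b, hb, hb', rfl⟩ := hL v hv
  have h1 : ⁅a, b⁆ ∈ H := H.mul_mem (H.mul_mem (H.mul_mem ha hb) (H.inv_mem ha)) (H.inv_mem hb)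
  have h2 := hH.diagHom_mem (UGrp.det_commutator a.1 b.1)
  have h3 := H.mul_mem (H.inv_mem h2) h1
  refine Subgroup.mem_comap.mpr (Eq.mpr (congrArg (· ∈ H) ?_) h3)
  refine Prod.ext ?_ (Prod.ext ?_ (Prod.ext ?_ (Prod.ext ?_ ?_)))
  · exact (inv_mul_cancel _).symm
  · change 1 = (conjU ⁅a.1, b.1⁆)⁻¹ * ⁅a.2.1, b.2.1⁆
    rw [map_commutatorElement, ha', hb', inv_mul_cancel]
  · change _ = 1⁻¹ * ⁅a.2.2.1, b.2.2.1⁆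
    rw [inv_one, one_mul]; rfl
  · change 1 = 1⁻¹ * ⁅a.2.2.2.1, b.2.2.2.1⁆
    rw [inv_one, one_mul, commutatorElement_eq_one_iff_mul_comm.mpr (mul_comm _ _)]
  · change 1 = 1⁻¹ * ⁅a.2.2.2.2, b.2.2.2.2⁆
    rw [inv_one, one_mul, commutatorElement_eq_one_iff_mul_comm.mpr (mul_comm _ _)]

/-- The hypothesis says that `w = y₂₁₁ (conj y₃₁)⁻¹` is not scalar. Conjugating by `y` a conjugate
pair chosen to cancel in (3,1) leaves the commutator of `w` and `g` in (2,1,1) alone, and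
`mem_of_commutator_nonscalar` finishes. -/
theorem HasExchange.incl211_mem {H : Subgroup Grp4} (hH : HasExchange H) {y : Grp4} (hy : y ∈ H)
    (hy' : ∀ c : ℂ, (y.2.1 : Matrix (Fin 3) (Fin 3) ℂ) ≠
      c • (y.1 : Matrix (Fin 3) (Fin 3) ℂ).map star)
    {g : UGrp 3} (hg : (g : Matrix (Fin 3) (Fin 3) ℂ).det = 1) : incl211 g ∈ H := by
  have hdet : ∀ g : UGrp 3, (g : Matrix (Fin 3) (Fin 3) ℂ).det = 1 →
      (conjU g : Matrix (Fin 3) (Fin 3) ℂ).det = 1 := fun g hg => by rw [conjU_det, hg, star_one]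
  refine mem_of_commutator_nonscalar (K := H.comap incl211) (fun g hg k hk => ?_)
    (y.2.1 * (conjU y.1)⁻¹) (fun c hc => hy' c ?_) (fun g hg => ?_) g hg
  · have h1 := hH.diagHom_mem (hdet g hg)
    have h2 := H.mul_mem (H.mul_mem h1 hk) (H.inv_mem h1)
    refine Subgroup.mem_comap.mpr (Eq.mpr (congrArg (· ∈ H) ?_) h2)
    refine Prod.ext ?_ (Prod.ext ?_ ?_)
    · change 1 = conjU g * 1 * (conjU g)⁻¹
      rw [mul_one, mul_inv_cancel]
    · change _ = conjU (conjU g) * k * (conjU (conjU g))⁻¹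
      rw [conjU_conjU]; rfl
    · change 1 = 1 * 1 * 1⁻¹
      rw [inv_one, mul_one, mul_one]
  · have : (y.2.1 : Matrix (Fin 3) (Fin 3) ℂ) =
        ((y.2.1 * (conjU y.1)⁻¹ : UGrp 3) : Matrix (Fin 3) (Fin 3) ℂ) *
          (conjU y.1 : Matrix (Fin 3) (Fin 3) ℂ) :=
      congrArg Subtype.val (inv_mul_cancel_right y.2.1 (conjU y.1)).symm
    rw [this, hc, smul_mul_assoc, one_mul, coe_conjU]
  · have hm : ((y.1⁻¹ * conjU g * y.1 : UGrp 3) : Matrix (Fin 3) (Fin 3) ℂ).det = 1 := by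
      rw [UGrp.det_mul, UGrp.det_mul, mul_right_comm, ← UGrp.det_mul, inv_mul_cancel, hdet g hg]
      simp
    have h1 := hH.diagHom_mem hm
    have h2 := H.mul_mem (H.mul_mem (H.mul_mem hy h1) (H.inv_mem hy))
      (H.inv_mem (hH.diagHom_mem (hdet g hg)))
    refine Subgroup.mem_comap.mpr (Eq.mpr (congrArg (· ∈ H) ?_) h2)
    refine Prod.ext ?_ (Prod.ext ?_ ?_)
    · change 1 = y.1 * (y.1⁻¹ * conjU g * y.1) * y.1⁻¹ * (conjU g)⁻¹
      group
    · change y.2.1 * (conjU y.1)⁻¹ * g * (y.2.1 * (conjU y.1)⁻¹)⁻¹ * g⁻¹ =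
        y.2.1 * conjU (y.1⁻¹ * conjU g * y.1) * y.2.1⁻¹ * (conjU (conjU g))⁻¹
      rw [map_mul, map_mul, conjU_conjU, map_inv]
      group
    · change 1 = y.2.2 * 1 * y.2.2⁻¹ * 1⁻¹
      rw [mul_one, mul_inv_cancel, inv_one, mul_one]

/-- A group that contains the exchange gates and an element that is not correlated contains the
commutator subgroup. -/
theorem HasExchange.commutator_le {H : Subgroup Grp4} (hH : HasExchange H) {y : Grp4} (hy : y ∈ H)
    (hy' : ∀ c : ℂ, (y.2.1 : Matrix (Fin 3) (Fin 3) ℂ) ≠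
      c • (y.1 : Matrix (Fin 3) (Fin 3) ℂ).map star) :
    ⁅(⊤ : Subgroup Grp4), (⊤ : Subgroup Grp4)⁆ ≤ H := by
  rw [Subgroup.commutator_le]
  intro a _ b _
  have h1 := hH.diagHom_mem (UGrp.det_commutator a.1 b.1)
  have h2 := hH.incl211_mem hy hy' (g := (conjU ⁅a.1, b.1⁆)⁻¹ * ⁅a.2.1, b.2.1⁆) (by
    rw [← map_inv, UGrp.det_mul, conjU_det, UGrp.det_inv _ (UGrp.det_commutator _ _),
      UGrp.det_commutator, star_one, one_mul])
  have h3 := hH.incl22_mem (UGrp.det_commutator a.2.2.1 b.2.2.1)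
  -- The conjugate pair fixes (3,1), the second factor corrects (2,1,1), the third supplies (2,2),
  -- and commutators vanish in the one-dimensional blocks.
  convert H.mul_mem (H.mul_mem h1 h2) h3 using 1
  refine Prod.ext ?_ (Prod.ext ?_ (Prod.ext ?_ (Prod.ext ?_ ?_)))
  · change _ = ⁅a.1, b.1⁆ * 1 * 1
    rw [mul_one, mul_one]; rfl
  · change _ = conjU ⁅a.1, b.1⁆ * ((conjU ⁅a.1, b.1⁆)⁻¹ * ⁅a.2.1, b.2.1⁆) * 1
    rw [mul_inv_cancel_left, mul_one]; rfl
  · change _ = 1 * 1 * ⁅a.2.2.1, b.2.2.1⁆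
    rw [mul_one, one_mul]; rfl
  · change ⁅a.2.2.2.1, b.2.2.2.1⁆ = 1 * 1 * 1
    rw [commutatorElement_eq_one_iff_mul_comm.mpr (mul_comm _ _), mul_one, mul_one]
  · change ⁅a.2.2.2.2, b.2.2.2.2⁆ = 1 * 1 * 1
    rw [commutatorElement_eq_one_iff_mul_comm.mpr (mul_comm _ _), mul_one, mul_one]

end

/-! ### Three-qudit gates generated by exchange gates and phases -/

section

theorem rot_one (θ : ℝ) : rot θ (1 : ℂ) = Complex.exp (Complex.I * θ) := by
  rw [mul_comm, Complex.exp_mul_I, rot]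
  simp [mul_comm]

theorem rot_neg_one (θ : ℝ) : rot θ (-1 : ℂ) = Complex.exp (-(Complex.I * θ)) := by
  rw [show -(Complex.I * θ) = ((-θ : ℝ) : ℂ) * Complex.I by push_cast; ring, Complex.exp_mul_I, rot]
  simp [mul_comm]

open scoped commutatorElement

/-- On three qudits, the exchange gates and the global phases generate all unitaries of the group
algebra for which the determinant in `(2,1)` is the product of the phases in `(3)` and
`(1,1,1)`. -/
theorem mem_of_det_eq_mul {H : Subgroup Grp3}
    (hex : ∀ k l : Fin 3, k ≠ l → ∀ θ : ℝ, ∃ g ∈ H, toAlg3 g = rot θ (rep3 (Equiv.swap k l)))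
    (hsc : ∀ θ : ℝ, ∃ g ∈ H, toAlg3 g = Complex.exp (Complex.I * θ) • 1) {g : Grp3}
    (hg : (g.1 : Matrix (Fin 2) (Fin 2) ℂ).det = g.2.1 * g.2.2) : g ∈ H := by
  have hrot : ∀ k l : Fin 3, k ≠ l → ∀ θ : ℝ,
      HasMat (H.map (MonoidHom.fst _ _)) (rot θ (rep21 (Equiv.swap k l))) := fun k l hkl θ => by
    obtain ⟨g, hg, e⟩ := hex k l hkl θ
    rw [rep3_apply, rot_prod] at e
    exact ⟨g.1, ⟨g, hg, rfl⟩, congrArg (fun a => a.1) e⟩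
  have hL : ∀ u : UGrp 2, (u : Matrix (Fin 2) (Fin 2) ℂ).det = 1 → ∃ a ∈ H, a.1 = u :=
    fun u hu => Subgroup.mem_map.mp (hasMat_rep21 (hrot 0 1 (by decide))
      (hrot 1 2 (by decide)) hu)
  -- Commutators forget the phases, so SU(2) occurs with trivial components in (3) and (1,1,1).
  have hK : ∀ u : UGrp 2, (u : Matrix (Fin 2) (Fin 2) ℂ).det = 1 →
      u ∈ H.comap (MonoidHom.inl _ _) := fun u hu => by
    refine mem_of_commutator_mem (fun u v hu hv => ?_) u hu
    obtain ⟨a, ha, rfl⟩ := hL u hu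
    obtain ⟨b, hb, rfl⟩ := hL v hv
    have h1 : ⁅a, b⁆ ∈ H := H.mul_mem (H.mul_mem (H.mul_mem ha hb) (H.inv_mem ha)) (H.inv_mem hb)
    refine Subgroup.mem_comap.mpr (Eq.mpr (congrArg (· ∈ H) ?_) h1)
    exact Prod.ext rfl (commutatorElement_eq_one_iff_mul_comm.mpr (mul_comm a.2 b.2)).symm
  obtain ⟨α, hα⟩ := exists_unit_exp (Unitary.mem_iff.mp g.2.1.2).2
  obtain ⟨β, hβ⟩ := exists_unit_exp (Unitary.mem_iff.mp g.2.2.2).2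
  -- The global phase `(α + β)/2` and the exchange angle `(α - β)/2` add to `α` in (3) and subtract
  -- to `β` in (1,1,1). The determinant condition puts the remaining factor in SU(2).
  obtain ⟨s, hs, es⟩ := hsc ((α + β) / 2)
  obtain ⟨r, hr, er⟩ := hex 0 1 (by decide) ((α - β) / 2)
  have esr : toAlg3 (s * r) = toAlg3 s * toAlg3 r := map_mul _ _ _
  rw [es, er, smul_mul_assoc, one_mul, rep3_apply, rot_prod, rot_prod, sgnHom_swap (by decide),
    rot_neg_one, rot_one, rot_rep21_swap01] at esr
  have e1 : ((s * r).1 : Matrix (Fin 2) (Fin 2) ℂ) = _ := congrArg (fun a => a.1) esr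
  have e2 : ((s * r).2.1 : ℂ) = _ := congrArg (fun a => a.2.1) esr
  have e3 : ((s * r).2.2 : ℂ) = _ := congrArg (fun a => a.2.2) esr
  simp only [Prod.smul_fst, Prod.smul_snd, smul_eq_mul, ← Complex.exp_add] at e1 e2 e3
  have f2 : g.2.1 = (s * r).2.1 := Subtype.ext (by
    rw [e2, hα]; congr 1; push_cast; ring)
  have f3 : g.2.2 = (s * r).2.2 := Subtype.ext (by
    rw [e3, hβ]; congr 1; push_cast; ring)
  have hdet : ((s * r).1 : Matrix (Fin 2) (Fin 2) ℂ).det = g.2.1 * g.2.2 := by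
    rw [e1, Matrix.det_smul, su2_det (by rw [star_zero, mul_zero, add_zero]; exact exp_I_unit _), hα, hβ,
      Fintype.card_fin,
      mul_one, ← Complex.exp_nat_mul, ← Complex.exp_add]
    congr 1; push_cast; ring
  have h1 := hK (g.1 * (s * r).1⁻¹) (by
    have := congrArg (fun x : UGrp 2 => (x : Matrix (Fin 2) (Fin 2) ℂ).det)
      (mul_inv_cancel (s * r).1)
    simp only [UGrp.det_mul, hdet] at this
    rw [UGrp.det_mul, hg, this]; simp)
  have h2 := H.mul_mem (Subgroup.mem_comap.mp h1) (H.mul_mem hs hr)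
  refine Eq.mpr (congrArg (· ∈ H) ?_) h2
  refine Prod.ext (inv_mul_cancel_right g.1 (s * r).1).symm (Prod.ext ?_ ?_)
  · change _ = 1 * (s * r).2.1
    rw [one_mul, f2]
  · change _ = 1 * (s * r).2.2
    rw [one_mul, f3]

end

/-! ### Exchange gates and local gates as operators on qudits -/

section

/-- The homomorphism `(a, b) ↦ a (1 + s) / 2 + b (1 - s) / 2` given by an involution `s`. -/
def involutionHom {A : Type*} [Ring A] [Algebra ℂ A] (s : A) (hs : s * s = 1) : ℂ × ℂ →+* A where
  toFun z := ((z.1 + z.2) / 2) • (1 : A) + ((z.1 - z.2) / 2) • s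
  map_one' := by simp
  map_zero' := by simp
  map_add' x y := by
    simp only [Prod.fst_add, Prod.snd_add]
    module
  map_mul' x y := by
    simp only [mul_add, add_mul, smul_mul_smul_comm, one_mul, mul_one, hs, Prod.fst_mul,
      Prod.snd_mul]
    module

/-- The algebra generated by an involution is an image of `ℂ × ℂ`, where the exponential is computed
entrywise; a continuous homomorphism commutes with it. -/
theorem exp_smul_involution {d n : ℕ} {P : Op d n} (hP : P * P = 1) (θ : ℝ) :
    NormedSpace.exp ((Complex.I * (θ : ℂ)) • P) = rot θ P := by
  have hc : Continuous (involutionHom P hP) := by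
    change Continuous fun z : ℂ × ℂ => ((z.1 + z.2) / 2) • (1 : Op d n) + ((z.1 - z.2) / 2) • P
    fun_prop
  let : NormedRing (Op d n) := Matrix.linftyOpNormedRing
  let : NormedAlgebra ℚ (Op d n) := Matrix.linftyOpNormedAlgebra
  have h := NormedSpace.map_exp (involutionHom P hP) hc (Complex.I * θ, -(Complex.I * θ))
  have e : involutionHom P hP (Complex.I * θ, -(Complex.I * θ)) = (Complex.I * (θ : ℂ)) • P := by
    change ((Complex.I * (θ : ℂ) + -(Complex.I * θ)) / 2) • (1 : Op d n) +
      ((Complex.I * θ - -(Complex.I * θ)) / 2) • P = _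
    module
  rw [e] at h
  refine h.symm.trans ?_
  change (((NormedSpace.exp _ : ℂ × ℂ).1 + (NormedSpace.exp _ : ℂ × ℂ).2) / 2) • (1 : Op d n) +
      (((NormedSpace.exp _ : ℂ × ℂ).1 - (NormedSpace.exp _ : ℂ × ℂ).2) / 2) • P = _
  rw [Prod.fst_exp, Prod.snd_exp, ← Complex.exp_eq_exp_ℂ, rot, Complex.ofReal_cos,
    Complex.ofReal_sin, Complex.cos, Complex.sin]
  have hI := Complex.I_mul_I
  rw [mul_comm (θ : ℂ), neg_mul, mul_comm (θ : ℂ)]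
  match_scalars
  · ring
  · linear_combination (Complex.exp (Complex.I * θ) - Complex.exp (-(Complex.I * θ))) / 2 * hI

theorem permOp_mul_self_swap (d : ℕ) {n : ℕ} (i j : Fin n) :
    permOp d n (Equiv.swap i j) * permOp d n (Equiv.swap i j) = 1 := by
  rw [← permHom_apply, ← map_mul, Equiv.swap_mul_self, map_one]

theorem star_permOp_swap (d : ℕ) {n : ℕ} (i j : Fin n) :
    star (permOp d n (Equiv.swap i j)) = permOp d n (Equiv.swap i j) := by
  rw [Matrix.star_eq_conjTranspose, permOp_conjTranspose, Equiv.swap_inv]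

theorem exchangeGates_eq (d n : ℕ) : exchangeGates d n = {U : UnitaryGrp d n | ∃ (i j : Fin n) (θ : ℝ), i ≠ j ∧
    (U : Op d n) = (rot θ (permOp d n (Equiv.swap i j)) : Op d n)} := by
  ext U
  simp only [exchangeGates, Set.mem_ofPred_eq, exp_smul_involution (permOp_mul_self_swap d _ _)]

theorem star_rep4_swap (i j : Fin 4) : star (rep4 (Equiv.swap i j)) = rep4 (Equiv.swap i j) := by
  rw [star_rep4, Equiv.swap_inv]

theorem star_rep3_swap (i j : Fin 3) : star (rep3 (Equiv.swap i j)) = rep3 (Equiv.swap i j) := by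
  rw [star_rep3, Equiv.swap_inv]

theorem rep4_swap_mul_self (i j : Fin 4) :
    rep4 (Equiv.swap i j) * rep4 (Equiv.swap i j) = 1 := by
  rw [← map_mul, Equiv.swap_mul_self, map_one]

theorem hasExchange_comap {d : ℕ} {G : Subgroup (UnitaryGrp d 4)}
    (hG : exchangeGates d 4 ⊆ G) : HasExchange (G.comap (psi4 d)) := by
  intro i j hij θ
  obtain ⟨g, hg⟩ := exists_toAlg4
    (rot_mem_unitary θ (rep4_swap_mul_self i j) (star_rep4_swap i j))
  refine ⟨g, hG ?_, hg⟩
  rw [exchangeGates_eq]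
  refine ⟨i, j, θ, hij, ?_⟩
  rw [coe_psi4, hg, ← theta4_rep4]
  exact map_rot (theta4 d : Alg4 →ₐ[ℂ] Op d 4) θ _

/-! ### Gates on some of the qudits -/

section Local

variable {d k n : ℕ} (e : Fin k ↪ Fin n)

open Classical in
/-- `A ↦ A ⊗ 1` as a homomorphism of algebras. -/
def localHom : Op d k →ₐ[ℂ] Op d n where
  toFun := localOp d e
  map_one' := by rw [localOp_eq, Matrix.one_kronecker_one, Matrix.submatrix_one_equiv]
  map_zero' := by ext x y; simp [localOp]
  map_mul' A B := by
    rw [localOp_eq, localOp_eq, localOp_eq, Matrix.submatrix_mul_equiv, ← Matrix.mul_kronecker_mul,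
      mul_one]
  map_add' A B := by
    ext x y
    simp only [localOp, Matrix.of_apply, Matrix.add_apply]
    split_ifs <;> simp
  commutes' c := by
    rw [Algebra.algebraMap_eq_smul_one, Algebra.algebraMap_eq_smul_one, localOp_eq,
      Matrix.smul_kronecker, Matrix.one_kronecker_one]
    exact congrArg (fun M : Op d n => c • M) (Matrix.submatrix_one_equiv _)

theorem localHom_apply (A : Op d k) : localHom e A = localOp d e A := rfl

theorem localOp_permOp_swap (i j : Fin k) :
    localOp d e (permOp d k (Equiv.swap i j)) = permOp d n (Equiv.swap (e i) (e j)) := by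
  ext x y
  simp only [localOp, permOp, Matrix.of_apply]
  by_cases h : ∀ l, l ∉ Set.range e → x l = y l
  · rw [if_pos h]
    refine if_congr ⟨fun h' => ?_, fun h' => ?_⟩ rfl rfl
    · funext l
      by_cases hl : l ∈ Set.range e
      · obtain ⟨m, rfl⟩ := hl
        have := congrFun h' m
        simpa [e.swap_apply] using this
      · rw [← h l hl, Function.comp_apply, Equiv.swap_apply_of_ne_of_ne] <;> rintro rfl <;>
          exact hl ⟨_, rfl⟩
    · funext m
      simpa [e.swap_apply] using congrFun h' (e m)
  · rw [if_neg h, if_neg]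
    rintro rfl
    refine h fun l hl => ?_
    rw [Function.comp_apply, Equiv.swap_apply_of_ne_of_ne] <;> rintro rfl <;>
      exact hl ⟨_, rfl⟩

open Classical in
theorem tensorPow_eq_kronecker (u : Matrix (Fin d) (Fin d) ℂ) :
    tensorPow d n u = (tensorPow d k u ⊗ₖ
      (Matrix.of fun x y => ∏ j, u (x j) (y j) :
        Matrix ({j // ¬ j ∈ Set.range e} → Fin d) _ ℂ)).submatrix
        (splitEquiv d e) (splitEquiv d e) := by
  ext x y
  simp only [tensorPow, Matrix.of_apply, Matrix.submatrix_apply, Matrix.kroneckerMap_apply]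
  rw [← Fintype.prod_subtype_mul_prod_subtype (fun j => j ∈ Set.range e)
    (fun j => u (x j) (y j))]
  congr 1
  have h := (Equiv.ofInjective e e.injective).prod_comp fun j => u (x j) (y j)
  refine Eq.trans (by convert h.symm) (Finset.prod_congr rfl fun i _ => ?_)
  simp [splitEquiv, Equiv.piEquivPiSubtypeProd, Equiv.arrowCongr]

-- The tensor power of `u` factors over the chosen qudits and the others. As `det u ≠ 0`, the second
-- factor has a nonzero entry, a power of `u 0 b`, that can be cancelled.
open Classical in
theorem commute_localOp_tensorPow_iff (hd : 0 < d) (A : Op d k) {u : Matrix (Fin d) (Fin d) ℂ}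
    (hu : u.det ≠ 0) :
    Commute (localOp d e A) (tensorPow d n u) ↔ Commute A (tensorPow d k u) := by
  have h0 : ∃ b, u ⟨0, hd⟩ b ≠ 0 := by
    by_contra! h
    exact hu (Matrix.det_eq_zero_of_row_eq_zero _ h)
  obtain ⟨b, hb⟩ := h0
  rw [commute_iff_eq, commute_iff_eq, localOp_eq, tensorPow_eq_kronecker e,
    Matrix.submatrix_mul_equiv, Matrix.submatrix_mul_equiv, ← Matrix.mul_kronecker_mul,
    ← Matrix.mul_kronecker_mul, one_mul, mul_one]
  constructor
  · intro h
    ext x y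
    have := congrFun (congrFun h ((splitEquiv d e).symm (x, fun _ => ⟨0, hd⟩)))
      ((splitEquiv d e).symm (y, fun _ => b))
    simp only [Matrix.submatrix_apply, Equiv.apply_symm_apply, Matrix.kroneckerMap_apply,
      Matrix.of_apply, Finset.prod_const] at this
    exact mul_right_cancel₀ (pow_ne_zero _ hb) this
  · intro h
    rw [h]

theorem localGate_mem_iff (hd : 0 < d) (A : UnitaryGrp d k) :
    localGate d e A ∈ invariantGroup d n ↔ A ∈ invariantGroup d k := by
  refine forall₂_congr fun u hu => commute_localOp_tensorPow_iff e hd A ?_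
  rw [(Matrix.mem_specialUnitaryGroup_iff.mp hu).2]
  exact one_ne_zero

end Local

theorem rot_permOp_mem (d : ℕ) {n : ℕ} (i j : Fin n) (θ : ℝ) :
    rot θ (permOp d n (Equiv.swap i j)) ∈ Matrix.unitaryGroup (Fin n → Fin d) ℂ :=
  rot_mem_unitary θ (permOp_mul_self_swap d i j) (star_permOp_swap d i j)

theorem exchangeGates_subset_localGroup (d n : ℕ) :
    exchangeGates d n ⊆ localGroup d 2 n := by
  rw [exchangeGates_eq]
  rintro U ⟨i, j, θ, hij, hU⟩
  let e : Fin 2 ↪ Fin n := ⟨![i, j], by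
    intro a b; fin_cases a <;> fin_cases b <;> simp [hij, hij.symm]⟩
  have he : U = localGate d e ⟨_, rot_permOp_mem d 0 1 θ⟩ := Subtype.ext (by
    change (U : Op d n) = localHom e (rot θ (permOp d 2 (Equiv.swap 0 1)))
    rw [map_rot, localHom_apply, localOp_permOp_swap, hU]; rfl)
  refine Subgroup.subset_closure ⟨?_, e, _, he⟩
  rw [mem_invariantGroup_iff, hU]
  refine Submodule.add_mem _ (Submodule.smul_mem _ _ (Submodule.subset_span ⟨1, ?_⟩))
    (Submodule.smul_mem _ _ (Submodule.subset_span ⟨_, rfl⟩))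
  exact map_one (permHom d n)

theorem phase_mem {ι : Type*} [Fintype ι] [DecidableEq ι] (θ : ℝ) :
    Complex.exp (Complex.I * θ) • (1 : Matrix ι ι ℂ) ∈ Matrix.unitaryGroup ι ℂ := by
  rw [Matrix.mem_unitaryGroup_iff, star_smul, star_one, smul_mul_smul_comm, exp_I_unit, one_smul,
    mul_one]

theorem phase_mem_localGroup {d n : ℕ} (hn : 2 ≤ n) (θ : ℝ) :
    (⟨_, phase_mem θ⟩ : UnitaryGrp d n) ∈ localGroup d 2 n := by
  refine Subgroup.subset_closure ⟨?_, Fin.castLEEmb hn, ⟨_, phase_mem θ⟩, Subtype.ext ?_⟩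
  · intro u _
    exact (Commute.one_left _).smul_left _
  · change _ = localHom (Fin.castLEEmb hn) (Complex.exp (Complex.I * θ) • (1 : Op d 2))
    rw [map_smul, map_one]

end

/-! ### Existence and uniqueness of the components -/

section

/-- Intertwining relations for the group algebra of the symmetric group can be checked on the
adjacent transpositions. -/
theorem intertwine_of_swap {n : ℕ} {A : Type*} [Ring A] [Algebra ℂ A]
    {ρ : Equiv.Perm (Fin (n + 1)) →* A} (hρ : Algebra.adjoin ℂ (Set.range ρ) = ⊤) {m k : Type*}
    [Fintype m] [DecidableEq m] [Fintype k] [DecidableEq k] (F : A →ₐ[ℂ] Matrix m m ℂ)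
    (G : A →ₐ[ℂ] Matrix k k ℂ) (T : Matrix m k ℂ)
    (h : ∀ i : Fin n, F (ρ (Equiv.swap i.castSucc i.succ)) * T =
      T * G (ρ (Equiv.swap i.castSucc i.succ))) (a : A) : F a * T = T * G a := by
  have hmul : ∀ x y, F x * T = T * G x → F y * T = T * G y → F (x * y) * T = T * G (x * y) :=
    fun x y hx hy => by
      rw [map_mul, map_mul, Matrix.mul_assoc, hy, ← Matrix.mul_assoc, hx, Matrix.mul_assoc]
  have hσ : ∀ σ, F (ρ σ) * T = T * G (ρ σ) := fun σ => by
    have hs : σ ∈ Submonoid.closure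
        (Set.range fun i : Fin n => Equiv.swap i.castSucc i.succ) := by
      rw [Equiv.Perm.mclosure_swap_castSucc_succ]; trivial
    induction hs using Submonoid.closure_induction with
    | mem x hx => obtain ⟨i, rfl⟩ := hx; exact h i
    | one => simp
    | mul x y _ _ hx hy => rw [map_mul]; exact hmul _ _ hx hy
  have ha : a ∈ Algebra.adjoin ℂ (Set.range ρ) := hρ ▸ Algebra.mem_top
  induction ha using Algebra.adjoin_induction with
  | mem x hx => obtain ⟨σ, rfl⟩ := hx; exact hσ σ
  | algebraMap r => simp [Algebra.algebraMap_eq_smul_one]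
  | add x y _ _ hx hy => rw [map_add, map_add, Matrix.add_mul, Matrix.mul_add, hx, hy]
  | mul x y _ _ hx hy => exact hmul x y hx hy

/-- Conjugation by an orthogonal matrix. -/
def conjHom (O : Matrix (Fin 3) (Fin 3) ℂ) (hO : Oᵀ * O = 1) :
    Matrix (Fin 3) (Fin 3) ℂ →ₐ[ℂ] Matrix (Fin 3) (Fin 3) ℂ where
  toFun X := O * X * Oᵀ
  map_one' := by rw [mul_one, mul_eq_one_comm.mp hO]
  map_mul' X Y := by
    rw [show O * X * Oᵀ * (O * Y * Oᵀ) = O * X * (Oᵀ * O) * Y * Oᵀ by simp only [mul_assoc], hO,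
      mul_one]
    simp only [mul_assoc]
  map_zero' := by rw [mul_zero, zero_mul]
  map_add' X Y := by rw [mul_add, add_mul]
  commutes' c := by
    rw [Algebra.algebraMap_eq_smul_one, mul_smul_comm, mul_one, smul_mul_assoc,
      mul_eq_one_comm.mp hO]

theorem conjHom_apply (O : Matrix (Fin 3) (Fin 3) ℂ) (hO : Oᵀ * O = 1)
    (X : Matrix (Fin 3) (Fin 3) ℂ) : conjHom O hO X = O * X * Oᵀ := rfl

theorem conjHom_injective (O : Matrix (Fin 3) (Fin 3) ℂ) (hO : Oᵀ * O = 1) :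
    Function.Injective (conjHom O hO) := fun X Y h => by
  have h' := congrArg (fun M => Oᵀ * M * O) h
  have e : ∀ X, Oᵀ * (conjHom O hO X) * O = X := fun X => by
    rw [conjHom_apply, mul_assoc, mul_assoc (O * X), hO, mul_one, ← mul_assoc, hO, one_mul]
  rwa [e, e] at h'

theorem conjHom_map_star (O : Matrix (Fin 3) (Fin 3) ℂ) (hO : Oᵀ * O = 1) (hs : O.map star = O)
    (X : Matrix (Fin 3) (Fin 3) ℂ) : conjHom O hO (X.map star) = (conjHom O hO X).map star := by
  rw [conjHom_apply, conjHom_apply, map_star_mul, map_star_mul, hs, Matrix.transpose_map, hs]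

theorem sqrt2_sq : ((√2 : ℝ) : ℂ) ^ 2 = 2 := by
  rw [← Complex.ofReal_pow, Real.sq_sqrt (by norm_num)]; norm_num

/-- The change of basis between the monomial and Young's orthonormal basis of `(3,1)`. -/
def youngBasis : Matrix (Fin 3) (Fin 3) ℂ :=
  !![(√2 : ℝ) * (√3 : ℝ) / 3, -((√2 : ℝ) * (√3 : ℝ) / 6), (√2 : ℝ) * (√3 : ℝ) / 6;
    0, (√2 : ℝ) / 2, (√2 : ℝ) / 2;
    (√3 : ℝ) / 3, (√3 : ℝ) / 3, -((√3 : ℝ) / 3)]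

theorem youngBasis_mul_transpose : youngBasisᵀ * youngBasis = 1 := by
  have h2 := sqrt2_sq
  have h3 := sqrt3_sq
  rw [youngBasis]
  generalize ((√2 : ℝ) : ℂ) = r at *
  generalize ((√3 : ℝ) : ℂ) = s at *
  ext i j
  fin_cases i <;> fin_cases j <;> simp [Matrix.mul_apply, Fin.sum_univ_three] <;> grind

theorem youngBasis_map_star : youngBasis.map star = youngBasis := by
  ext i j
  fin_cases i <;> fin_cases j <;> simp [youngBasis, Complex.conj_ofNat]

theorem matJ_mul_transpose : matJᵀ * matJ = 1 := by
  ext i j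
  fin_cases i <;> fin_cases j <;> simp [matJ, Matrix.mul_apply, Fin.sum_univ_three]

theorem matJ_map_star : matJ.map star = matJ := by
  ext i j
  fin_cases i <;> fin_cases j <;> simp [matJ]

theorem conjHom_youngBasis_rep31 (k : Fin 3) :
    conjHom youngBasis youngBasis_mul_transpose (rep31 (Equiv.swap k.castSucc k.succ)) =
      young31 k := by
  have h2 := sqrt2_sq
  have h3 := sqrt3_sq
  rw [conjHom_apply, youngBasis, young31]
  generalize ((√2 : ℝ) : ℂ) = r at *
  generalize ((√3 : ℝ) : ℂ) = s at *
  fin_cases k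
  · change _ * rep31 (Equiv.swap 0 1) * _ = _
    rw [rep31_swap01]
    ext i j
    fin_cases i <;> fin_cases j <;>
      simp [Matrix.mul_apply, Fin.sum_univ_three, Matrix.vecHead, Matrix.vecTail] <;> grind
  · change _ * rep31 (Equiv.swap 1 2) * _ = _
    rw [rep31_swap12]
    ext i j
    fin_cases i <;> fin_cases j <;>
      simp [Matrix.mul_apply, Fin.sum_univ_three, Matrix.vecHead, Matrix.vecTail] <;> grind
  · change _ * rep31 (Equiv.swap 2 3) * _ = _
    rw [rep31_swap23]
    ext i j
    fin_cases i <;> fin_cases j <;>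
      simp [Matrix.mul_apply, Fin.sum_univ_three, Matrix.vecHead, Matrix.vecTail] <;> grind

theorem rep211_swap_eq {i j : Fin 4} (hij : i ≠ j) :
    rep211 (Equiv.swap i j) = -rep31 (Equiv.swap i j) := by
  have h : ∀ i j : Fin 4, i ≠ j →
      ∃ k l : Fin 3, pairingHom (Equiv.swap i j) = Equiv.swap k l ∧ k ≠ l := by decide
  obtain ⟨k, l, h1, h2⟩ := h i j hij
  exact rep211_swap h1 h2

/-- The component in the sector `(3,1)`, in Young's basis. -/
def comp31 : Alg4 →ₐ[ℂ] Matrix (Fin 3) (Fin 3) ℂ :=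
  (conjHom youngBasis youngBasis_mul_transpose).comp (AlgHom.fst ℂ _ _)

/-- The component in the sector `(2,1,1)`, in Young's basis. -/
def comp211 : Alg4 →ₐ[ℂ] Matrix (Fin 3) (Fin 3) ℂ :=
  ((conjHom matJ matJ_mul_transpose).comp (conjHom youngBasis youngBasis_mul_transpose)).comp
    ((AlgHom.fst ℂ _ _).comp (AlgHom.snd ℂ _ _))

theorem comp31_swap (k : Fin 3) :
    comp31 (rep4 (Equiv.swap k.castSucc k.succ)) = young31 k :=
  conjHom_youngBasis_rep31 k

theorem comp211_swap (k : Fin 3) :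
    comp211 (rep4 (Equiv.swap k.castSucc k.succ)) = young211 k := by
  change conjHom matJ matJ_mul_transpose
    (conjHom youngBasis youngBasis_mul_transpose (rep211 _)) = _
  rw [rep211_swap_eq (Fin.castSucc_lt_succ (i := k)).ne, map_neg, conjHom_youngBasis_rep31, map_neg,
    conjHom_apply, matJ_young31, neg_neg]

theorem isComponent_comp31 (d : ℕ) (a : Alg4) : IsComponent d young31 (theta4 d a) (comp31 a) :=
  fun T hT => intertwine_of_swap adjoin_rep4 (theta4 d : Alg4 →ₐ[ℂ] Op d 4) comp31 T
    (fun k => by rw [comp31_swap, ← hT k, ← theta4_rep4]; rfl) a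

theorem isComponent_comp211 (d : ℕ) (a : Alg4) :
    IsComponent d young211 (theta4 d a) (comp211 a) :=
  fun T hT => intertwine_of_swap adjoin_rep4 (theta4 d : Alg4 →ₐ[ℂ] Op d 4) comp211 T
    (fun k => by rw [comp211_swap, ← hT k, ← theta4_rep4]; rfl) a

/-! ### Uniqueness of the components -/

/-- A single injective intertwiner determines the component. Injectivity is certified by a left
inverse `L` of three of its rows, and `O` translates to Young's basis. -/
theorem isComponent_unique {d : ℕ} {ρ ρ' : Fin 3 → Matrix (Fin 3) (Fin 3) ℂ}
    {O : Matrix (Fin 3) (Fin 3) ℂ} (hO : Oᵀ * O = 1) (hρ : ∀ k, O * ρ' k * Oᵀ = ρ k)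
    {T : Matrix (Fin 4 → Fin d) (Fin 3) ℂ} (hT : IsIntertwiner d ρ' T)
    (r : Fin 3 → Fin 4 → Fin d) {L : Matrix (Fin 3) (Fin 3) ℂ} (hL : L * T.submatrix r id = 1)
    {V : Op d 4} {v w : Matrix (Fin 3) (Fin 3) ℂ} (hv : IsComponent d ρ V v)
    (hw : IsComponent d ρ V w) : v = w := by
  have hTO : IsIntertwiner d ρ (T * Oᵀ) := fun k => by
    rw [← Matrix.mul_assoc, hT k, ← hρ k, Matrix.mul_assoc, Matrix.mul_assoc, Matrix.mul_assoc O,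
      ← Matrix.mul_assoc Oᵀ, hO, Matrix.one_mul]
  have h := (hv _ hTO).symm.trans (hw _ hTO)
  have h' := congrArg (fun M => O * (L * M.submatrix r id)) h
  have e : ∀ v, O * (L * (T * Oᵀ * v).submatrix r id) = v := fun v => by
    change O * (L * (T.submatrix r id * Oᵀ * v)) = v
    rw [← Matrix.mul_assoc L, ← Matrix.mul_assoc L, hL, Matrix.one_mul, ← Matrix.mul_assoc,
      mul_eq_one_comm.mp hO, Matrix.one_mul]
  simpa only [e] using h'

theorem permOp_mul_of_equivariant {d : ℕ} {ι : Type*} [Fintype ι] (w : ι → (Fin 4 → Fin d) → ℂ)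
    (F : ι → Fin 3 → ℂ) {σ : Equiv.Perm (Fin 4)} {ρ : Matrix (Fin 3) (Fin 3) ℂ} (s : ι ≃ ι)
    (hw : ∀ x z, w x (z ∘ σ) = w (s x) z) (hF : ∀ x i, F x i = ∑ j, F (s x) j * ρ j i) :
    permOp d 4 σ * (Matrix.of fun z i => ∑ x, w x z * F x i) =
      (Matrix.of fun z i => ∑ x, w x z * F x i) * ρ := by
  ext z i
  rw [permOp_mul_apply, Matrix.mul_apply]
  simp only [Matrix.of_apply, hw, Finset.sum_mul]
  rw [Finset.sum_comm]
  refine Eq.trans ?_ (s.sum_comp fun x => ∑ j, w x z * F x j * ρ j i)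
  refine Finset.sum_congr rfl fun x _ => ?_
  rw [hF, Finset.mul_sum]
  exact Finset.sum_congr rfl fun j _ => (mul_assoc _ _ _).symm

theorem frame31_swap (k : Fin 3) : ∀ x i, frame31 x i =
    ∑ j, frame31 (Equiv.swap k.castSucc k.succ x) j *
      rep31 (Equiv.swap k.castSucc k.succ) j i := by
  intro x i
  fin_cases k
  · change _ = ∑ j, frame31 (Equiv.swap 0 1 x) j * rep31 (Equiv.swap 0 1) j i
    rw [rep31_swap01]
    fin_cases x <;> fin_cases i <;>
      simp [frame31, Fin.sum_univ_three, Equiv.swap_apply_def]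
  · change _ = ∑ j, frame31 (Equiv.swap 1 2 x) j * rep31 (Equiv.swap 1 2) j i
    rw [rep31_swap12]
    fin_cases x <;> fin_cases i <;>
      simp [frame31, Fin.sum_univ_three, Equiv.swap_apply_def]
  · change _ = ∑ j, frame31 (Equiv.swap 2 3 x) j * rep31 (Equiv.swap 2 3) j i
    rw [rep31_swap23]
    fin_cases x <;> fin_cases i <;>
      simp [frame31, Fin.sum_univ_three, Equiv.swap_apply_def]

theorem isComponent31_unique {d : ℕ} (hd : 2 ≤ d) {V : Op d 4}
    {v w : Matrix (Fin 3) (Fin 3) ℂ} (hv : IsComponent d young31 V v)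
    (hw : IsComponent d young31 V w) : v = w := by
  -- Basis strings with a letter 1 at a marked position carry the permutation representation on four
  -- points, which contains (3,1). The rows used below have a single 1, and `L` inverts the first
  -- three rows of the frame.
  let c : Fin 4 → (Fin 4 → Fin d) → ℂ := fun x z => if z x = ⟨1, by omega⟩ then 1 else 0
  have hc : ∀ (σ : Equiv.Perm (Fin 4)) x z, c x (z ∘ σ) = c (σ x) z := fun _ _ _ => rfl
  refine isComponent_unique youngBasis_mul_transpose conjHom_youngBasis_rep31
    (T := Matrix.of fun z i => ∑ x, c x z * frame31 x i)
    (fun k => permOp_mul_of_equivariant c frame31 (Equiv.swap k.castSucc k.succ) (hc _) ?_)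
    (fun x => Function.update (fun _ => ⟨0, by omega⟩) x.castSucc ⟨1, by omega⟩)
    (L := !![1 / 2, 1 / 2, 0; 1 / 2, 0, 1 / 2; 0, -1 / 2, -1 / 2]) ?_ hv hw
  · exact frame31_swap k
  · ext i j
    fin_cases i <;> fin_cases j <;>
      simp [c, Matrix.mul_apply, Fin.sum_univ_three, Fin.sum_univ_four, frame31,
        Function.update_apply] <;> norm_num

theorem isComponent211_unique {d : ℕ} (hd : 3 ≤ d) {V : Op d 4}
    {v w : Matrix (Fin 3) (Fin 3) ℂ} (hv : IsComponent d young211 V v)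
    (hw : IsComponent d young211 V w) : v = w := by
  have hO : (matJ * youngBasis)ᵀ * (matJ * youngBasis) = 1 := by
    rw [Matrix.transpose_mul, mul_assoc, ← mul_assoc matJᵀ, matJ_mul_transpose, one_mul,
      youngBasis_mul_transpose]
  have hρ : ∀ k : Fin 3, matJ * youngBasis * -rep31 (Equiv.swap k.castSucc k.succ) *
      (matJ * youngBasis)ᵀ = young211 k := fun k => by
    have h := comp211_swap k
    change matJ * (youngBasis * rep211 _ * youngBasisᵀ) * matJᵀ = _ at h
    rw [← h, rep211_swap_eq (Fin.castSucc_lt_succ (i := k)).ne, Matrix.transpose_mul]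
    simp only [mul_assoc]
  -- Marking a letter 1 and a letter 2, in a background of 0, is where `d ≥ 3` enters. The irrep
  -- (2,1,1) is the exterior square of (3,1), realized by the cross product, on which a reflection
  -- `R` acts by `det R · R = -R`.
  let c : Fin 4 × Fin 4 → (Fin 4 → Fin d) → ℂ := fun x z =>
    (if z x.1 = ⟨1, by omega⟩ then 1 else 0) * (if z x.2 = ⟨2, by omega⟩ then 1 else 0)
  have hc : ∀ (σ : Equiv.Perm (Fin 4)) x z, c x (z ∘ σ) = c (σ.prodCongr σ x) z :=
    fun _ _ _ => rfl
  let r : Fin 3 → Fin 4 → Fin d :=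
    ![![⟨1, by omega⟩, ⟨2, by omega⟩, ⟨0, by omega⟩, ⟨0, by omega⟩],
      ![⟨0, by omega⟩, ⟨0, by omega⟩, ⟨1, by omega⟩, ⟨2, by omega⟩],
      ![⟨1, by omega⟩, ⟨0, by omega⟩, ⟨2, by omega⟩, ⟨0, by omega⟩]]
  let F : Fin 4 × Fin 4 → Fin 3 → ℂ := fun x => crossProduct (frame31 x.1) (frame31 x.2)
  refine isComponent_unique hO hρ (T := Matrix.of fun z i => ∑ x, c x z * F x i)
    (fun k => permOp_mul_of_equivariant c F ((Equiv.swap k.castSucc k.succ).prodCongr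
      (Equiv.swap k.castSucc k.succ)) (hc _) ?_)
    r
    (L := !![-1 / 4, 1 / 4, -1 / 2; 1 / 4, 1 / 4, 0; -1 / 4, 1 / 4, 0]) ?_ hv hw
  · rintro ⟨x, y⟩ i
    have hx := frame31_swap k x
    have hy := frame31_swap k y
    change crossProduct (frame31 x) (frame31 y) i = ∑ j,
        crossProduct (frame31 (Equiv.swap k.castSucc k.succ x))
          (frame31 (Equiv.swap k.castSucc k.succ y)) j *
          (-rep31 (Equiv.swap k.castSucc k.succ)) j i
    generalize frame31 (Equiv.swap k.castSucc k.succ x) = u at *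
    generalize frame31 (Equiv.swap k.castSucc k.succ y) = v at *
    have key : ∀ R, rep31 (Equiv.swap k.castSucc k.succ) = R →
        (R = !![1, 0, 0; 0, 0, -1; 0, -1, 0] ∨ R = !![0, 1, 0; 1, 0, 0; 0, 0, 1] ∨
          R = !![1, 0, 0; 0, 0, 1; 0, 1, 0]) := by
      rintro R rfl
      fin_cases k
      exacts [Or.inl rep31_swap01, Or.inr (Or.inl rep31_swap12), Or.inr (Or.inr rep31_swap23)]
    generalize rep31 (Equiv.swap k.castSucc k.succ) = R at *
    rw [cross_apply, cross_apply]
    simp only [hx, hy, Fin.sum_univ_three]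
    rcases key R rfl with rfl | rfl | rfl <;> fin_cases i <;> simp <;> ring
  · have hT : ∀ p i, ∑ x, c x (r p) * F x i = F (![(0, 1), (2, 3), (0, 2)] p) i := fun p i => by
      rw [Finset.sum_eq_single (![(0, 1), (2, 3), (0, 2)] p)]
      · fin_cases p <;> simp [c, r]
      · rintro ⟨x, y⟩ - hxy
        have : c (x, y) (r p) = 0 := by
          revert hxy
          fin_cases p <;> fin_cases x <;> fin_cases y <;> simp [c, r]
        rw [this, zero_mul]
      · simp
    have h01 : F (0, 1) = ![0, 2, -2] := by
      change crossProduct ![1, 1, 1] ![1, -1, -1] = _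
      rw [cross_apply]
      simp only [Matrix.cons_val]
      norm_num
    have h23 : F (2, 3) = ![0, 2, 2] := by
      change crossProduct ![-1, 1, -1] ![-1, -1, 1] = _
      rw [cross_apply]
      simp only [Matrix.cons_val]
      norm_num
    have h02 : F (0, 2) = ![-2, 0, 2] := by
      change crossProduct ![1, 1, 1] ![-1, 1, -1] = _
      rw [cross_apply]
      simp only [Matrix.cons_val]
      norm_num
    ext i j
    rw [Matrix.mul_apply, Fin.sum_univ_three]
    simp only [Matrix.submatrix_apply, Matrix.of_apply, hT]
    fin_cases i <;> fin_cases j <;> simp [h01, h23, h02] <;> norm_num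

end

/-! ### The correlation as a criterion -/

section

theorem component31_eq {d : ℕ} (hd : 2 ≤ d) (a : Alg4) :
    component d young31 (theta4 d a) = comp31 a :=
  isComponent31_unique hd (Classical.epsilon_spec ⟨_, isComponent_comp31 d a⟩)
    (isComponent_comp31 d a)

theorem component211_eq {d : ℕ} (hd : 3 ≤ d) (a : Alg4) :
    component d young211 (theta4 d a) = comp211 a :=
  isComponent211_unique hd (Classical.epsilon_spec ⟨_, isComponent_comp211 d a⟩)
    (isComponent_comp211 d a)

theorem block31_eq {d : ℕ} (hd : 2 ≤ d) {a b : Alg4} (h : theta4 d a = theta4 d b) :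
    a.1 = b.1 :=
  conjHom_injective _ youngBasis_mul_transpose (isComponent31_unique hd (isComponent_comp31 d a)
    (h ▸ isComponent_comp31 d b))

/-- The map `theta4 d` can have a kernel, for instance the block (1,1,1,1) when `d = 3`, but this
block is still visible. -/
theorem block211_eq {d : ℕ} (hd : 3 ≤ d) {a b : Alg4} (h : theta4 d a = theta4 d b) :
    a.2.1 = b.2.1 :=
  conjHom_injective _ youngBasis_mul_transpose (conjHom_injective _ matJ_mul_transpose (isComponent211_unique hd
    (isComponent_comp211 d a) (h ▸ isComponent_comp211 d b)))

/-- The components in `(3,1)` and `(2,1,1)` are complex conjugates up to a factor. -/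
def PhaseCorrelated (g : Grp4) : Prop :=
  ∃ c : ℂ, (g.2.1 : Matrix (Fin 3) (Fin 3) ℂ) = c • (g.1 : Matrix (Fin 3) (Fin 3) ℂ).map star

theorem smul_map_star (c : ℂ) (A : Matrix (Fin 3) (Fin 3) ℂ) :
    (c • A).map star = star c • A.map star := by
  ext i j; simp

theorem map_star_map_star (A : Matrix (Fin 3) (Fin 3) ℂ) : (A.map star).map star = A := by
  ext i j; simp

theorem mul_star_eq_one_of_smul {u v : UGrp 3} {c : ℂ}
    (h : (u : Matrix (Fin 3) (Fin 3) ℂ) = c • (v : Matrix (Fin 3) (Fin 3) ℂ)) :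
    c * star c = 1 := by
  have h1 := u.mul_conjTranspose
  rw [h, Matrix.conjTranspose_smul, smul_mul_smul_comm, v.mul_conjTranspose] at h1
  simpa using congrFun (congrFun h1 0) 0

/-- The changes of basis are real and commute with conjugation, so the condition can be read in the
monomial basis. Unitarity makes any factor `c` a phase, and conjugating the relation exchanges the
roles of the two blocks with the same phase. -/
theorem breaksCorrelation_iff {d : ℕ} (hd : 3 ≤ d) (g : Grp4) :
    BreaksCorrelation d (psi4 d g) ↔ ¬ PhaseCorrelated g := by
  have key : ∀ φ : ℝ, matJ * component d young31 (psi4 d g) * matJᵀ =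
      Complex.exp (Complex.I * (φ : ℂ)) • (component d young211 (psi4 d g)).map star ↔
      (g.1 : Matrix (Fin 3) (Fin 3) ℂ) =
        Complex.exp (Complex.I * (φ : ℂ)) • (g.2.1 : Matrix (Fin 3) (Fin 3) ℂ).map star := by
    intro φ
    rw [coe_psi4, component31_eq (by omega), component211_eq hd]
    change conjHom matJ matJ_mul_transpose (conjHom youngBasis youngBasis_mul_transpose _) =
      _ • (conjHom matJ matJ_mul_transpose
        (conjHom youngBasis youngBasis_mul_transpose _)).map star ↔ _
    rw [← conjHom_map_star _ _ matJ_map_star, ← conjHom_map_star _ _ youngBasis_map_star,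
      ← map_smul, ← map_smul, (conjHom_injective _ _).eq_iff, (conjHom_injective _ _).eq_iff]
    rfl
  rw [BreaksCorrelation, ← not_exists, not_iff_not]
  simp only [key]
  constructor
  · rintro ⟨φ, h⟩
    refine ⟨Complex.exp (Complex.I * φ), ?_⟩
    rw [h, smul_map_star, map_star_map_star, smul_smul, exp_I_unit, one_smul]
  · rintro ⟨c, h⟩
    have hc : c * star c = 1 := mul_star_eq_one_of_smul (u := g.2.1) (v := conjU g.1) h
    obtain ⟨φ, hφ⟩ := exists_unit_exp hc
    refine ⟨φ, ?_⟩
    rw [← hφ, h, smul_map_star, map_star_map_star, smul_smul, hc, one_smul]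

theorem commutator_invariantGroup (d : ℕ) : ⁅invariantGroup d 4, invariantGroup d 4⁆ =
    (⁅(⊤ : Subgroup Grp4), (⊤ : Subgroup Grp4)⁆).map (psi4 d) := by
  rw [Subgroup.map_commutator, ← MonoidHom.range_eq_map, range_psi4]

theorem semiUniversal_of_not_phaseCorrelated {d : ℕ} {gates : Set (UnitaryGrp d 4)}
    (hG : exchangeGates d 4 ⊆ Subgroup.closure gates) {g : Grp4}
    (hg : psi4 d g ∈ Subgroup.closure gates) (hg' : ¬ PhaseCorrelated g) :
    SemiUniversal d 4 gates := by
  rw [SemiUniversal, commutator_invariantGroup, Subgroup.map_le_iff_le_comap]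
  exact (hasExchange_comap hG).commutator_le hg (not_exists.mp hg')

/-- The subgroup of the phase correlated elements. -/
def phaseCorrelatedSubgroup : Subgroup Grp4 where
  carrier := {g | PhaseCorrelated g}
  one_mem' := ⟨1, by
    rw [one_smul]
    exact congrArg Subtype.val (map_one conjU).symm⟩
  mul_mem' := by
    rintro a b ⟨c, hc⟩ ⟨c', hc'⟩
    refine ⟨c * c', ?_⟩
    change (a.2.1 : Matrix (Fin 3) (Fin 3) ℂ) * (b.2.1 : Matrix (Fin 3) (Fin 3) ℂ) =
      _ • ((a.1 : Matrix (Fin 3) (Fin 3) ℂ) * (b.1 : Matrix (Fin 3) (Fin 3) ℂ)).map star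
    rw [hc, hc', smul_mul_smul_comm, map_star_mul]
  inv_mem' := by
    rintro a ⟨c, hc⟩
    refine ⟨star c, ?_⟩
    change ((a.2.1⁻¹ : UGrp 3) : Matrix (Fin 3) (Fin 3) ℂ) =
      _ • ((a.1⁻¹ : UGrp 3) : Matrix (Fin 3) (Fin 3) ℂ).map star
    rw [UGrp.coe_inv, UGrp.coe_inv, hc, Matrix.conjTranspose_smul]
    rfl

theorem perm_fin_two (σ : Equiv.Perm (Fin 2)) : σ = 1 ∨ σ = Equiv.swap 0 1 := by
  revert σ; decide

theorem exists_eq_of_mem_invariantGroup_two {d : ℕ} {A : UnitaryGrp d 2}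
    (hA : A ∈ invariantGroup d 2) :
    ∃ a b : ℂ, (A : Op d 2) = a • 1 + b • permOp d 2 (Equiv.swap 0 1) := by
  rw [mem_invariantGroup_iff] at hA
  have h : Submodule.span ℂ (Set.range (permOp d 2)) ≤
      Submodule.span ℂ {1, permOp d 2 (Equiv.swap 0 1)} := by
    refine Submodule.span_mono ?_
    rintro _ ⟨σ, rfl⟩
    rcases perm_fin_two σ with rfl | rfl
    · exact Or.inl (map_one (permHom d 2))
    · exact Or.inr rfl
  obtain ⟨a, b, e⟩ := Submodule.mem_span_pair.mp (h hA)
  exact ⟨a, b, e.symm⟩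

/-- Unitarity of both `a + bR` and `a - bR` means `|a|² + |b|² = 1` and `Re(a conj b) = 0`, so `a ±
b` are phases. On the eigenspaces of `R` conjugation inverts them, and the factor `(a + b)(a - b)`
trades one for the other. -/
theorem phaseCorrelated_of_eq {g : Grp4} {a b : ℂ} {R : Matrix (Fin 3) (Fin 3) ℂ}
    (hR : R * R = 1) (hR' : Rᴴ = R) (hs : R.map star = R)
    (h1 : (g.1 : Matrix (Fin 3) (Fin 3) ℂ) = a • 1 + b • R)
    (h2 : (g.2.1 : Matrix (Fin 3) (Fin 3) ℂ) = a • 1 - b • R) : PhaseCorrelated g := by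
  have u1 := g.1.mul_conjTranspose
  have u2 := g.2.1.mul_conjTranspose
  rw [h1] at u1
  rw [h2] at u2
  simp only [Matrix.conjTranspose_add, Matrix.conjTranspose_sub, Matrix.conjTranspose_smul, hR',
    Matrix.conjTranspose_one, mul_add, add_mul, mul_sub, sub_mul, smul_mul_smul_comm, hR, one_mul,
    mul_one] at u1 u2
  have e1 : (a * star a + b * star b) • (1 : Matrix (Fin 3) (Fin 3) ℂ) = 1 := by
    linear_combination (norm := module) (2⁻¹ : ℂ) • u1 + (2⁻¹ : ℂ) • u2
  have e2 : (a * star b + b * star a) • R = 0 := by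
    linear_combination (norm := module) (2⁻¹ : ℂ) • u1 - (2⁻¹ : ℂ) • u2
  replace e2 := congrArg (· * R) e2
  simp only [smul_mul_assoc, hR, zero_mul] at e2
  have f1 : a * star a + b * star b = 1 := by simpa using congrFun (congrFun e1 0) 0
  have f2 : a * star b + b * star a = 0 := by simpa using congrFun (congrFun e2 0) 0
  refine ⟨(a + b) * (a - b), ?_⟩
  have e : (a • (1 : Matrix (Fin 3) (Fin 3) ℂ) + b • R).map star = star a • 1 + star b • R := by
    rw [show (a • (1 : Matrix (Fin 3) (Fin 3) ℂ) + b • R).map star =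
        (a • (1 : Matrix (Fin 3) (Fin 3) ℂ)).map star + (b • R).map star from
          Matrix.map_add star (star_add) _ _,
      smul_map_star, smul_map_star, hs, Matrix.map_one star (star_zero _) (star_one _)]
  rw [h1, h2, e]
  match_scalars
  · linear_combination (-a) * f1 + b * f2
  · linear_combination b * f1 - a * f2

theorem localGroup_le {d : ℕ} (hd : 3 ≤ d) :
    localGroup d 2 4 ≤ phaseCorrelatedSubgroup.map (psi4 d) := by
  rw [localGroup, Subgroup.closure_le]
  rintro U ⟨hU, e, A, rfl⟩
  have hA := (localGate_mem_iff e (by omega) A).mp hU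
  obtain ⟨a, b, hab⟩ := exists_eq_of_mem_invariantGroup_two hA
  rw [← range_psi4] at hU
  obtain ⟨g, hg⟩ := hU
  refine ⟨g, ?_, hg⟩
  have h01 : e 0 ≠ e 1 := fun h => by simpa using e.injective h
  have hθ : theta4 d (toAlg4 g) =
      theta4 d (a • 1 + b • rep4 (Equiv.swap (e 0) (e 1))) := by
    rw [← coe_psi4, hg, map_add, map_smul, map_smul, map_one, theta4_rep4, ← localOp_permOp_swap]
    change localHom e (A : Op d 2) = _
    rw [hab, map_add, map_smul, map_smul, map_one, localHom_apply]
  have h1 := block31_eq (by omega) hθ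
  have h2 := block211_eq hd hθ
  refine phaseCorrelated_of_eq (R := rep31 (Equiv.swap (e 0) (e 1))) (a := a) (b := b) ?_ ?_
    (rep31_map_star _) h1 ?_
  · rw [← map_mul, Equiv.swap_mul_self, map_one]
  · rw [← Matrix.star_eq_conjTranspose, star_rep31, Equiv.swap_inv]
  · refine h2.trans ?_
    change a • 1 + b • rep211 _ = _
    rw [rep211_swap_eq h01, smul_neg, sub_eq_add_neg]

theorem not_semiUniversal_of_phaseCorrelated {d : ℕ} (hd : 3 ≤ d) {g : Grp4}
    (hg : PhaseCorrelated g) :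
    ¬ SemiUniversal d 4 ({psi4 d g} ∪ (localGroup d 2 4 : Set (UnitaryGrp d 4))) := by
  intro h
  have hle : Subgroup.closure ({psi4 d g} ∪ (localGroup d 2 4 : Set (UnitaryGrp d 4))) ≤
      phaseCorrelatedSubgroup.map (psi4 d) := by
    rw [Subgroup.closure_le, Set.union_subset_iff, Set.singleton_subset_iff]
    exact ⟨⟨g, hg, rfl⟩, localGroup_le hd⟩
  rw [SemiUniversal, commutator_invariantGroup] at h
  -- The commutator of these elements is `diag(-1, 1, -1)`. Placed in (2,1,1) alone it faces the
  -- identity in (3,1), whose conjugate has only scalar multiples.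
  let w : UGrp 3 := ⟨cyc3, cyc3_mem⟩
  let t : UGrp 3 := ⟨su12 (-1) 0, su12_mem (by simp)⟩
  have hw : ((w * t * w⁻¹ * t⁻¹ : UGrp 3) : Matrix (Fin 3) (Fin 3) ℂ) =
      su23 (-1) 0 * su12 (-1) 0 := by
    change cyc3 * su12 (-1) 0 * ((w⁻¹ : UGrp 3) : Matrix (Fin 3) (Fin 3) ℂ) *
      ((t⁻¹ : UGrp 3) : Matrix (Fin 3) (Fin 3) ℂ) = _
    rw [UGrp.coe_inv, UGrp.coe_inv]
    change cyc3 * su12 (-1) 0 * cyc3ᴴ * (su12 (-1) 0)ᴴ = _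
    rw [cyc3_conj, su12_conjTranspose]
    simp
  obtain ⟨k, ⟨c, hc⟩, hk⟩ := hle (h ⟨_, Subgroup.commutator_mem_commutator
    (Subgroup.mem_top (incl211 w)) (Subgroup.mem_top (incl211 t)), rfl⟩)
  have hk' := congrArg Subtype.val hk
  rw [coe_psi4, coe_psi4] at hk'
  have h1 := block31_eq (by omega) hk'
  have h2 := block211_eq hd hk'
  have h1' : (k.1 : Matrix (Fin 3) (Fin 3) ℂ) = 1 := h1.trans (by
    change ((1 * 1 * 1⁻¹ * 1⁻¹ : UGrp 3) : Matrix (Fin 3) (Fin 3) ℂ) = 1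
    simp)
  have h2' : (k.2.1 : Matrix (Fin 3) (Fin 3) ℂ) = su23 (-1) 0 * su12 (-1) 0 := h2.trans hw
  rw [h1', h2', Matrix.map_one star (star_zero _) (star_one _)] at hc
  have i0 := congrFun (congrFun hc 0) 0
  have i1 := congrFun (congrFun hc 1) 1
  simp [su12, su23, Matrix.mul_apply, Fin.sum_univ_three] at i0 i1
  rw [← i0] at i1
  norm_num at i1

end

/-! ### Three-qudit gates seen on four qudits -/

section

/-- The embedding of `𝕊₃` in `𝕊₄` as the stabilizer of the last point. -/
def stabHom : Equiv.Perm (Fin 3) →* Equiv.Perm (Fin 4) :=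
  ((finSumFinEquiv (m := 3) (n := 1)).permCongrHom.toMonoidHom.comp
    (Equiv.Perm.sumCongrHom (Fin 3) (Fin 1))).comp (MonoidHom.inl _ _)

theorem stabHom_swap (i j : Fin 3) :
    stabHom (Equiv.swap i j) = Equiv.swap i.castSucc j.castSucc := by
  revert i j; decide

theorem exists_inclAlg : ∃ Θ : Alg3 →⋆ₐ[ℂ] Alg4, ∀ σ, Θ (rep3 σ) = rep4 (stabHom σ) := by
  obtain ⟨Θ, hΘ⟩ := exists_algHom_of_adjoin_eq_top rep3 adjoin_rep3 finrank_alg3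
    (rep4.comp stabHom)
  have h := map_star_of_adjoin_eq_top rep3 adjoin_rep3 (rep4.comp stabHom) star_rep3
    (fun σ => by
      rw [MonoidHom.comp_apply, MonoidHom.comp_apply, star_rep4, map_inv stabHom]) Θ hΘ
  exact ⟨{ Θ with map_star' := h }, hΘ⟩

/-- The inclusion of the group algebra of `𝕊₃` in that of `𝕊₄`. -/
def inclAlg : Alg3 →⋆ₐ[ℂ] Alg4 := exists_inclAlg.choose

theorem inclAlg_swap (i j : Fin 3) :
    inclAlg (rep3 (Equiv.swap i j)) = rep4 (Equiv.swap i.castSucc j.castSucc) := by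
  rw [inclAlg, exists_inclAlg.choose_spec, stabHom_swap]

/-- Both sides are homomorphisms of the group algebra of `𝕊₃`, so adjacent transpositions suffice;
equality is the intertwining relation with the identity. -/
theorem theta4_inclAlg (d : ℕ) (a : Alg3) :
    theta4 d (inclAlg a) = localOp d Fin.castSuccEmb (theta3 d a) := by
  have h := intertwine_of_swap adjoin_rep3
    ((theta4 d : Alg4 →ₐ[ℂ] Op d 4).comp (inclAlg : Alg3 →ₐ[ℂ] Alg4))
    ((localHom Fin.castSuccEmb).comp (theta3 d : Alg3 →ₐ[ℂ] Op d 3)) 1 (fun i => by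
      rw [Matrix.mul_one, Matrix.one_mul]
      change theta4 d (inclAlg _) = localHom _ (theta3 d _)
      rw [inclAlg_swap, theta4_rep4, theta3_rep3, localHom_apply, localOp_permOp_swap]
      rfl) a
  rwa [Matrix.mul_one, Matrix.one_mul] at h

/-- The block diagonal matrix with blocks of size two and one. -/
def blockHom : Matrix (Fin 2) (Fin 2) ℂ × ℂ →ₐ[ℂ] Matrix (Fin 3) (Fin 3) ℂ where
  toFun z := !![z.1 0 0, z.1 0 1, 0; z.1 1 0, z.1 1 1, 0; 0, 0, z.2]
  map_one' := by ext i j; fin_cases i <;> fin_cases j <;> simp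
  map_mul' x y := by
    ext i j
    fin_cases i <;> fin_cases j <;> simp [Matrix.mul_apply, Fin.sum_univ_succ]
  map_zero' := by ext i j; fin_cases i <;> fin_cases j <;> simp
  map_add' x y := by ext i j; fin_cases i <;> fin_cases j <;> simp
  commutes' c := by
    ext i j
    fin_cases i <;> fin_cases j <;> simp [Algebra.algebraMap_eq_smul_one]

theorem blockHom_apply (u : Matrix (Fin 2) (Fin 2) ℂ) (α : ℂ) :
    blockHom (u, α) = !![u 0 0, u 0 1, 0; u 1 0, u 1 1, 0; 0, 0, α] := rfl

/-- The branching rule: (3,1) restricts to (2,1) and (3), and Young's basis is adapted to the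
stabilizer of the last point. -/
theorem comp31_inclAlg (a : Alg3) : comp31 (inclAlg a) = blockHom (a.1, a.2.1) := by
  have h := intertwine_of_swap adjoin_rep3 (comp31.comp (inclAlg : Alg3 →ₐ[ℂ] Alg4))
    (blockHom.comp ((AlgHom.fst ℂ _ _).prod ((AlgHom.fst ℂ _ _).comp (AlgHom.snd ℂ _ _)))) 1
    (fun i => by
      rw [Matrix.mul_one, Matrix.one_mul]
      change comp31 (inclAlg _) = blockHom (rep21 _, 1)
      rw [inclAlg_swap]
      refine (comp31_swap i.castSucc).trans ?_
      fin_cases i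
      · refine Eq.trans ?_ (congrArg (fun A => blockHom (A, 1)) rep21_swap01.symm)
        simp [blockHom_apply, young31]
      · refine Eq.trans ?_ (congrArg (fun A => blockHom (A, 1)) rep21_swap12.symm)
        simp [blockHom_apply, young31]) a
  rwa [Matrix.mul_one, Matrix.one_mul] at h

theorem comp211_inclAlg (a : Alg3) : comp211 (inclAlg a) = blockHom (a.1, a.2.2) := by
  have h := intertwine_of_swap adjoin_rep3 (comp211.comp (inclAlg : Alg3 →ₐ[ℂ] Alg4))
    (blockHom.comp ((AlgHom.fst ℂ _ _).prod ((AlgHom.snd ℂ _ _).comp (AlgHom.snd ℂ _ _)))) 1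
    (fun i => by
      rw [Matrix.mul_one, Matrix.one_mul]
      change comp211 (inclAlg _) = blockHom (rep21 _, sgnHom 3 _)
      rw [inclAlg_swap, sgnHom_swap (Fin.castSucc_lt_succ (i := i)).ne]
      refine (comp211_swap i.castSucc).trans ?_
      fin_cases i
      · refine Eq.trans ?_ (congrArg (fun A => blockHom (A, -1)) rep21_swap01.symm)
        simp [blockHom_apply, young211]
      · refine Eq.trans ?_ (congrArg (fun A => blockHom (A, -1)) rep21_swap12.symm)
        simp [blockHom_apply, young211]) a
  rwa [Matrix.mul_one, Matrix.one_mul] at h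

theorem matJ_conj_block (p q r s α : ℂ) :
    matJ * !![p, q, 0; r, s, 0; 0, 0, α] * matJᵀ = !![s, -r, 0; -q, p, 0; 0, 0, α] := by
  ext i j
  fin_cases i <;> fin_cases j <;>
    simp [matJ, Matrix.mul_apply, Fin.sum_univ_three, Matrix.transpose_apply, -Matrix.cons_transpose]

/-- Conjugation by `J` replaces the block `u` by its cofactor matrix, which for unitary `u` is `det
u` times the conjugate of `u`. The correlation therefore forces `c = det u`, and the remaining entry
gives `β = c conj α`. -/
theorem det_eq_mul_of_phaseCorrelated {g : Grp3} {y : Grp4} (hy : toAlg4 y = inclAlg (toAlg3 g))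
    (h : PhaseCorrelated y) : (g.1 : Matrix (Fin 2) (Fin 2) ℂ).det = g.2.1 * g.2.2 := by
  obtain ⟨c, hc⟩ := h
  have h31 := comp31_inclAlg (toAlg3 g)
  have h211 := comp211_inclAlg (toAlg3 g)
  rw [← hy] at h31 h211
  change conjHom youngBasis youngBasis_mul_transpose (y.1 : Matrix (Fin 3) (Fin 3) ℂ) =
    blockHom ((g.1 : Matrix (Fin 2) (Fin 2) ℂ), (g.2.1 : ℂ)) at h31
  change conjHom matJ matJ_mul_transpose (conjHom youngBasis youngBasis_mul_transpose
    (y.2.1 : Matrix (Fin 3) (Fin 3) ℂ)) =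
      blockHom ((g.1 : Matrix (Fin 2) (Fin 2) ℂ), (g.2.2 : ℂ)) at h211
  rw [hc, map_smul, map_smul, conjHom_map_star _ _ youngBasis_map_star,
    conjHom_map_star _ _ matJ_map_star, h31, blockHom_apply, blockHom_apply, conjHom_apply,
    matJ_conj_block] at h211
  have hu := g.1.mul_conjTranspose
  have hα := (Unitary.mem_iff.mp g.2.1.2).2
  generalize (g.1 : Matrix (Fin 2) (Fin 2) ℂ) = u at *
  generalize (g.2.1 : ℂ) = α at *
  generalize (g.2.2 : ℂ) = β at *
  have i00 := congrFun (congrFun h211 0) 0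
  have i01 := congrFun (congrFun h211 0) 1
  have i22 := congrFun (congrFun h211 2) 2
  have iu := congrFun (congrFun hu 1) 1
  simp [-RCLike.star_def, -Complex.star_def] at i00 i01 i22
  simp [Matrix.mul_apply, -RCLike.star_def, -Complex.star_def] at iu
  rw [Matrix.det_fin_two, ← i00, ← i01, ← i22]
  linear_combination c * iu - c * hα

theorem mem_localGroup_of_det_eq {d : ℕ} {g : Grp3}
    (hg : (g.1 : Matrix (Fin 2) (Fin 2) ℂ).det = g.2.1 * g.2.2) :
    psi3 d g ∈ localGroup d 2 3 := by
  refine mem_of_det_eq_mul (H := (localGroup d 2 3).comap (psi3 d)) (fun k l hkl θ => ?_)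
    (fun θ => ?_) hg
  · obtain ⟨h, hh⟩ := exists_toAlg3
      (rot_mem_unitary θ (rep3_swap_mul_self k l) (star_rep3_swap k l))
    refine ⟨h, exchangeGates_subset_localGroup d 3 ?_, hh⟩
    rw [exchangeGates_eq]
    refine ⟨k, l, θ, hkl, ?_⟩
    rw [coe_psi3, hh, ← theta3_rep3]
    exact map_rot (theta3 d : Alg3 →ₐ[ℂ] Op d 3) θ _
  · have hu : Complex.exp (Complex.I * θ) • (1 : Alg3) ∈ unitary Alg3 := by
      have h := exp_I_unit θ
      rw [Unitary.mem_iff, star_smul, star_one, smul_mul_smul_comm, smul_mul_smul_comm,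
        mul_comm (star _), h, one_smul, mul_one]
      exact ⟨rfl, rfl⟩
    obtain ⟨h, hh⟩ := exists_toAlg3 hu
    refine ⟨h, ?_, hh⟩
    have e : psi3 d h = ⟨_, phase_mem θ⟩ := Subtype.ext (by
      rw [coe_psi3, hh, map_smul, map_one])
    rw [Subgroup.mem_comap, e]
    exact phase_mem_localGroup (by norm_num) θ

/-- A three-qudit gate that is not generated by two-qudit gates is not correlated. -/
theorem exists_not_phaseCorrelated {d : ℕ} {S : UnitaryGrp d 3} (hS : S ∈ invariantGroup d 3)
    (hS' : S ∉ localGroup d 2 3) :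
    ∃ y : Grp4, psi4 d y = localGate d Fin.castSuccEmb S ∧ ¬ PhaseCorrelated y := by
  rw [← range_psi3] at hS
  obtain ⟨g, rfl⟩ := hS
  obtain ⟨y, hy⟩ := exists_toAlg4 (Unitary.map_mem inclAlg (toAlg3_mem g))
  refine ⟨y, Subtype.ext ?_, fun h => hS' (mem_localGroup_of_det_eq
    (det_eq_mul_of_phaseCorrelated hy h))⟩
  rw [coe_psi4, hy, theta4_inclAlg]
  rfl

end

end QuditCircuit

end

theorem mainTheorem9 (d : ℕ) (hd : 2 ≤ d) :
    (3 ≤ d → ∀ Y ∈ QuditCircuit.invariantGroup d 4,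
      (∃! v, QuditCircuit.IsComponent d QuditCircuit.young31 Y v) ∧
      (∃! v, QuditCircuit.IsComponent d QuditCircuit.young211 Y v) ∧
      (QuditCircuit.SemiUniversal d 4 ({Y} ∪ QuditCircuit.localGroup d 2 4) ↔
        QuditCircuit.BreaksCorrelation d Y)) ∧
    (∀ S ∈ QuditCircuit.invariantGroup d 3, S ∉ QuditCircuit.localGroup d 2 3 →
      (3 ≤ d → QuditCircuit.BreaksCorrelation d
        (QuditCircuit.localGate d (Fin.castSuccEmb (n := 3)) S)) ∧
      QuditCircuit.SemiUniversal d 4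
        ({QuditCircuit.localGate d (Fin.castSuccEmb (n := 3)) S} ∪
          QuditCircuit.localGroup d 2 4) ∧
      QuditCircuit.SemiUniversal d 4
        ({QuditCircuit.localGate d (Fin.castSuccEmb (n := 3)) S} ∪
          QuditCircuit.exchangeGates d 4)) := by
  open QuditCircuit in
  have hex : ∀ Y, exchangeGates d 4 ⊆
      Subgroup.closure ({Y} ∪ (localGroup d 2 4 : Set (UnitaryGrp d 4))) := fun Y =>
    (exchangeGates_subset_localGroup d 4).trans
      (Set.subset_union_right.trans Subgroup.subset_closure)
  refine ⟨fun hd3 Y hY => ?_, fun S hS hS' => ?_⟩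
  · rw [← range_psi4] at hY
    obtain ⟨y, rfl⟩ := hY
    refine ⟨⟨_, isComponent_comp31 d _, fun v hv =>
        isComponent31_unique hd hv (isComponent_comp31 d _)⟩,
      ⟨_, isComponent_comp211 d _, fun v hv =>
        isComponent211_unique hd3 hv (isComponent_comp211 d _)⟩, ?_⟩
    rw [breaksCorrelation_iff hd3]
    exact ⟨fun h h' => not_semiUniversal_of_phaseCorrelated hd3 h' h, fun h =>
      semiUniversal_of_not_phaseCorrelated (hex _) (Subgroup.subset_closure (Or.inl rfl)) h⟩
  · obtain ⟨y, hy, hy'⟩ := exists_not_phaseCorrelated hS hS'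
    rw [← hy]
    exact ⟨fun hd3 => (breaksCorrelation_iff hd3 y).mpr hy',
      semiUniversal_of_not_phaseCorrelated (hex _) (Subgroup.subset_closure (Or.inl rfl)) hy',
      semiUniversal_of_not_phaseCorrelated (Set.subset_union_right.trans Subgroup.subset_closure)
        (Subgroup.subset_closure (Or.inl rfl)) hy'⟩
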